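/- Let $n\ge 1$, $d\ge 0$, $r\ge 0$ and $s$ be integers with $s>\tfrac n2+1$. For an integer $k\ge 0$ let $H^k(\mathbb R^n,\mathbb R)$ be the Hilbert space of all $g\in L^2(\mathbb R^n,\mathbb R)$ whose distributional derivatives $\partial^\alpha g$, $|\alpha|\le k$, are in $L^2(\mathbb R^n,\mathbb R)$, with the norm $\|g\|_k=\big(\sum_{|\alpha|\le k}\int_{\mathbb R^n}|\partial^\alpha g|^2\,dx\big)^{1/2}$, and let $H^k(\mathbb R^n,\mathbb R^d)$ be the space of $f=(f_1,\dots,f_d)$ with $f_i\in H^k(\mathbb R^n,\mathbb R)$, with the norm $\|f\|_k=\big(\sum_{i=1}^d\|f_i\|_k^2\big)^{1/2}$. Let $\mathrm{Diff}^1_+(\mathbb R^n)$ be the set of bijective $C^1$ maps $\varphi:\mathbb R^n\to\mathbb R^n$ such that $\varphi^{-1}$ is $C^1$ and $\det(d_x\varphi)>0$ for all $x\in\mathbb R^n$, and for an integer $k>\tfrac n2+1$ let $$\mathcal D^k(\mathbb R^n)=\{\varphi\in\mathrm{Diff}^1_+(\mathbb R^n)\;:\;\varphi-\mathrm{id}\in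 H^k(\mathbb R^n,\mathbb R^n)\}.$$ The sets $\mathcal D^{s}(\mathbb R^n)-\mathrm{id}$ and $\mathcal D^{s+r}(\mathbb R^n)-\mathrm{id}$ are open in $H^{s}(\mathbb R^n,\mathbb R^n)$ and $H^{s+r}(\mathbb R^n,\mathbb R^n)$ respectively, so that $\varphi\mapsto\varphi-\mathrm{id}$ is a global chart that makes each of $\mathcal D^{s}(\mathbb R^n)$ and $\mathcal D^{s+r}(\mathbb R^n)$ a Hilbert manifold. With respect to these structures, the maps $$\mu:H^{s+r}(\mathbb R^n,\mathbb R^d)\times\mathcal D^s(\mathbb R^n)\to H^s(\mathbb R^n,\mathbb R^d),\qquad (u,\varphi)\mapsto u\circ\varphi,$$ and $$\mathrm{inv}:\mathcal D^{s+r}(\mathbb R^n)\to\mathcal D^s(\mathbb R^n),\qquad \varphi\mapsto\varphi^{-1},$$ are well defined (that is, $u\circ\varphi\in H^s(\mathbb R^n,\mathbb R^d)$ and $\varphi^{-1}\in\mathcal D^s(\mathbb R^n)$) and are of class $C^r$. -/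

import Mathlib

open MeasureTheory Filter Topology
open scoped LineDeriv Distributions

noncomputable section

namespace SobolevDiff

/-- Euclidean space `ℝⁿ`. -/
abbrev E (n : ℕ) : Type := EuclideanSpace ℝ (Fin n)

/-- Real-valued test functions on `ℝⁿ`, i.e. `C_c^∞(ℝⁿ, ℝ)`. -/
abbrev TestFn (n : ℕ) : Type := TestFunction (⊤ : TopologicalSpace.Opens (E n)) ℝ ⊤

/-- The Hilbert space `L²(ℝⁿ, ℝ)`. -/
abbrev L2 (n : ℕ) : Type := Lp ℝ 2 (volume : Measure (E n))

/-- The length `|α| = α₁ + ⋯ + αₙ` of a multi-index. -/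
def len {n : ℕ} (α : Fin n → ℕ) : ℕ := ∑ i, α i

/-- The finite set of multi-indices `α` with `|α| ≤ s`. -/
def multiIndices (n s : ℕ) : Finset (Fin n → ℕ) :=
  (Fintype.piFinset fun _ => Finset.range (s + 1)).filter fun α => len α ≤ s

theorem mem_multiIndices {n s : ℕ} {α : Fin n → ℕ} : α ∈ multiIndices n s ↔ len α ≤ s := by
  simp only [multiIndices, Finset.mem_filter, Fintype.mem_piFinset, Finset.mem_range,
    and_iff_right_iff_imp]
  intro h i
  have : α i ≤ len α := Finset.single_le_sum (fun _ _ => Nat.zero_le _) (Finset.mem_univ i)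
  omega

/-- The partial derivative `∂^α η = ∂₁^{α₁} ⋯ ∂ₙ^{αₙ} η` of a test function. -/
def testDeriv {n : ℕ} (α : Fin n → ℕ) (η : TestFn n) : TestFn n :=
  (List.finRange n).foldr
    (fun i ψ => (fun χ : TestFn n => ∂_{(EuclideanSpace.single i (1 : ℝ) : E n)} χ)^[α i] ψ) η

/-- `h` is the distributional derivative `∂^α g` of `g`:
`∫ g ∂^α η = (-1)^{|α|} ∫ h η` for every test function `η`. -/
def IsWeakDeriv {n : ℕ} (α : Fin n → ℕ) (g h : L2 n) : Prop :=
  ∀ η : TestFn n, ∫ x, g x * testDeriv α η x = (-1) ^ len α * ∫ x, h x * η x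

theorem memLp_testFn {n : ℕ} (η : TestFn n) : MemLp (fun x => η x) 2 (volume : Measure (E n)) :=
  η.contDiff.continuous.memLp_of_hasCompactSupport η.hasCompactSupport

theorem integrable_mul_testFn {n : ℕ} (g : L2 n) (η : TestFn n) :
    Integrable (fun x => g x * η x) (volume : Measure (E n)) :=
  (Lp.memLp g).integrable_mul (memLp_testFn η)

theorem integral_add_mul {n : ℕ} (g g' : L2 n) (η : TestFn n) :
    ∫ x, (g + g') x * η x = (∫ x, g x * η x) + ∫ x, g' x * η x := by
  rw [← integral_add (integrable_mul_testFn g η) (integrable_mul_testFn g' η)]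
  refine integral_congr_ae ?_
  filter_upwards [Lp.coeFn_add g g'] with x hx
  rw [hx, Pi.add_apply, add_mul]

theorem integral_smul_mul {n : ℕ} (c : ℝ) (g : L2 n) (η : TestFn n) :
    ∫ x, (c • g) x * η x = c * ∫ x, g x * η x := by
  rw [← integral_const_mul]
  refine integral_congr_ae ?_
  filter_upwards [Lp.coeFn_smul c g] with x hx
  rw [hx, Pi.smul_apply, smul_eq_mul, mul_assoc]

theorem IsWeakDeriv.add {n : ℕ} {α : Fin n → ℕ} {g h g' h' : L2 n}
    (H : IsWeakDeriv α g h) (H' : IsWeakDeriv α g' h') : IsWeakDeriv α (g + g') (h + h') := by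
  intro η
  rw [integral_add_mul, integral_add_mul, H η, H' η, mul_add]

theorem IsWeakDeriv.smul {n : ℕ} {α : Fin n → ℕ} {g h : L2 n} (c : ℝ)
    (H : IsWeakDeriv α g h) : IsWeakDeriv α (c • g) (c • h) := by
  intro η
  rw [integral_smul_mul, integral_smul_mul, H η]
  ring

theorem IsWeakDeriv.zero {n : ℕ} (α : Fin n → ℕ) : IsWeakDeriv α (0 : L2 n) 0 := by
  intro η
  have h0 := integral_smul_mul (0 : ℝ) (0 : L2 n)
  simp only [zero_smul, zero_mul] at h0
  rw [h0, h0, mul_zero]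

/-- Distributional derivatives are unique. -/
theorem IsWeakDeriv.unique {n : ℕ} {α : Fin n → ℕ} {g h h' : L2 n}
    (H : IsWeakDeriv α g h) (H' : IsWeakDeriv α g h') : h = h' := by
  apply Lp.ext
  refine ae_eq_of_integral_contDiff_smul_eq
    ((Lp.memLp h).locallyIntegrable (by norm_num))
    ((Lp.memLp h').locallyIntegrable (by norm_num)) ?_
  intro η hη hc
  have key := (H ⟨η, hη, hc, by simp⟩).symm.trans (H' ⟨η, hη, hc, by simp⟩)
  have key' := mul_left_cancel₀ (pow_ne_zero _ (by norm_num)) key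
  simpa [mul_comm] using key'

theorem IsWeakDeriv.self {n : ℕ} (g : L2 n) : IsWeakDeriv (fun _ => 0) g g := by
  intro η
  have : testDeriv (fun _ => 0) η = η := by
    unfold testDeriv
    induction List.finRange n with
    | nil => rfl
    | cons a l ih => exact ih
  simp [this, len]

/-- The functions `g ∈ L²(ℝⁿ, ℝ)` all of whose distributional derivatives `∂^α g`, `|α| ≤ s`,
are in `L²(ℝⁿ, ℝ)`. -/
def sobolevSubmodule (n s : ℕ) : Submodule ℝ (L2 n) where
  carrier := {g | ∀ α : Fin n → ℕ, len α ≤ s → ∃ h : L2 n, IsWeakDeriv α g h}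
  add_mem' := by
    intro g g' hg hg' α hα
    obtain ⟨h, H⟩ := hg α hα
    obtain ⟨h', H'⟩ := hg' α hα
    exact ⟨h + h', H.add H'⟩
  zero_mem' := fun α _ => ⟨0, IsWeakDeriv.zero α⟩
  smul_mem' := by
    intro c g hg α hα
    obtain ⟨h, H⟩ := hg α hα
    exact ⟨c • h, H.smul c⟩

/-- The Sobolev space `H^s(ℝⁿ, ℝ)` (a type of its own, since it carries the `H^s`-norm and not
the norm of `L²`). -/
def Sobolev (n s : ℕ) : Type := sobolevSubmodule n s

instance instAddCommGroupSobolev (n s : ℕ) : AddCommGroup (Sobolev n s) :=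
  inferInstanceAs (AddCommGroup (sobolevSubmodule n s))

instance instModuleSobolev (n s : ℕ) : Module ℝ (Sobolev n s) :=
  inferInstanceAs (Module ℝ (sobolevSubmodule n s))

/-- The inclusion `H^s(ℝⁿ, ℝ) → L²(ℝⁿ, ℝ)`. -/
def Sobolev.toL2 {n s : ℕ} : Sobolev n s →ₗ[ℝ] L2 n := (sobolevSubmodule n s).subtype

open Classical in
/-- The distributional derivative `∂^α g ∈ L²(ℝⁿ, ℝ)` (zero if there is none in `L²`). -/
def weakDeriv {n : ℕ} (α : Fin n → ℕ) (g : L2 n) : L2 n :=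
  if H : ∃ h : L2 n, IsWeakDeriv α g h then H.choose else 0

theorem IsWeakDeriv.weakDeriv_eq {n : ℕ} {α : Fin n → ℕ} {g h : L2 n} (H : IsWeakDeriv α g h) :
    weakDeriv α g = h := by
  have H' : ∃ h : L2 n, IsWeakDeriv α g h := ⟨h, H⟩
  rw [weakDeriv, dif_pos H']
  exact H'.choose_spec.unique H

theorem Sobolev.isWeakDeriv {n s : ℕ} (f : Sobolev n s) {α : Fin n → ℕ} (hα : len α ≤ s) :
    IsWeakDeriv α f.toL2 (weakDeriv α f.toL2) := by
  obtain ⟨h, H⟩ := f.2 α hα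
  have H' : IsWeakDeriv α f.toL2 h := H
  rwa [H'.weakDeriv_eq]

theorem Sobolev.weakDeriv_add {n s : ℕ} (f g : Sobolev n s) {α : Fin n → ℕ} (hα : len α ≤ s) :
    weakDeriv α (f + g).toL2 = weakDeriv α f.toL2 + weakDeriv α g.toL2 := by
  rw [map_add]
  exact ((f.isWeakDeriv hα).add (g.isWeakDeriv hα)).weakDeriv_eq

theorem Sobolev.weakDeriv_smul {n s : ℕ} (c : ℝ) (f : Sobolev n s) {α : Fin n → ℕ}
    (hα : len α ≤ s) : weakDeriv α (c • f).toL2 = c • weakDeriv α f.toL2 := by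
  rw [map_smul]
  exact ((f.isWeakDeriv hα).smul c).weakDeriv_eq

theorem integrable_mul {n : ℕ} (a b : L2 n) :
    Integrable (fun x => a x * b x) (volume : Measure (E n)) :=
  (Lp.memLp a).integrable_mul (Lp.memLp b)

theorem eq_zero_of_integral_mul_self {n : ℕ} (a : L2 n) (h : ∫ x, a x * a x = 0) : a = 0 := by
  have h2 := (integral_eq_zero_iff_of_nonneg (fun x => mul_self_nonneg (a x))
    (integrable_mul a a)).1 h
  apply Lp.ext
  filter_upwards [h2, Lp.coeFn_zero ℝ 2 (volume : Measure (E n))] with x hx hx0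
  rw [hx0]
  exact mul_self_eq_zero.1 hx

/-- The inner product of `H^s(ℝⁿ, ℝ)`, `⟨f, g⟩ = ∑_{|α| ≤ s} ∫ ∂^α f ∂^α g`. -/
def sobolevInner {n s : ℕ} (f g : Sobolev n s) : ℝ :=
  ∑ α ∈ multiIndices n s, ∫ x, weakDeriv α f.toL2 x * weakDeriv α g.toL2 x

theorem sobolevInner_comm {n s : ℕ} (f g : Sobolev n s) :
    sobolevInner f g = sobolevInner g f := by
  exact Finset.sum_congr rfl fun α _ => integral_congr_ae (ae_of_all _ fun x => mul_comm _ _)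

theorem sobolevInner_self_nonneg {n s : ℕ} (f : Sobolev n s) : 0 ≤ sobolevInner f f :=
  Finset.sum_nonneg fun _ _ => integral_nonneg fun _ => mul_self_nonneg _

theorem sobolevInner_add_left {n s : ℕ} (f g h : Sobolev n s) :
    sobolevInner (f + g) h = sobolevInner f h + sobolevInner g h := by
  unfold sobolevInner
  rw [← Finset.sum_add_distrib]
  refine Finset.sum_congr rfl fun α hα => ?_
  rw [f.weakDeriv_add g (mem_multiIndices.1 hα),
    ← integral_add (integrable_mul _ _) (integrable_mul _ _)]
  refine integral_congr_ae ?_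
  filter_upwards [Lp.coeFn_add (weakDeriv α f.toL2) (weakDeriv α g.toL2)] with x hx
  rw [hx, Pi.add_apply, add_mul]

theorem sobolevInner_smul_left {n s : ℕ} (c : ℝ) (f g : Sobolev n s) :
    sobolevInner (c • f) g = c * sobolevInner f g := by
  unfold sobolevInner
  rw [Finset.mul_sum]
  refine Finset.sum_congr rfl fun α hα => ?_
  rw [f.weakDeriv_smul c (mem_multiIndices.1 hα), ← integral_const_mul]
  refine integral_congr_ae ?_
  filter_upwards [Lp.coeFn_smul c (weakDeriv α f.toL2)] with x hx
  rw [hx, Pi.smul_apply, smul_eq_mul, mul_assoc]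

theorem sobolevInner_definite {n s : ℕ} (f : Sobolev n s) (hf : sobolevInner f f = 0) :
    f = 0 := by
  have h0 : (fun _ => 0 : Fin n → ℕ) ∈ multiIndices n s := by
    rw [mem_multiIndices]
    simp [len]
  have h1 := (Finset.sum_eq_zero_iff_of_nonneg fun α _ =>
    integral_nonneg fun x => mul_self_nonneg (weakDeriv α f.toL2 x)).1 hf _ h0
  rw [(IsWeakDeriv.self f.toL2).weakDeriv_eq] at h1
  exact Subtype.ext (eq_zero_of_integral_mul_self f.toL2 h1)

/-- The inner product space structure of `H^s(ℝⁿ, ℝ)`; its norm is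
`‖f‖ = (∑_{|α| ≤ s} ∫ |∂^α f|²)^{1/2}`. -/
@[reducible] def sobolevCore (n s : ℕ) : InnerProductSpace.Core ℝ (Sobolev n s) where
  inner f g := sobolevInner f g
  conj_inner_symm f g := sobolevInner_comm g f
  re_inner_nonneg f := sobolevInner_self_nonneg f
  add_left f g h := sobolevInner_add_left f g h
  smul_left f g c := sobolevInner_smul_left c f g
  definite f hf := sobolevInner_definite f hf

instance instNormedAddCommGroupSobolev (n s : ℕ) : NormedAddCommGroup (Sobolev n s) :=
  (sobolevCore n s).toNormedAddCommGroup

instance instInnerProductSpaceSobolev (n s : ℕ) : InnerProductSpace ℝ (Sobolev n s) :=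
  InnerProductSpace.ofCore (sobolevCore n s).toCore

theorem Sobolev.norm_eq {n s : ℕ} (f : Sobolev n s) :
    ‖f‖ = Real.sqrt (∑ α ∈ multiIndices n s, ∫ x, |weakDeriv α f.toL2 x| ^ 2) := by
  have h : ‖f‖ = Real.sqrt (sobolevInner f f) := rfl
  rw [h]
  simp only [sobolevInner, pow_two, abs_mul_abs_self]

/-- The Sobolev space `H^s(ℝⁿ, ℝᵈ)` of `d`-tuples of elements of `H^s(ℝⁿ, ℝ)`, with the norm
`‖f‖ = (∑ᵢ ‖fᵢ‖²)^{1/2}`. -/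
abbrev SobolevVec (n d s : ℕ) : Type := PiLp 2 fun _ : Fin d => Sobolev n s

/-- The map `ℝⁿ → ℝᵈ`, determined up to a null set, that an element of `H^s(ℝⁿ, ℝᵈ)` stands
for. -/
def toMap {n d s : ℕ} (u : SobolevVec n d s) : E n → E d :=
  fun x => WithLp.toLp 2 fun i => (u i).toL2 x

/-- `Diff¹₊(ℝⁿ)`: the bijections `φ` of `ℝⁿ` such that `φ` and `φ⁻¹` are `C¹` and
`det (d_x φ) > 0` for every `x`. -/
structure IsDiffeo {n : ℕ} (φ : E n ≃ E n) : Prop where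
  contDiff : ContDiff ℝ 1 φ
  contDiff_symm : ContDiff ℝ 1 φ.symm
  det_pos : ∀ x, 0 < (fderiv ℝ φ x).det

/-- `D^s(ℝⁿ)`: the `φ ∈ Diff¹₊(ℝⁿ)` such that `φ - id ∈ H^s(ℝⁿ, ℝⁿ)`. -/
def Diffeo (n s : ℕ) : Type :=
  {φ : E n ≃ E n // IsDiffeo φ ∧ ∃ v : SobolevVec n n s, toMap v =ᵐ[volume] fun x => φ x - x}

/-- The chart `D^s(ℝⁿ) → H^s(ℝⁿ, ℝⁿ)`, `φ ↦ φ - id`. -/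
def chart {n s : ℕ} (φ : Diffeo n s) : SobolevVec n n s := φ.2.2.choose

theorem chart_spec {n s : ℕ} (φ : Diffeo n s) :
    toMap (chart φ) =ᵐ[volume] fun x => φ.1 x - x := φ.2.2.choose_spec

theorem chart_injective (n s : ℕ) : Function.Injective (chart : Diffeo n s → SobolevVec n n s) := by
  intro φ ψ h
  have h0 := chart_spec φ
  rw [h] at h0
  have h1 := h0.symm.trans (chart_spec ψ)
  have h2 := Continuous.ae_eq_iff_eq (volume : Measure (E n))
    (φ.2.1.contDiff.continuous.sub continuous_id) (ψ.2.1.contDiff.continuous.sub continuous_id)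
    |>.1 h1
  refine Subtype.ext (Equiv.ext fun x => ?_)
  exact sub_left_injective (congrFun h2 x)

theorem isDiffeo_refl (n : ℕ) : IsDiffeo (Equiv.refl (E n)) where
  contDiff := contDiff_id
  contDiff_symm := contDiff_id
  det_pos x := by
    have h : fderiv ℝ (Equiv.refl (E n)) x = ContinuousLinearMap.id ℝ (E n) := fderiv_id
    have h' : (ContinuousLinearMap.id ℝ (E n)).det = 1 := LinearMap.det_id
    rw [h, h']
    exact one_pos

theorem toMap_zero (n d s : ℕ) : toMap (0 : SobolevVec n d s) =ᵐ[volume] fun _ => 0 := by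
  filter_upwards [Lp.coeFn_zero ℝ 2 (volume : Measure (E n))] with x hx
  ext i
  exact hx

/-- The identity of `ℝⁿ` is an element of `D^s(ℝⁿ)`. -/
instance instInhabitedDiffeo (n s : ℕ) : Inhabited (Diffeo n s) :=
  ⟨⟨Equiv.refl _, isDiffeo_refl n, 0, by
    filter_upwards [toMap_zero n n s] with x hx
    rw [hx, Equiv.refl_apply, sub_self]⟩⟩

/-- The parametrization `w ↦ id + w` of `D^s(ℝⁿ)`, inverse to the chart; only its values on the
image of the chart matter. -/
def param {n s : ℕ} : SobolevVec n n s → Diffeo n s := Function.invFun chart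

theorem param_chart {n s : ℕ} (φ : Diffeo n s) : param (chart φ) = φ :=
  Function.leftInverse_invFun (chart_injective n s) φ

end SobolevDiff

end

/-!
Write `D^m` for the set of `w ∈ H^m(ℝⁿ, ℝⁿ)` such that `id + w` is an orientation preserving
`C¹`-diffeomorphism (`diffeoSet`), which is the image of the chart, and put `s = σ + 1`, so that
`σ > n/2`. Multi-indices are used only to show that a function is in `H^{k+1}` if and only if it is
in `L²` with first weak derivatives in `H^k`, and that convergence in `H^{k+1}` can be tested in the
same way (`Sobolev.tendsto_succ_iff`). Everything afterwards is an induction on the order of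
differentiability.

*Analysis of `H^k`.* On Schwartz functions the Fourier transform gives the embedding of `H^σ` in
the continuous functions vanishing at infinity, and, through Young's inequality for the convolution,
the estimate `‖f g‖_{L²} ≤ C ‖f‖_{H^a} ‖g‖_{H^b}` for `a + b > n/2`. Schwartz functions are dense in
`H^k`: the form `⟨(1 - cΔ)^k f, g⟩_{L²}` is coercive on `H^k`, and `(1 - cΔ)^k` is onto the Schwartz
functions, so nothing is orthogonal to all of them. The Leibniz rule then yields the multiplication
`H^a × H^b → H^c` (`mulB`) and the embedding `emb`, which picks the continuous representative.

*Openness.* If `id + w` is a diffeomorphism, `(1 + dw)⁻¹` is bounded, since `dw` vanishes at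
infinity. For small `h`, `(id + w + h) ∘ (id + w)⁻¹` is then the identity plus a contraction
(`isOpen_diffeoSet`).

*Continuity.* Multiplication by the entries of `A = (1 + dw)⁻¹` is continuous on `H^k`, `k ≤ σ`,
jointly in the function and in `w`, by induction on `k` with `∂ᵢ A = -A (∂ᵢ dw) A`
(`isSob_entry_mul`). The chain rule expresses the first derivatives of `f ∘ (id + w)⁻¹` by such
products, composed with `(id + w)⁻¹`; by induction again, `(f, w) ↦ f ∘ (id + w)⁻¹` is continuous
`H^k × D^{σ+1} → H^k` for `k ≤ σ + 1` (`isSob_comp_psi`). In particular the inverse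
`id - w ∘ (id + w)⁻¹` depends continuously on `w` (`continuousOn_invField`), and since `id + w` is
the inverse of its inverse, `(f, w) ↦ f ∘ (id + w)` is continuous too.

*Differentiability.* The fundamental theorem of calculus along `w + t h` shows that composition with
`id + w`, as an operator `H^m → H^{σ+1}`, is continuous in the operator norm for `m ≥ σ + 2` and
differentiable for `m ≥ σ + 3`, with the derivative `h ↦ (f ↦ ∑ⱼ (∂ⱼ f ∘ (id + w)) hⱼ)`, which is
again given by composition operators; so it is `C^r` for `m ≥ σ + r + 2` (`contDiffOn_compLow`). As
a map of the pair `(f, w)` composition is better by one derivative (`contDiffOn_compLow_apply`).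

*Inversion.* With `z = -h ∘ (id + w + h)⁻¹` one has `(id + w + h)⁻¹ = (id + w)⁻¹ ∘ (id + z)`. So
differentiability of the inversion follows from that of composition, and its derivative consists of
composition with `(id + w)⁻¹` and of the first derivatives of `(id + w)⁻¹`, taken one order of
regularity higher. Induction on `r`, for all `σ` at once, gives `contDiffOn_invField`.
-/

open scoped LineDeriv Distributions SchwartzMap FourierTransform ENNReal NNReal

noncomputable section

namespace SobolevDiff

/-! ### Algebraic structures underlying the norm -/

/-- The additive group of `H^k`, reached through the norm. This and the three instances after it
equal the existing ones by definition; they let instance search find the norms of spaces of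
operators between spaces of operators. -/
instance instAddCommGroupSobolevNormed (n k : ℕ) : AddCommGroup (Sobolev n k) :=
  NormedAddCommGroup.toAddCommGroup

instance instModuleSobolevNormed (n k : ℕ) : Module ℝ (Sobolev n k) := NormedSpace.toModule

instance instAddCommGroupSobolevPi (n k d : ℕ) : AddCommGroup (Fin d → Sobolev n k) :=
  NormedAddCommGroup.toAddCommGroup

instance instModuleSobolevPi (n k d : ℕ) : Module ℝ (Fin d → Sobolev n k) := NormedSpace.toModule

/-! ### Weak derivatives of first order -/

/-- The `i`-th standard basis vector of `ℝⁿ`. -/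
abbrev basisVec {n : ℕ} (i : Fin n) : E n := EuclideanSpace.single i (1 : ℝ)

/-- `h` is the weak partial derivative `∂ᵢ f`: the first-order case of `IsWeakDeriv`, without
multi-indices. -/
def IsPartial {n : ℕ} (i : Fin n) (f h : L2 n) : Prop :=
  ∀ η : TestFn n, ∫ x, f x * (∂_{basisVec i} η) x = -∫ x, h x * η x

theorem testFn_lineDeriv_apply {n : ℕ} (η : TestFn n) (v x : E n) :
    (∂_{v} η) x = fderiv ℝ η x v := by
  rw [TestFunction.lineDerivOp_eq_lineDerivCLM ℝ,
    TestFunction.lineDerivCLM_apply_of_le (by simp)]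
  exact ((η.contDiff.differentiable (by simp)) x).lineDeriv_eq_fderiv

theorem testFn_lineDeriv_comm {n : ℕ} (η : TestFn n) (v w : E n) :
    (∂_{v} (∂_{w} η) : TestFn n) = ∂_{w} (∂_{v} η) := by
  have key : ∀ (v w x : E n), fderiv ℝ (fun y => fderiv ℝ η y w) x v
      = fderiv ℝ (fderiv ℝ η) x v w := by
    intro v w x
    have h : DifferentiableAt ℝ (fderiv ℝ η) x :=
      ((η.contDiff.of_le (m := 2) (WithTop.coe_le_coe.2 (le_top : (2 : ℕ∞) ≤ ⊤))).fderiv_right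
        (m := 1) (by norm_num)).differentiable (by norm_num) x
    rw [fderiv_clm_apply h (differentiableAt_const w)]
    simp
  have hf : ∀ (w : E n), (⇑(∂_{w} η : TestFn n)) = fun y => fderiv ℝ η y w :=
    fun w => funext fun y => testFn_lineDeriv_apply η w y
  ext x
  rw [testFn_lineDeriv_apply, testFn_lineDeriv_apply, hf, hf, key, key]
  have hs : IsSymmSndFDerivAt ℝ η x :=
    (η.contDiff.contDiffAt (x := x)).isSymmSndFDerivAt (by
      simp only [minSmoothness_of_isRCLikeNormedField]
      exact WithTop.coe_le_coe.2 (le_top : (2 : ℕ∞) ≤ ⊤))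
  exact hs v w

theorem testFn_lineDeriv_iterate_comm {n : ℕ} (η : TestFn n) (v w : E n) (m : ℕ) :
    (fun χ : TestFn n => (∂_{v} χ : TestFn n))^[m] (∂_{w} η)
      = ∂_{w} ((fun χ : TestFn n => (∂_{v} χ : TestFn n))^[m] η) := by
  induction m with
  | zero => rfl
  | succ m ih => rw [Function.iterate_succ_apply', ih, Function.iterate_succ_apply',
      testFn_lineDeriv_comm]

theorem testDeriv_add_single {n : ℕ} (α : Fin n → ℕ) (i : Fin n) (η : TestFn n) :
    testDeriv (α + Pi.single i 1) η = ∂_{basisVec i} (testDeriv α η) := by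
  have key : ∀ l : List (Fin n), l.Nodup →
      l.foldr (fun j ψ =>
        (fun χ : TestFn n => ∂_{basisVec j} χ)^[(α + Pi.single i 1 : Fin n → ℕ) j] ψ) η
      = if i ∈ l then ∂_{basisVec i}
          (l.foldr (fun j ψ => (fun χ : TestFn n => ∂_{basisVec j} χ)^[α j] ψ) η)
        else l.foldr (fun j ψ => (fun χ : TestFn n => ∂_{basisVec j} χ)^[α j] ψ) η := by
    intro l
    induction l with
    | nil => simp
    | cons j l ih =>
      intro hl
      rw [List.nodup_cons] at hl
      simp only [List.foldr_cons]
      rw [ih hl.2]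
      by_cases hij : i = j
      · subst hij
        rw [if_neg hl.1, if_pos (by simp)]
        simp only [Pi.add_apply, Pi.single_eq_same]
        rw [Function.iterate_succ_apply']
      · have h0 : (α + Pi.single i 1 : Fin n → ℕ) j = α j := by simp [Ne.symm hij]
        rw [h0]
        by_cases hil : i ∈ l
        · rw [if_pos hil, if_pos (by simp [hil])]
          exact testFn_lineDeriv_iterate_comm _ _ _ _
        · rw [if_neg hil, if_neg (by simp [hil, hij])]
  have := key (List.finRange n) (List.nodup_finRange n)
  rw [if_pos (List.mem_finRange i)] at this
  exact this

theorem len_add_single {n : ℕ} (α : Fin n → ℕ) (i : Fin n) :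
    len (α + Pi.single i 1) = len α + 1 := by
  simp [len, Finset.sum_add_distrib]

theorem exists_eq_add_single {n : ℕ} {α : Fin n → ℕ} (h : α ≠ 0) :
    ∃ (i : Fin n) (β : Fin n → ℕ), α = β + Pi.single i 1 := by
  obtain ⟨i, hi⟩ := Function.ne_iff.1 h
  have hi' : α i ≠ 0 := hi
  refine ⟨i, α - Pi.single i 1, funext fun j => ?_⟩
  by_cases hj : j = i
  · subst hj; simp; omega
  · simp [hj]

theorem testDeriv_zero {n : ℕ} (η : TestFn n) : testDeriv 0 η = η := by
  unfold testDeriv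
  induction List.finRange n with
  | nil => rfl
  | cons a l ih => exact ih

theorem isWeakDeriv_single_iff {n : ℕ} {i : Fin n} {f h : L2 n} :
    IsWeakDeriv (Pi.single i 1) f h ↔ IsPartial i f h := by
  have h0 : len (0 : Fin n → ℕ) = 0 := by simp [len]
  have h1 : len (Pi.single i 1 : Fin n → ℕ) = 1 := by
    simpa [h0] using len_add_single (0 : Fin n → ℕ) i
  have h2 : ∀ η : TestFn n, testDeriv (Pi.single i 1) η = ∂_{basisVec i} η := fun η => by
    simpa [testDeriv_zero] using testDeriv_add_single (0 : Fin n → ℕ) i η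
  simp [IsWeakDeriv, IsPartial, h1, h2]

theorem IsPartial.isWeakDeriv_iff {n : ℕ} {i : Fin n} {α : Fin n → ℕ} {f h g : L2 n}
    (H : IsPartial i f h) : IsWeakDeriv (α + Pi.single i 1) f g ↔ IsWeakDeriv α h g := by
  refine forall_congr' fun η => ?_
  rw [testDeriv_add_single, H, len_add_single, pow_succ]
  constructor <;> intro h <;> linarith

theorem IsPartial.unique {n : ℕ} {i : Fin n} {f h h' : L2 n}
    (H : IsPartial i f h) (H' : IsPartial i f h') : h = h' :=
  (isWeakDeriv_single_iff.2 H).unique (isWeakDeriv_single_iff.2 H')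

/-! ### The scale of Sobolev spaces -/

namespace Sobolev

theorem toL2_injective {n k : ℕ} : Function.Injective (toL2 : Sobolev n k → L2 n) :=
  Subtype.val_injective

theorem ext_toL2 {n k : ℕ} {f g : Sobolev n k} (h : f.toL2 = g.toL2) : f = g := toL2_injective h

/-- The element of `H^k` given by an `L²` function with the required weak derivatives. -/
def mk {n k : ℕ} (g : L2 n) (h : g ∈ sobolevSubmodule n k) : Sobolev n k := ⟨g, h⟩

theorem toL2_mem {n k : ℕ} (f : Sobolev n k) : f.toL2 ∈ sobolevSubmodule n k := f.2

end Sobolev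

theorem norm_sq_L2 {n : ℕ} (g : L2 n) : ‖g‖ ^ 2 = ∫ x, |g x| ^ 2 := by
  rw [← real_inner_self_eq_norm_sq, L2.inner_def]
  refine integral_congr_ae (ae_of_all _ fun x => ?_)
  simp [pow_two]

namespace Sobolev

theorem norm_sq {n k : ℕ} (f : Sobolev n k) :
    ‖f‖ ^ 2 = ∑ α ∈ multiIndices n k, ‖weakDeriv α f.toL2‖ ^ 2 := by
  rw [norm_eq, Real.sq_sqrt (Finset.sum_nonneg fun _ _ => integral_nonneg fun _ => by positivity)]
  exact Finset.sum_congr rfl fun _ _ => (norm_sq_L2 _).symm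

theorem norm_weakDeriv_le {n k : ℕ} (f : Sobolev n k) {α : Fin n → ℕ} (hα : len α ≤ k) :
    ‖weakDeriv α f.toL2‖ ≤ ‖f‖ := by
  refine le_of_sq_le_sq ?_ (norm_nonneg _)
  rw [norm_sq]
  exact Finset.single_le_sum (f := fun α => ‖weakDeriv α f.toL2‖ ^ 2)
    (fun _ _ => by positivity) (mem_multiIndices.2 hα)

theorem norm_le_of_forall {n k : ℕ} (f : Sobolev n k) {C : ℝ} (hC : 0 ≤ C)
    (h : ∀ α, len α ≤ k → ‖weakDeriv α f.toL2‖ ≤ C) :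
    ‖f‖ ≤ ((multiIndices n k).card + 1) * C := by
  refine le_of_sq_le_sq ?_ (by positivity)
  rw [norm_sq]
  calc ∑ α ∈ multiIndices n k, ‖weakDeriv α f.toL2‖ ^ 2
      ≤ ∑ α ∈ multiIndices n k, C ^ 2 := Finset.sum_le_sum fun α hα =>
        pow_le_pow_left₀ (norm_nonneg _) (h α (mem_multiIndices.1 hα)) 2
    _ = (multiIndices n k).card * C ^ 2 := by simp
    _ ≤ (((multiIndices n k).card + 1) * C) ^ 2 := by
        rw [mul_pow]
        gcongr
        have : (0 : ℝ) ≤ (multiIndices n k).card := by positivity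
        nlinarith

/-- The inclusion `H^k → L²` as a continuous linear map. -/
def toL2CLM {n k : ℕ} : Sobolev n k →L[ℝ] L2 n :=
  toL2.mkContinuous 1 fun f => by
    have h := f.norm_weakDeriv_le (α := fun _ => 0) (by simp [len])
    rwa [(IsWeakDeriv.self f.toL2).weakDeriv_eq, ← one_mul ‖f‖] at h

@[simp] theorem toL2CLM_apply {n k : ℕ} (f : Sobolev n k) : toL2CLM f = f.toL2 := rfl

/-- The inclusion `H^m → H^k` for `k ≤ m`. -/
def lower {n m k : ℕ} (h : k ≤ m) : Sobolev n m →L[ℝ] Sobolev n k :=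
  LinearMap.mkContinuous
    { toFun := fun f => mk f.toL2 fun α hα => f.toL2_mem α (hα.trans h)
      map_add' := fun _ _ => rfl
      map_smul' := fun _ _ => rfl } ((multiIndices n k).card + 1) fun f =>
    norm_le_of_forall _ (norm_nonneg _) fun _ hα => f.norm_weakDeriv_le (hα.trans h)

@[simp] theorem toL2_lower {n m k : ℕ} (h : k ≤ m) (f : Sobolev n m) :
    (lower h f).toL2 = f.toL2 := rfl

theorem isPartial_weakDeriv {n k : ℕ} (f : Sobolev n (k + 1)) (i : Fin n) :
    IsPartial i f.toL2 (weakDeriv (Pi.single i 1) f.toL2) :=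
  isWeakDeriv_single_iff.1 (f.isWeakDeriv (by simp [len]))

/-- The weak partial derivative `∂ᵢ : H^{k+1} → H^k`. -/
def D {n k : ℕ} (i : Fin n) : Sobolev n (k + 1) →L[ℝ] Sobolev n k :=
  LinearMap.mkContinuous
    { toFun := fun f => mk (weakDeriv (Pi.single i 1) f.toL2) fun α hα =>
        ⟨weakDeriv (α + Pi.single i 1) f.toL2, (f.isPartial_weakDeriv i).isWeakDeriv_iff.1
          (f.isWeakDeriv (by rw [len_add_single]; omega))⟩
      map_add' := fun f g => ext_toL2 (f.weakDeriv_add g (by simp [len]))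
      map_smul' := fun c f => ext_toL2 (f.weakDeriv_smul c (by simp [len])) }
    ((multiIndices n k).card + 1) fun f =>
    norm_le_of_forall _ (norm_nonneg _) fun α hα => by
      have h1 := f.isWeakDeriv (α := α + Pi.single i 1) (by rw [len_add_single]; omega)
      have h2 := ((f.isPartial_weakDeriv i).isWeakDeriv_iff.1 h1).weakDeriv_eq
      have h3 := f.norm_weakDeriv_le (α := α + Pi.single i 1) (by rw [len_add_single]; omega)
      rw [← h2] at h3
      exact h3

theorem isPartial_D {n k : ℕ} (f : Sobolev n (k + 1)) (i : Fin n) :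
    IsPartial i f.toL2 (D i f).toL2 := f.isPartial_weakDeriv i

theorem D_eq {n k : ℕ} {f : Sobolev n (k + 1)} {i : Fin n} {g : Sobolev n k}
    (h : IsPartial i f.toL2 g.toL2) : D i f = g :=
  ext_toL2 ((f.isPartial_D i).unique h)

theorem lower_D {n m k : ℕ} (h : k ≤ m) (h' : k + 1 ≤ m + 1) (f : Sobolev n (m + 1)) (i : Fin n) :
    D i (lower h' f) = lower h (D i f) := D_eq (f.isPartial_D i)

theorem mem_succ {n k : ℕ} {g : L2 n} (h : ∀ i, ∃ u : Sobolev n k, IsPartial i g u.toL2) :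
    g ∈ sobolevSubmodule n (k + 1) := by
  intro α hα
  by_cases h0 : α = 0
  · subst h0; exact ⟨g, IsWeakDeriv.self g⟩
  · obtain ⟨i, β, rfl⟩ := exists_eq_add_single h0
    obtain ⟨u, hu⟩ := h i
    rw [len_add_single] at hα
    obtain ⟨v, hv⟩ := u.toL2_mem β (by omega)
    exact ⟨v, hu.isWeakDeriv_iff.2 hv⟩

theorem mem_zero {n : ℕ} (g : L2 n) : g ∈ sobolevSubmodule n 0 := by
  intro α hα
  have : α = 0 := funext fun i => by
    have := Finset.single_le_sum (f := α) (fun _ _ => Nat.zero_le _) (Finset.mem_univ i)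
    have h : len α = ∑ i, α i := rfl
    simp only [Pi.zero_apply]
    omega
  subst this
  exact ⟨g, IsWeakDeriv.self g⟩

/-- The `H^{k+1}`-norm is controlled by the `L²`-norm and the `H^k`-norms of the first
derivatives; this is what makes induction on `k` work. -/
theorem exists_norm_succ_le (n k : ℕ) : ∃ C : ℝ, 0 ≤ C ∧ ∀ f : Sobolev n (k + 1),
    ‖f‖ ≤ C * (‖f.toL2‖ + ∑ i, ‖D i f‖) := by
  refine ⟨_, by positivity, fun f => norm_le_of_forall f (by positivity) fun α hα => ?_⟩
  by_cases h0 : α = 0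
  · subst h0
    rw [(IsWeakDeriv.self f.toL2).weakDeriv_eq (α := fun _ => 0) |> fun h => (show
      weakDeriv 0 f.toL2 = f.toL2 from h)]
    exact le_add_of_nonneg_right (by positivity)
  · obtain ⟨i, β, rfl⟩ := exists_eq_add_single h0
    rw [len_add_single] at hα
    have h1 := f.isWeakDeriv (α := β + Pi.single i 1) (by rw [len_add_single]; omega)
    have h2 := ((f.isPartial_D i).isWeakDeriv_iff.1 h1).weakDeriv_eq
    rw [← h2]
    refine ((D i f).norm_weakDeriv_le (by omega)).trans ?_
    exact (Finset.single_le_sum (f := fun i => ‖D i f‖) (fun _ _ => norm_nonneg _)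
      (Finset.mem_univ i)).trans (le_add_of_nonneg_left (norm_nonneg _))

theorem exists_norm_zero_le (n : ℕ) : ∃ C : ℝ, 0 ≤ C ∧ ∀ f : Sobolev n 0,
    ‖f‖ ≤ C * ‖f.toL2‖ := by
  refine ⟨_, by positivity, fun f => norm_le_of_forall f (by positivity) fun α hα => ?_⟩
  by_cases h0 : α = 0
  · subst h0
    rw [(IsWeakDeriv.self f.toL2).weakDeriv_eq (α := fun _ => 0) |> fun h => (show
      weakDeriv 0 f.toL2 = f.toL2 from h)]
  · obtain ⟨i, β, rfl⟩ := exists_eq_add_single h0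
    rw [len_add_single] at hα
    omega

/-- `L²` functions as elements of `H^0`. -/
def ofL2 {n : ℕ} : L2 n →L[ℝ] Sobolev n 0 :=
  LinearMap.mkContinuousOfExistsBound
    { toFun := fun g => mk g (mem_zero g)
      map_add' := fun _ _ => rfl
      map_smul' := fun _ _ => rfl } (by
    obtain ⟨C, _, h⟩ := exists_norm_zero_le n
    exact ⟨C, fun g => h _⟩)

@[simp] theorem ofL2_toL2 {n : ℕ} (g : Sobolev n 0) : ofL2 g.toL2 = g := rfl

theorem tendsto_zero_iff {n : ℕ} {X : Type*} {l : Filter X} {F : X → Sobolev n 0}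
    {f : Sobolev n 0} : Tendsto F l (𝓝 f) ↔ Tendsto (fun x => (F x).toL2) l (𝓝 f.toL2) :=
  ⟨fun h => (toL2CLM.continuous.tendsto f).comp h, fun h => (ofL2.continuous.tendsto _).comp h⟩

/-- Convergence in `H^{k+1}` is convergence in `L²` together with convergence of the first
derivatives in `H^k`. -/
theorem tendsto_succ_iff {n k : ℕ} {X : Type*} {l : Filter X} {F : X → Sobolev n (k + 1)}
    {f : Sobolev n (k + 1)} : Tendsto F l (𝓝 f) ↔
      Tendsto (fun x => (F x).toL2) l (𝓝 f.toL2) ∧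
      ∀ i, Tendsto (fun x => D i (F x)) l (𝓝 (D i f)) := by
  refine ⟨fun h => ⟨(toL2CLM.continuous.tendsto f).comp h, fun i =>
    ((D i).continuous.tendsto f).comp h⟩, fun ⟨h0, h1⟩ => ?_⟩
  obtain ⟨C, hC, hn⟩ := exists_norm_succ_le n k
  rw [tendsto_iff_norm_sub_tendsto_zero] at h0 ⊢
  have h1' : ∀ i, Tendsto (fun x => ‖D i (F x) - D i f‖) l (𝓝 0) := fun i =>
    tendsto_iff_norm_sub_tendsto_zero.1 (h1 i)
  have h2 := (h0.add (tendsto_finsetSum Finset.univ fun i _ => h1' i)).const_mul C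
  simp only [Finset.sum_const_zero, add_zero, mul_zero] at h2
  refine squeeze_zero (fun _ => norm_nonneg _) (fun x => ?_) h2
  simpa only [map_sub] using hn (F x - f)

end Sobolev

theorem integral_mul_testFn_eq_inner {n : ℕ} (f : L2 n) (η : TestFn n) :
    ∫ x, f x * η x = inner ℝ f ((memLp_testFn η).toLp) := by
  rw [L2.inner_def]
  refine integral_congr_ae ?_
  filter_upwards [(memLp_testFn η).coeFn_toLp] with x hx
  rw [hx]
  simp [mul_comm]

/-- Weak differentiation is a closed operator. -/
theorem IsPartial.of_tendsto {n : ℕ} {i : Fin n} {X : Type*} {l : Filter X} [l.NeBot]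
    {F G : X → L2 n} {f g : L2 n} (h : ∀ᶠ x in l, IsPartial i (F x) (G x))
    (hF : Tendsto F l (𝓝 f)) (hG : Tendsto G l (𝓝 g)) : IsPartial i f g := by
  intro η
  rw [integral_mul_testFn_eq_inner, integral_mul_testFn_eq_inner]
  have h1 : Tendsto (fun x => inner ℝ (F x) ((memLp_testFn (∂_{basisVec i} η : TestFn n)).toLp)) l
    (𝓝 (inner ℝ f ((memLp_testFn (∂_{basisVec i} η : TestFn n)).toLp))) :=
      hF.inner tendsto_const_nhds
  have h2 : Tendsto (fun x => -inner ℝ (G x) ((memLp_testFn η).toLp)) l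
    (𝓝 (-inner ℝ g ((memLp_testFn η).toLp))) := (hG.inner tendsto_const_nhds).neg
  refine tendsto_nhds_unique h1 (h2.congr' ?_)
  filter_upwards [h] with x hx
  have := hx η
  rw [integral_mul_testFn_eq_inner, integral_mul_testFn_eq_inner] at this
  exact this.symm

instance instCompleteSpaceSobolev (n k : ℕ) : CompleteSpace (Sobolev n k) := by
  induction k with
  | zero =>
    refine Metric.complete_of_cauchySeq_tendsto fun u hu => ?_
    obtain ⟨g, hg⟩ := cauchySeq_tendsto_of_complete
      (Sobolev.toL2CLM.uniformContinuous.comp_cauchySeq hu)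
    exact ⟨Sobolev.ofL2 g, Sobolev.tendsto_zero_iff.2 hg⟩
  | succ k ih =>
    refine Metric.complete_of_cauchySeq_tendsto fun u hu => ?_
    obtain ⟨g, hg⟩ := cauchySeq_tendsto_of_complete
      (Sobolev.toL2CLM.uniformContinuous.comp_cauchySeq hu)
    have hD : ∀ i, ∃ v, Tendsto (fun m => Sobolev.D i (u m)) atTop (𝓝 v) := fun i =>
      cauchySeq_tendsto_of_complete ((Sobolev.D i).uniformContinuous.comp_cauchySeq hu)
    choose v hv using hD
    have hp : ∀ i, IsPartial i g (v i).toL2 := fun i =>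
      IsPartial.of_tendsto (Eventually.of_forall fun m => (u m).isPartial_D i) hg
        ((Sobolev.toL2CLM.continuous.tendsto _).comp (hv i))
    refine ⟨Sobolev.mk g (Sobolev.mem_succ fun i => ⟨v i, hp i⟩),
      Sobolev.tendsto_succ_iff.2 ⟨hg, fun i => ?_⟩⟩
    rw [Sobolev.D_eq (g := v i) (hp i)]
    exact hv i

/-! ### Schwartz functions in Sobolev spaces -/

/-- A differentiable function has its classical partial derivative as weak derivative. -/
theorem isPartial_of_hasLineDerivAt {n : ℕ} {i : Fin n} {f g : L2 n} {F G : E n → ℝ}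
    (hF : f =ᵐ[volume] F) (hG : g =ᵐ[volume] G)
    (h : ∀ x, HasLineDerivAt ℝ F (G x) x (basisVec i)) : IsPartial i f g := by
  intro η
  have e1 : ∀ χ : TestFn n, (fun x => f x * χ x) =ᵐ[volume] fun x => F x * χ x := fun χ => by
    filter_upwards [hF] with x hx; rw [hx]
  have e2 : (fun x => g x * η x) =ᵐ[volume] fun x => G x * η x := by
    filter_upwards [hG] with x hx; rw [hx]
  rw [integral_congr_ae (e1 _), integral_congr_ae e2]
  refine integral_bilinear_hasLineDerivAt_right_eq_neg_left_of_integrable (v := basisVec i)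
    (f := F) (g := η) (B := ContinuousLinearMap.mul ℝ ℝ)
    ((integrable_mul_testFn g η).congr e2) ((integrable_mul_testFn f _).congr (e1 _))
    ((integrable_mul_testFn f η).congr (e1 _)) (fun x _ => h x) (fun x _ => ?_)
  rw [testFn_lineDeriv_apply]
  exact (η.contDiff.differentiable (by simp) x).hasFDerivAt.hasLineDerivAt _

theorem isPartial_schwartz {n : ℕ} (i : Fin n) (f : 𝓢(E n, ℝ)) :
    IsPartial i (f.toLp 2 volume) ((∂_{basisVec i} f : 𝓢(E n, ℝ)).toLp 2 volume) := by
  refine isPartial_of_hasLineDerivAt (f.coeFn_toLp 2 volume)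
    ((∂_{basisVec i} f : 𝓢(E n, ℝ)).coeFn_toLp 2 volume) fun x => ?_
  exact (f.hasFDerivAt x).hasLineDerivAt (basisVec i)

theorem schwartz_mem {n : ℕ} (k : ℕ) (f : 𝓢(E n, ℝ)) : f.toLp 2 volume ∈ sobolevSubmodule n k := by
  induction k generalizing f with
  | zero => exact Sobolev.mem_zero _
  | succ k ih => exact Sobolev.mem_succ fun i =>
      ⟨Sobolev.mk _ (ih (∂_{basisVec i} f)), isPartial_schwartz i f⟩

/-- Schwartz functions as elements of `H^k`. -/
def ofSchwartz {n : ℕ} (k : ℕ) : 𝓢(E n, ℝ) →ₗ[ℝ] Sobolev n k where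
  toFun f := Sobolev.mk (f.toLp 2 volume) (schwartz_mem k f)
  map_add' _ _ := rfl
  map_smul' _ _ := rfl

@[simp] theorem toL2_ofSchwartz {n k : ℕ} (f : 𝓢(E n, ℝ)) :
    (ofSchwartz k f).toL2 = f.toLp 2 volume := rfl

@[simp] theorem D_ofSchwartz {n k : ℕ} (i : Fin n) (f : 𝓢(E n, ℝ)) :
    Sobolev.D i (ofSchwartz (k + 1) f) = ofSchwartz k (∂_{basisVec i} f) :=
  Sobolev.D_eq (isPartial_schwartz i f)

@[simp] theorem lower_ofSchwartz {n m k : ℕ} (h : k ≤ m) (f : 𝓢(E n, ℝ)) :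
    Sobolev.lower h (ofSchwartz m f) = ofSchwartz k f := rfl

theorem Sobolev.norm_toL2_le {n k : ℕ} (f : Sobolev n k) : ‖f.toL2‖ ≤ ‖f‖ := by
  have h := f.norm_weakDeriv_le (α := fun _ => 0) (by simp [len])
  rwa [(IsWeakDeriv.self f.toL2).weakDeriv_eq] at h

/-! ### Fourier estimates -/

/-- A real Schwartz function as a complex one. -/
def toComplex {n : ℕ} (f : 𝓢(E n, ℝ)) : 𝓢(E n, ℂ) :=
  SchwartzMap.postcompCLM (𝕜 := ℝ) Complex.ofRealCLM f

@[simp] theorem toComplex_apply {n : ℕ} (f : 𝓢(E n, ℝ)) (x : E n) : toComplex f x = f x := rfl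

theorem toComplex_lineDeriv {n : ℕ} (f : 𝓢(E n, ℝ)) (v : E n) :
    toComplex (∂_{v} f) = ∂_{v} (toComplex f) := by
  ext x
  rw [SchwartzMap.lineDerivOp_apply_eq_fderiv, toComplex_apply,
    SchwartzMap.lineDerivOp_apply_eq_fderiv]
  have h : HasFDerivAt (fun y => (f y : ℂ)) (Complex.ofRealCLM.comp (fderiv ℝ f x)) x :=
    Complex.ofRealCLM.hasFDerivAt.comp x (f.hasFDerivAt x)
  have h' : (⇑(toComplex f)) = fun y => (f y : ℂ) := rfl
  rw [h', h.fderiv]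
  rfl

/-- The function `(1 + |ξ|)^k |𝓕⁻ f(ξ)|`, whose `L²`-norm is the Fourier version of the
`H^k`-norm. -/
def weightedFourier {n : ℕ} (k : ℕ) (f : 𝓢(E n, ℝ)) (ξ : E n) : ℝ :=
  (1 + ‖ξ‖) ^ k * ‖𝓕⁻ (toComplex f) ξ‖

theorem continuous_weightedFourier {n : ℕ} (k : ℕ) (f : 𝓢(E n, ℝ)) :
    Continuous (weightedFourier k f) := by
  unfold weightedFourier
  exact (by fun_prop : Continuous fun ξ : E n => (1 + ‖ξ‖) ^ k).mul
    (SchwartzMap.continuous _).norm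

theorem weightedFourier_nonneg {n : ℕ} (k : ℕ) (f : 𝓢(E n, ℝ)) (ξ : E n) :
    0 ≤ weightedFourier k f ξ := by
  unfold weightedFourier; positivity

theorem abs_coord_mul_norm_fourierInv_le {n : ℕ} (f : 𝓢(E n, ℝ)) (i : Fin n) (ξ : E n) :
    |ξ i| * ‖𝓕⁻ (toComplex f) ξ‖ ≤ ‖𝓕⁻ (toComplex (∂_{basisVec i} f)) ξ‖ := by
  have hg : (fun x : E n => inner ℝ x (basisVec i)).HasTemperateGrowth := by fun_prop
  rw [toComplex_lineDeriv, SchwartzMap.fourierInv_lineDerivOp_eq, smul_apply,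
    SchwartzMap.smulLeftCLM_apply_apply hg]
  have h1 : inner ℝ ξ (basisVec i) = ξ i := by
    simp [basisVec, EuclideanSpace.inner_single_right]
  rw [h1, norm_smul, norm_smul, Real.norm_eq_abs]
  have h2 : (1 : ℝ) ≤ ‖-(2 * Real.pi * Complex.I : ℂ)‖ := by
    simp only [norm_neg, norm_mul, Complex.norm_I, mul_one, Complex.norm_real, Complex.norm_ofNat,
      Real.norm_eq_abs, abs_of_pos Real.pi_pos]
    linarith [Real.pi_gt_three]
  exact le_mul_of_one_le_left (by positivity) h2

theorem weightedFourier_succ_le {n : ℕ} (k : ℕ) (f : 𝓢(E n, ℝ)) (ξ : E n) :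
    weightedFourier (k + 1) f ξ ≤ weightedFourier k f ξ +
      ∑ i : Fin n, weightedFourier k (∂_{basisVec i} f) ξ := by
  have h1 : ‖ξ‖ ≤ ∑ i, |ξ i| := by
    calc ‖ξ‖ = ‖∑ i, ξ i • basisVec i‖ := by
          congr 1
          conv_lhs => rw [← (EuclideanSpace.basisFun (Fin n) ℝ).sum_repr ξ]
          simp [basisVec]
      _ ≤ ∑ i, ‖ξ i • basisVec i‖ := norm_sum_le _ _
      _ = ∑ i, |ξ i| := by simp [norm_smul, basisVec]
  unfold weightedFourier
  calc (1 + ‖ξ‖) ^ (k + 1) * ‖𝓕⁻ (toComplex f) ξ‖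
      = (1 + ‖ξ‖) ^ k * ‖𝓕⁻ (toComplex f) ξ‖
        + (1 + ‖ξ‖) ^ k * (‖ξ‖ * ‖𝓕⁻ (toComplex f) ξ‖) := by ring
    _ ≤ (1 + ‖ξ‖) ^ k * ‖𝓕⁻ (toComplex f) ξ‖
        + (1 + ‖ξ‖) ^ k * ((∑ i, |ξ i|) * ‖𝓕⁻ (toComplex f) ξ‖) := by gcongr
    _ ≤ _ := by
        rw [Finset.sum_mul, Finset.mul_sum]
        gcongr with i
        exact abs_coord_mul_norm_fourierInv_le f i ξ

theorem eLpNorm_fourierInv_toComplex {n : ℕ} (f : 𝓢(E n, ℝ)) :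
    eLpNorm (𝓕⁻ (toComplex f) : 𝓢(E n, ℂ)) 2 volume = eLpNorm f 2 volume := by
  have h1 : ‖(𝓕⁻ (toComplex f)).toLp 2 volume‖ = ‖(toComplex f).toLp 2 volume‖ := by
    rw [← SchwartzMap.norm_fourier_toL2_eq, FourierTransform.fourier_fourierInv_eq]
  rw [SchwartzMap.norm_toLp, SchwartzMap.norm_toLp, ENNReal.toReal_eq_toReal_iff'
    (SchwartzMap.eLpNorm_lt_top (𝓕⁻ (toComplex f)) 2 volume).ne
    (SchwartzMap.eLpNorm_lt_top (toComplex f) 2 volume).ne] at h1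
  rw [h1]
  exact eLpNorm_congr_norm_ae (ae_of_all _ fun x => by simp)

/-- The Fourier version of the `H^k`-norm is controlled by the `H^k`-norm. -/
theorem exists_eLpNorm_weightedFourier_le (n k : ℕ) : ∃ C : ℝ≥0, ∀ f : 𝓢(E n, ℝ),
    eLpNorm (weightedFourier k f) 2 volume ≤ C * ‖ofSchwartz k f‖ₑ := by
  induction k with
  | zero =>
    refine ⟨1, fun f => ?_⟩
    have h1 : eLpNorm (weightedFourier 0 f) 2 volume = eLpNorm f 2 volume := by
      rw [← eLpNorm_fourierInv_toComplex]
      exact eLpNorm_congr_norm_ae (ae_of_all _ fun x => by simp [weightedFourier])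
    have h2 : eLpNorm f 2 volume = ‖(ofSchwartz 0 f).toL2‖ₑ := by
      rw [toL2_ofSchwartz, Lp.enorm_def]
      exact (eLpNorm_congr_ae (f.coeFn_toLp 2 volume)).symm
    rw [h1, h2, ENNReal.coe_one, one_mul]
    exact enorm_le_iff_norm_le.2 (Sobolev.norm_toL2_le _)
  | succ k ih =>
    obtain ⟨C, hC⟩ := ih
    refine ⟨C * (‖Sobolev.lower (n := n) (Nat.le_succ k)‖₊
      + ∑ i : Fin n, ‖Sobolev.D (n := n) (k := k) i‖₊), fun f => ?_⟩
    have hm : ∀ k (f : 𝓢(E n, ℝ)), AEStronglyMeasurable (weightedFourier k f) volume :=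
      fun k f => (continuous_weightedFourier k f).aestronglyMeasurable
    calc eLpNorm (weightedFourier (k + 1) f) 2 volume
        ≤ eLpNorm (weightedFourier k f + ∑ i : Fin n, weightedFourier k (∂_{basisVec i} f)) 2
            volume := by
          refine eLpNorm_mono_real fun x => ?_
          rw [Real.norm_of_nonneg (weightedFourier_nonneg _ _ _)]
          simpa using weightedFourier_succ_le k f x
      _ ≤ eLpNorm (weightedFourier k f) 2 volume
          + ∑ i : Fin n, eLpNorm (weightedFourier k (∂_{basisVec i} f)) 2 volume := by
          refine (eLpNorm_add_le (hm _ _) ?_ (by norm_num)).trans ?_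
          · exact Finset.aestronglyMeasurable_sum _ fun i _ => hm _ _
          · gcongr
            exact eLpNorm_sum_le (fun i _ => hm _ _) (by norm_num)
      _ ≤ C * (‖Sobolev.lower (n := n) (Nat.le_succ k)‖₊ * ‖ofSchwartz (k + 1) f‖ₑ) +
          ∑ i, C * (‖Sobolev.D (n := n) (k := k) i‖₊ * ‖ofSchwartz (k + 1) f‖ₑ) := by
          gcongr with i
          · refine (hC f).trans ?_
            gcongr
            rw [← lower_ofSchwartz (Nat.le_succ k)]
            exact (Sobolev.lower (n := n) (Nat.le_succ k)).le_opENorm _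
          · refine (hC _).trans ?_
            gcongr
            rw [← D_ofSchwartz]
            exact (Sobolev.D (n := n) (k := k) i).le_opENorm _
      _ = _ := by
          push_cast
          rw [← Finset.mul_sum, ← Finset.sum_mul]
          ring

/-- Square integrability of `(1 + |ξ|)^{-s}` for `s > n/2`. -/
theorem eLpNorm_inv_weight_lt_top {n s : ℕ} (hs : n < 2 * s) :
    eLpNorm (fun ξ : E n => ((1 + ‖ξ‖) ^ s)⁻¹) 2 volume < ∞ := by
  have h : (Module.finrank ℝ (E n) : ℝ) < ((2 * s : ℕ) : ℝ) := by
    rw [finrank_euclideanSpace_fin]; exact_mod_cast hs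
  have h1 := finite_integral_one_add_norm (μ := (volume : Measure (E n))) h
  refine (MemLp.eLpNorm_lt_top ?_)
  refine (memLp_two_iff_integrable_sq_norm ?_).2 ?_
  · refine (Continuous.inv₀ (by fun_prop) fun x => by positivity).aestronglyMeasurable
  · refine (integrable_one_add_norm (μ := (volume : Measure (E n))) h).congr
      (ae_of_all _ fun x => ?_)
    simp only [norm_inv, norm_pow]
    rw [Real.norm_of_nonneg (by positivity), Real.rpow_neg (by positivity), Real.rpow_natCast,
      inv_pow, ← pow_mul, mul_comm s 2]

/-- The Sobolev inequality on Schwartz functions: `|f|` is at most the `L¹`-norm of the Fourier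
transform, and `(1 + |ξ|)^{-s}` is square integrable. -/
theorem exists_sup_le (n s : ℕ) (hs : n < 2 * s) : ∃ C : ℝ, ∀ (f : 𝓢(E n, ℝ)) (x : E n),
    ‖f x‖ ≤ C * ‖ofSchwartz s f‖ := by
  obtain ⟨C, hC⟩ := exists_eLpNorm_weightedFourier_le n s
  have hK := eLpNorm_inv_weight_lt_top hs
  set K := eLpNorm (fun ξ : E n => ((1 + ‖ξ‖) ^ s)⁻¹) 2 volume
  refine ⟨K.toReal * C, fun f x => ?_⟩
  have h1 : ‖f x‖ ≤ ‖(𝓕⁻ (toComplex f)).toLp 1 volume‖ := by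
    have := SchwartzMap.norm_fourier_apply_le_toLp_one (𝓕⁻ (toComplex f)) x
    rw [FourierTransform.fourier_fourierInv_eq] at this
    simpa using this
  have h2 : eLpNorm (𝓕⁻ (toComplex f) : 𝓢(E n, ℂ)) 1 volume ≤ K * (C * ‖ofSchwartz s f‖ₑ) := by
    calc eLpNorm (𝓕⁻ (toComplex f) : 𝓢(E n, ℂ)) 1 volume
        = eLpNorm ((fun ξ : E n => ((1 + ‖ξ‖) ^ s)⁻¹) • weightedFourier s f) 1 volume := by
          refine eLpNorm_congr_norm_ae (ae_of_all _ fun ξ => ?_)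
          have : (1 + ‖ξ‖) ^ s ≠ 0 := by positivity
          simp only [Pi.smul_apply', weightedFourier, smul_eq_mul]
          rw [inv_mul_cancel_left₀ this, norm_norm]
      _ ≤ K * eLpNorm (weightedFourier s f) 2 volume := by
          refine eLpNorm_smul_le_mul_eLpNorm
            (continuous_weightedFourier _ _).aestronglyMeasurable ?_
          exact (Continuous.inv₀ (by fun_prop) fun x => by positivity).aestronglyMeasurable
      _ ≤ _ := by gcongr; exact hC f
  rw [SchwartzMap.norm_toLp] at h1
  refine h1.trans ((ENNReal.toReal_mono ?_ h2).trans_eq ?_)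
  · exact (ENNReal.mul_lt_top hK (ENNReal.mul_lt_top ENNReal.coe_lt_top enorm_lt_top)).ne
  · simp [mul_assoc]

/-- Young's inequality `‖F ⋆ k‖₂ ≤ ‖F‖₂ ‖k‖₁` for nonnegative functions. -/
theorem lintegral_conv_sq_le {n : ℕ} {F k : E n → ℝ≥0∞} (hF : Measurable F) (hk : Measurable k) :
    ∫⁻ x, (∫⁻ y, F (x - y) * k y) ^ 2 ≤ (∫⁻ y, k y) ^ 2 * ∫⁻ x, F x ^ 2 := by
  have hFm : ∀ x : E n, Measurable fun y => F (x - y) := fun x => hF.comp (by fun_prop)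
  have h1 : ∀ x : E n, (∫⁻ y, F (x - y) * k y) ^ 2 ≤
      (∫⁻ y, k y) * ∫⁻ y, F (x - y) ^ 2 * k y := by
    intro x
    have h := ENNReal.lintegral_mul_le_Lp_mul_Lq (volume : Measure (E n))
      Real.HolderConjugate.two_two (f := fun y => k y ^ (1 / 2 : ℝ))
      (g := fun y => F (x - y) * k y ^ (1 / 2 : ℝ))
      (hk.pow_const _).aemeasurable ((hFm x).mul (hk.pow_const _)).aemeasurable
    have hsq : ∀ a : ℝ≥0∞, a ^ (1 / 2 : ℝ) * a ^ (1 / 2 : ℝ) = a := fun a => by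
      rw [← ENNReal.rpow_add_of_nonneg _ _ (by norm_num) (by norm_num)]; norm_num
    have hsq' : ∀ a : ℝ≥0∞, (a ^ (1 / 2 : ℝ)) ^ (2 : ℝ) = a := fun a => by
      rw [← ENNReal.rpow_mul]; norm_num
    have hsq2 : ∀ a : ℝ≥0∞, (a ^ (1 / 2 : ℝ)) ^ 2 = a := fun a => by rw [pow_two, hsq]
    have e1 : ∀ y, ((fun y => k y ^ (1 / 2 : ℝ)) * fun y => F (x - y) * k y ^ (1 / 2 : ℝ)) y
        = F (x - y) * k y := fun y => by
      simp only [Pi.mul_apply]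
      rw [mul_left_comm, hsq]
    simp only [e1, hsq', ENNReal.mul_rpow_of_nonneg _ _ (by norm_num : (0 : ℝ) ≤ 2),
      ENNReal.rpow_two] at h
    calc _ ≤ _ := pow_le_pow_left' h 2
      _ = _ := by rw [mul_pow, hsq2, hsq2]
  calc ∫⁻ x, (∫⁻ y, F (x - y) * k y) ^ 2
      ≤ ∫⁻ x, (∫⁻ y, k y) * ∫⁻ y, F (x - y) ^ 2 * k y := lintegral_mono h1
    _ = (∫⁻ y, k y) * ∫⁻ x, ∫⁻ y, F (x - y) ^ 2 * k y := by
        rw [lintegral_const_mul]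
        exact Measurable.lintegral_prod_right' (f := fun p : E n × E n =>
          F (p.1 - p.2) ^ 2 * k p.2) (by fun_prop)
    _ = (∫⁻ y, k y) * ∫⁻ y, ∫⁻ x, F (x - y) ^ 2 * k y := by
        rw [lintegral_lintegral_swap]
        exact (by fun_prop : Measurable fun p : E n × E n =>
          F (p.1 - p.2) ^ 2 * k p.2).aemeasurable
    _ = (∫⁻ y, k y) * ∫⁻ y, (∫⁻ x, F x ^ 2) * k y := by
        congr 1
        refine lintegral_congr fun y => ?_
        rw [lintegral_mul_const _ (by fun_prop), lintegral_sub_right_eq_self (fun x => F x ^ 2) y]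
    _ = _ := by
        rw [lintegral_const_mul _ hk]; ring

/-- The weights for the product estimate: at frequencies `t` and `y`, the weight `(1 + |·|)^{a+b}`
of the smaller one is split between both factors. -/
theorem fourier_product_weight_le {n a b : ℕ} (f g : 𝓢(E n, ℝ)) (t y : E n) :
    ‖𝓕⁻ (toComplex f) t‖ * ‖𝓕⁻ (toComplex g) y‖ ≤
      weightedFourier a f t * (weightedFourier b g y * ((1 + ‖y‖) ^ (a + b))⁻¹) +
      (weightedFourier a f t * ((1 + ‖t‖) ^ (a + b))⁻¹) * weightedFourier b g y := by
  set F := ‖𝓕⁻ (toComplex f) t‖ with hF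
  set G := ‖𝓕⁻ (toComplex g) y‖ with hG
  have hF0 : 0 ≤ F := norm_nonneg _
  have hG0 : 0 ≤ G := norm_nonneg _
  have ht : 0 < 1 + ‖t‖ := by positivity
  have hy : 0 < 1 + ‖y‖ := by positivity
  unfold weightedFourier
  rw [← hF, ← hG]
  rcases le_total (1 + ‖y‖) (1 + ‖t‖) with h | h
  · refine le_add_of_le_of_nonneg ?_ (by positivity)
    have : (1 : ℝ) ≤ (1 + ‖t‖) ^ a * ((1 + ‖y‖) ^ b * ((1 + ‖y‖) ^ (a + b))⁻¹) := by
      rw [pow_add, mul_inv, mul_comm ((1 + ‖y‖) ^ a)⁻¹, mul_inv_cancel_left₀ (by positivity),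
        ← div_eq_mul_inv, one_le_div (by positivity)]
      gcongr
    nlinarith [mul_nonneg hF0 hG0]
  · refine le_add_of_nonneg_of_le (by positivity) ?_
    have : (1 : ℝ) ≤ (1 + ‖y‖) ^ b * ((1 + ‖t‖) ^ a * ((1 + ‖t‖) ^ (a + b))⁻¹) := by
      rw [pow_add, mul_inv, mul_inv_cancel_left₀ (by positivity),
        ← div_eq_mul_inv, one_le_div (by positivity)]
      gcongr
    nlinarith [mul_nonneg hF0 hG0]

theorem lintegral_weightedFourier_div_le {n a s : ℕ} (f : 𝓢(E n, ℝ)) :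
    ∫⁻ ξ, ‖weightedFourier a f ξ * ((1 + ‖ξ‖) ^ s)⁻¹‖ₑ ≤
      eLpNorm (fun ξ : E n => ((1 + ‖ξ‖) ^ s)⁻¹) 2 volume *
        eLpNorm (weightedFourier a f) 2 volume := by
  rw [← eLpNorm_one_eq_lintegral_enorm, mul_comm]
  exact eLpNorm_smul_le_mul_eLpNorm (p := 2) (q := 2) (r := 1)
    (f := fun ξ : E n => ((1 + ‖ξ‖) ^ s)⁻¹) (φ := weightedFourier a f)
    (Continuous.inv₀ (by fun_prop) fun x => by positivity).aestronglyMeasurable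
    (continuous_weightedFourier _ _).aestronglyMeasurable

theorem eLpNorm_two_sq {n : ℕ} {F : Type*} [NormedAddCommGroup F] (f : E n → F) :
    eLpNorm f 2 volume ^ 2 = ∫⁻ x, ‖f x‖ₑ ^ 2 := by
  have := eLpNorm_nnreal_pow_eq_lintegral (f := f) (μ := (volume : Measure (E n)))
    (p := 2) (by norm_num)
  simpa using this

/-- The product estimate `‖f g‖_{L²} ≤ C ‖f‖_{H^a} ‖g‖_{H^b}` for `a + b > n/2`, on Schwartz
functions: on the Fourier side it is Young's inequality for the convolution. -/
theorem exists_eLpNorm_mul_schwartz_le (n a b : ℕ) (hab : n < 2 * (a + b)) :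
    ∃ C : ℝ≥0, ∀ f g : 𝓢(E n, ℝ), eLpNorm (fun x => f x * g x) 2 volume ≤
      C * (‖ofSchwartz a f‖ₑ * ‖ofSchwartz b g‖ₑ) := by
  obtain ⟨Ca, hCa⟩ := exists_eLpNorm_weightedFourier_le n a
  obtain ⟨Cb, hCb⟩ := exists_eLpNorm_weightedFourier_le n b
  have hK := eLpNorm_inv_weight_lt_top hab
  set K := eLpNorm (fun ξ : E n => ((1 + ‖ξ‖) ^ (a + b))⁻¹) 2 volume with hKdef
  refine ⟨4 * K.toNNReal * Ca * Cb, fun f g => ?_⟩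
  set f1 : 𝓢(E n, ℂ) := 𝓕⁻ (toComplex f) with hf1
  set g1 : 𝓢(E n, ℂ) := 𝓕⁻ (toComplex g) with hg1
  set h : 𝓢(E n, ℂ) := SchwartzMap.convolution (ContinuousLinearMap.mul ℂ ℂ) f1 g1 with hh
  set A := eLpNorm (weightedFourier a f) 2 volume with hA
  set B := eLpNorm (weightedFourier b g) 2 volume with hB
  -- by Plancherel, since the Fourier transform of the convolution `h` is `f g`
  have e1 : eLpNorm (fun x => f x * g x) 2 volume = eLpNorm h 2 volume := by
    have h1 : ‖(𝓕 h).toLp 2 volume‖ = ‖h.toLp 2 volume‖ := SchwartzMap.norm_fourier_toL2_eq h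
    rw [SchwartzMap.norm_toLp, SchwartzMap.norm_toLp, ENNReal.toReal_eq_toReal_iff'
      (SchwartzMap.eLpNorm_lt_top (𝓕 h) 2 volume).ne
      (SchwartzMap.eLpNorm_lt_top h 2 volume).ne] at h1
    rw [← h1, hh, SchwartzMap.fourier_convolution, hf1, hg1,
      FourierTransform.fourier_fourierInv_eq, FourierTransform.fourier_fourierInv_eq]
    exact eLpNorm_congr_norm_ae (ae_of_all _ fun x => by simp)
  have hmA : Measurable fun ξ => ‖weightedFourier a f ξ‖ₑ :=
    (continuous_weightedFourier a f).measurable.enorm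
  have hmB : Measurable fun ξ => ‖weightedFourier b g ξ‖ₑ :=
    (continuous_weightedFourier b g).measurable.enorm
  have hw : Measurable fun ξ : E n => ((1 + ‖ξ‖) ^ (a + b))⁻¹ := by fun_prop
  have hmA' : Measurable fun ξ => ‖weightedFourier a f ξ * ((1 + ‖ξ‖) ^ (a + b))⁻¹‖ₑ :=
    ((continuous_weightedFourier a f).measurable.mul hw).enorm
  have hmB' : Measurable fun ξ => ‖weightedFourier b g ξ * ((1 + ‖ξ‖) ^ (a + b))⁻¹‖ₑ :=
    ((continuous_weightedFourier b g).measurable.mul hw).enorm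
  -- the two terms of the bound for `h` on the Fourier side that `fourier_product_weight_le` gives
  set P : E n → ℝ≥0∞ := fun x => ∫⁻ y, ‖weightedFourier a f (x - y)‖ₑ *
    ‖weightedFourier b g y * ((1 + ‖y‖) ^ (a + b))⁻¹‖ₑ with hP
  set Q : E n → ℝ≥0∞ := fun x => ∫⁻ t, ‖weightedFourier b g (x - t)‖ₑ *
    ‖weightedFourier a f t * ((1 + ‖t‖) ^ (a + b))⁻¹‖ₑ with hQ
  have e2 : ∀ x, ‖h x‖ₑ ≤ P x + Q x := by
    intro x
    rw [hh, SchwartzMap.convolution_apply]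
    have hP' : P x = ∫⁻ t, ‖weightedFourier a f t‖ₑ *
        ‖weightedFourier b g (x - t) * ((1 + ‖x - t‖) ^ (a + b))⁻¹‖ₑ := by
      rw [hP, ← lintegral_sub_left_eq_self _ x]
      simp only [sub_sub_cancel]
    have hm : Measurable fun t => ‖weightedFourier a f t‖ₑ *
        ‖weightedFourier b g (x - t) * ((1 + ‖x - t‖) ^ (a + b))⁻¹‖ₑ :=
      hmA.mul (hmB'.comp (measurable_const.sub measurable_id))
    rw [hP', show Q x = ∫⁻ t, ‖weightedFourier b g (x - t)‖ₑ *
      ‖weightedFourier a f t * ((1 + ‖t‖) ^ (a + b))⁻¹‖ₑ from rfl, ← lintegral_add_left hm]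
    refine (enorm_integral_le_lintegral_enorm _).trans (lintegral_mono fun t => ?_)
    simp only [ContinuousLinearMap.mul_apply']
    rw [← ofReal_norm, ← ofReal_norm, ← ofReal_norm, ← ofReal_norm, ← ofReal_norm,
      ← ENNReal.ofReal_mul (norm_nonneg _), ← ENNReal.ofReal_mul (norm_nonneg _),
      ← ENNReal.ofReal_add (by positivity) (by positivity)]
    refine ENNReal.ofReal_le_ofReal ?_
    have h0 := fourier_product_weight_le (a := a) (b := b) f g t (x - t)
    have p1 := weightedFourier_nonneg a f t
    have p2 := weightedFourier_nonneg b g (x - t)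
    rw [norm_mul, Real.norm_of_nonneg p1, Real.norm_of_nonneg p2,
      Real.norm_of_nonneg (mul_nonneg p2 (by positivity)),
      Real.norm_of_nonneg (mul_nonneg p1 (by positivity)),
      mul_comm (weightedFourier b g (x - t)) (weightedFourier a f t * _)]
    exact h0
  have e3 : ∫⁻ x, P x ^ 2 ≤ (K * B) ^ 2 * A ^ 2 := by
    refine (lintegral_conv_sq_le hmA hmB').trans ?_
    rw [hA, eLpNorm_two_sq]
    gcongr
    exact lintegral_weightedFourier_div_le g
  have e4 : ∫⁻ x, Q x ^ 2 ≤ (K * A) ^ 2 * B ^ 2 := by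
    refine (lintegral_conv_sq_le hmB hmA').trans ?_
    rw [hB, eLpNorm_two_sq]
    gcongr
    exact lintegral_weightedFourier_div_le f
  have hPm : Measurable P := Measurable.lintegral_prod_right' (f := fun p : E n × E n =>
    ‖weightedFourier a f (p.1 - p.2)‖ₑ *
      ‖weightedFourier b g p.2 * ((1 + ‖p.2‖) ^ (a + b))⁻¹‖ₑ)
    ((hmA.comp (measurable_fst.sub measurable_snd)).mul (hmB'.comp measurable_snd))
  have e5 : eLpNorm h 2 volume ^ 2 ≤ (4 * K * A * B) ^ 2 := by
    rw [eLpNorm_two_sq]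
    calc ∫⁻ x, ‖h x‖ₑ ^ 2 ≤ ∫⁻ x, (4 * P x ^ 2 + 4 * Q x ^ 2) := by
          refine lintegral_mono fun x => (pow_le_pow_left' (e2 x) 2).trans ?_
          have h2 : ∀ a b : ℝ≥0∞, a ≤ b → (a + b) ^ 2 ≤ 4 * b ^ 2 := fun a b hab => by
            calc (a + b) ^ 2 ≤ (b + b) ^ 2 := by gcongr
              _ = 4 * b ^ 2 := by ring
          rcases le_total (P x) (Q x) with hx | hx
          · exact (h2 _ _ hx).trans le_add_self
          · rw [add_comm (P x)]
            exact (h2 _ _ hx).trans le_self_add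
      _ = 4 * (∫⁻ x, P x ^ 2) + 4 * ∫⁻ x, Q x ^ 2 := by
          rw [lintegral_add_left (by fun_prop), lintegral_const_mul' _ _ (by norm_num),
            lintegral_const_mul' _ _ (by norm_num)]
      _ ≤ 4 * ((K * B) ^ 2 * A ^ 2) + 4 * ((K * A) ^ 2 * B ^ 2) := by gcongr
      _ = 8 * (K * A * B) ^ 2 := by ring
      _ ≤ 16 * (K * A * B) ^ 2 := by gcongr; norm_num
      _ = _ := by ring
  have e6 : eLpNorm h 2 volume ≤ 4 * K * A * B :=
    (ENNReal.pow_right_strictMono (by norm_num : (2 : ℕ) ≠ 0)).le_iff_le.1 e5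
  rw [e1]
  calc eLpNorm h 2 volume ≤ 4 * K * A * B := e6
    _ ≤ 4 * K * (Ca * ‖ofSchwartz a f‖ₑ) * (Cb * ‖ofSchwartz b g‖ₑ) := by
        gcongr
        · exact hCa f
        · exact hCb g
    _ = _ := by
        push_cast
        rw [ENNReal.coe_toNNReal hK.ne]
        ring

/-! ### Density of Schwartz functions -/

/-- Weak partial derivatives may be tested against Schwartz functions. -/
theorem IsPartial.integral_schwartz {n : ℕ} {i : Fin n} {f h : L2 n} (H : IsPartial i f h)
    (η : 𝓢(E n, ℝ)) :
    ∫ x, f x * (∂_{basisVec i} η : 𝓢(E n, ℝ)) x = -∫ x, h x * η x := by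
  -- `η` is approximated by the test functions `χ (c x) η(x)` with `c → 0`
  let χ : ContDiffBump (0 : E n) := ⟨1, 2, one_pos, one_lt_two⟩
  have hχ : ContDiff ℝ (⊤ : ℕ∞) (χ : E n → ℝ) := χ.contDiff
  obtain ⟨C, hC⟩ := (χ.hasCompactSupport.fderiv ℝ).exists_bound_of_continuous
    (hχ.continuous_fderiv (by simp))
  let c : ℕ → ℝ := fun m => ((m : ℝ) + 1)⁻¹
  have hc0 : ∀ m, 0 < c m := fun m => by positivity
  have hc1 : ∀ m, c m ≤ 1 := fun m => inv_le_one_of_one_le₀ (by simp)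
  have hcl : Tendsto c atTop (𝓝 0) := tendsto_inv_atTop_zero.comp
    (tendsto_atTop_add_const_right _ _ tendsto_natCast_atTop_atTop)
  have hsm : ∀ m, ContDiff ℝ (⊤ : ℕ∞) fun x : E n => χ (c m • x) := fun m =>
    hχ.comp (contDiff_const_smul _)
  have hcs : ∀ m, HasCompactSupport fun x : E n => χ (c m • x) := fun m =>
    χ.hasCompactSupport.comp_smul (hc0 m).ne'
  let ζ : ℕ → TestFn n := fun m => ⟨fun x => χ (c m • x) * η x, (hsm m).mul (η.smooth ⊤),
    (hcs m).mul_right, fun _ _ => trivial⟩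
  have hζ : ∀ m x, ζ m x = χ (c m • x) * η x := fun m x => rfl
  have hd : ∀ m x, (∂_{basisVec i} (ζ m) : TestFn n) x =
      χ (c m • x) * (∂_{basisVec i} η : 𝓢(E n, ℝ)) x +
        η x * (c m * fderiv ℝ χ (c m • x) (basisVec i)) := by
    intro m x
    rw [testFn_lineDeriv_apply, SchwartzMap.lineDerivOp_apply_eq_fderiv]
    have h1 : HasFDerivAt (fun x : E n => χ (c m • x))
        ((fderiv ℝ χ (c m • x)).comp (c m • ContinuousLinearMap.id ℝ (E n))) x :=
      (hχ.differentiable (by simp) _).hasFDerivAt.comp x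
        ((hasFDerivAt_id x).const_smul (c m))
    have h2 := h1.mul (η.hasFDerivAt x)
    have h3 : (⇑(ζ m)) = (fun x : E n => χ (c m • x)) * η := rfl
    rw [h3, h2.fderiv]
    simp
  have hlim : ∀ x : E n, Tendsto (fun m => χ (c m • x)) atTop (𝓝 1) := by
    intro x
    have h1 : Tendsto (fun m => c m • x) atTop (𝓝 (0 : E n)) := by
      simpa using hcl.smul_const x
    have h2 := (χ.continuous.tendsto (0 : E n)).comp h1
    rwa [χ.one_of_mem_closedBall (Metric.mem_closedBall_self χ.rIn_pos.le)] at h2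
  have hη2 : MemLp (fun x => η x) 2 (volume : Measure (E n)) := η.memLp 2 volume
  have hdη2 : MemLp (fun x => (∂_{basisVec i} η : 𝓢(E n, ℝ)) x) 2 (volume : Measure (E n)) :=
    (∂_{basisVec i} η : 𝓢(E n, ℝ)).memLp 2 volume
  have L1 : Tendsto (fun m => ∫ x, h x * ζ m x) atTop (𝓝 (∫ x, h x * η x)) := by
    refine tendsto_integral_of_dominated_convergence (fun x => ‖h x * η x‖)
      (fun m => (integrable_mul_testFn h (ζ m)).aestronglyMeasurable)
      ((Lp.memLp h).integrable_mul hη2).norm (fun m => ae_of_all _ fun x => ?_)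
      (ae_of_all _ fun x => ?_)
    · rw [hζ, mul_left_comm, norm_mul]
      exact mul_le_of_le_one_left (norm_nonneg _) (by
        rw [Real.norm_of_nonneg χ.nonneg]; exact χ.le_one)
    · simp only [hζ]
      have := ((hlim x).mul_const (η x)).const_mul (h x)
      rwa [one_mul] at this
  have L2' : Tendsto (fun m => ∫ x, f x * (∂_{basisVec i} (ζ m) : TestFn n) x) atTop
      (𝓝 (∫ x, f x * (∂_{basisVec i} η : 𝓢(E n, ℝ)) x)) := by
    refine tendsto_integral_of_dominated_convergence
      (fun x => ‖f x * (∂_{basisVec i} η : 𝓢(E n, ℝ)) x‖ + C * ‖f x * η x‖)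
      (fun m => (integrable_mul_testFn f _).aestronglyMeasurable)
      (((Lp.memLp f).integrable_mul hdη2).norm.add
        (((Lp.memLp f).integrable_mul hη2).norm.const_mul C)) (fun m => ae_of_all _ fun x => ?_)
      (ae_of_all _ fun x => ?_)
    · rw [hd, mul_add]
      refine (norm_add_le _ _).trans (add_le_add ?_ ?_)
      · rw [mul_left_comm, norm_mul]
        exact mul_le_of_le_one_left (norm_nonneg _) (by
          rw [Real.norm_of_nonneg χ.nonneg]; exact χ.le_one)
      · rw [← mul_assoc, norm_mul, mul_comm]
        gcongr
        rw [norm_mul, Real.norm_of_nonneg (hc0 m).le]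
        have hb : ‖fderiv ℝ χ (c m • x) (basisVec i)‖ ≤ C := by
          refine ((fderiv ℝ χ (c m • x)).le_opNorm _).trans ?_
          simpa [basisVec] using hC (c m • x)
        exact (mul_le_of_le_one_left (norm_nonneg _) (hc1 m)).trans hb
    · simp only [hd]
      have h1 : Tendsto (fun m => c m * fderiv ℝ χ (c m • x) (basisVec i)) atTop (𝓝 0) := by
        refine squeeze_zero_norm (a := fun m => c m * C) (fun m => ?_) (by
          simpa using hcl.mul_const C)
        rw [norm_mul, Real.norm_of_nonneg (hc0 m).le]
        refine mul_le_mul_of_nonneg_left ?_ (hc0 m).le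
        · refine ((fderiv ℝ χ (c m • x)).le_opNorm _).trans ?_
          simpa [basisVec] using hC (c m • x)
      have := (((hlim x).mul_const ((∂_{basisVec i} η : 𝓢(E n, ℝ)) x)).add
        (h1.const_mul (η x))).const_mul (f x)
      simpa using this
  refine tendsto_nhds_unique L2' ?_
  refine L1.neg.congr fun m => ?_
  exact (H (ζ m)).symm

theorem postcomp_lineDeriv {n : ℕ} {F G : Type*} [NormedAddCommGroup F] [NormedSpace ℝ F]
    [NormedAddCommGroup G] [NormedSpace ℝ G] (T : F →L[ℝ] G) (f : 𝓢(E n, F)) (v : E n) :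
    SchwartzMap.postcompCLM T (∂_{v} f : 𝓢(E n, F))
      = ∂_{v} (SchwartzMap.postcompCLM T f : 𝓢(E n, G)) := by
  ext x
  rw [SchwartzMap.lineDerivOp_apply_eq_fderiv, SchwartzMap.postcompCLM_apply,
    SchwartzMap.lineDerivOp_apply_eq_fderiv]
  have h : HasFDerivAt (fun y => T (f y)) (T.comp (fderiv ℝ f x)) x :=
    T.hasFDerivAt.comp x (f.hasFDerivAt x)
  have h' : (⇑(SchwartzMap.postcompCLM T f)) = fun y => T (f y) := rfl
  rw [h', h.fderiv]
  rfl

theorem schwartz_lineDeriv_comm {n : ℕ} (η : 𝓢(E n, ℝ)) (v w : E n) :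
    (∂_{v} (∂_{w} η) : 𝓢(E n, ℝ)) = ∂_{w} (∂_{v} η) := by
  have key : ∀ (v w x : E n), fderiv ℝ (fun y => fderiv ℝ η y w) x v
      = fderiv ℝ (fderiv ℝ η) x v w := by
    intro v w x
    have h : DifferentiableAt ℝ (fderiv ℝ η) x :=
      ((η.smooth 2).fderiv_right (m := 1) (by norm_num)).differentiable (by norm_num) x
    rw [fderiv_clm_apply h (differentiableAt_const w)]
    simp
  have hf : ∀ (w : E n), (⇑(∂_{w} η : 𝓢(E n, ℝ))) = fun y => fderiv ℝ η y w :=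
    fun w => funext fun y => SchwartzMap.lineDerivOp_apply_eq_fderiv w η y
  ext x
  rw [SchwartzMap.lineDerivOp_apply_eq_fderiv, SchwartzMap.lineDerivOp_apply_eq_fderiv,
    hf, hf, key, key]
  have hs : IsSymmSndFDerivAt ℝ η x :=
    ((η.smooth 2).contDiffAt (x := x)).isSymmSndFDerivAt (by
      simp only [minSmoothness_of_isRCLikeNormedField]; exact le_rfl)
  exact hs v w

/-- The normalization that gives `1 - c Δ` the Fourier symbol `1 + |ξ|²`. -/
def besselConst : ℝ := ((2 * Real.pi) ^ 2)⁻¹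

theorem besselConst_pos : 0 < besselConst := by
  unfold besselConst; have := Real.pi_pos; positivity

/-- The operator `1 - (2π)⁻² Δ` on Schwartz functions. -/
def besselOp {n : ℕ} {F : Type*} [NormedAddCommGroup F] [NormedSpace ℝ F] (η : 𝓢(E n, F)) :
    𝓢(E n, F) :=
  η - besselConst • ∑ i : Fin n, (∂_{basisVec i} (∂_{basisVec i} η : 𝓢(E n, F)) : 𝓢(E n, F))

/-- The symbol `1 + |ξ|²` of the operator is inverted by a Fourier multiplier. -/
theorem besselOp_surjective_complex {n : ℕ} (χ : 𝓢(E n, ℂ)) : ∃ η, besselOp η = χ := by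
  let g1 : E n → ℝ := fun x => (1 + ‖x‖ ^ 2) ^ (-1 : ℝ)
  let g2 : E n → ℝ := fun x => ‖x‖ ^ 2
  have h1 : g1.HasTemperateGrowth := Function.hasTemperateGrowth_one_add_norm_sq_rpow (E n) (-1)
  have h2 : g2.HasTemperateGrowth := by fun_prop
  refine ⟨SchwartzMap.fourierMultiplierCLM ℂ g1 χ, ?_⟩
  set η := SchwartzMap.fourierMultiplierCLM ℂ g1 χ with hη
  have hΔ := SchwartzMap.laplacian_eq_fourierMultiplierCLM η
  rw [SchwartzMap.laplacian_eq_sum (EuclideanSpace.basisFun (Fin n) ℝ)] at hΔ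
  have hb : ∀ i, EuclideanSpace.basisFun (Fin n) ℝ i = basisVec i := fun i => by
    simp [basisVec]
  simp only [hb] at hΔ
  rw [besselOp, hΔ, smul_smul]
  have hc : besselConst * -(2 * Real.pi) ^ 2 = -1 := by
    have := Real.pi_pos
    unfold besselConst
    field_simp
  rw [hc, neg_one_smul, sub_neg_eq_add, hη]
  have e2 : SchwartzMap.fourierMultiplierCLM ℂ (fun x : E n => ‖x‖ ^ 2)
      (SchwartzMap.fourierMultiplierCLM ℂ g1 χ)
      = SchwartzMap.fourierMultiplierCLM ℂ (g2 * g1) χ :=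
    SchwartzMap.fourierMultiplierCLM_fourierMultiplierCLM_apply h2 h1 χ
  have e3 : (‖·‖ ^ 2 : E n → ℝ) = fun x => ‖x‖ ^ 2 := rfl
  rw [e3, e2, SchwartzMap.fourierMultiplierCLM_apply, SchwartzMap.fourierMultiplierCLM_apply,
    ← FourierTransform.fourierInv_add]
  have e4 : SchwartzMap.smulLeftCLM ℂ g1 (𝓕 χ) + SchwartzMap.smulLeftCLM ℂ (g2 * g1) (𝓕 χ)
      = 𝓕 χ := by
    ext x
    rw [_root_.add_apply, SchwartzMap.smulLeftCLM_apply_apply h1,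
      SchwartzMap.smulLeftCLM_apply_apply (h2.mul h1), ← add_smul]
    have : g1 x + (g2 * g1) x = 1 := by
      simp only [g1, g2, Pi.mul_apply, Real.rpow_neg_one]
      have : (1 + ‖x‖ ^ 2) ≠ 0 := by positivity
      field_simp
    rw [this, one_smul]
  rw [e4, FourierTransform.fourierInv_fourier_eq]

theorem besselOp_surjective {n : ℕ} (χ : 𝓢(E n, ℝ)) : ∃ η, besselOp η = χ := by
  obtain ⟨η, hη⟩ := besselOp_surjective_complex (toComplex χ)
  refine ⟨SchwartzMap.postcompCLM Complex.reCLM η, ?_⟩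
  have h := congrArg (SchwartzMap.postcompCLM (𝕜 := ℝ) Complex.reCLM) hη
  have h2 : SchwartzMap.postcompCLM (𝕜 := ℝ) Complex.reCLM (toComplex χ) = χ := by
    ext x; simp [SchwartzMap.postcompCLM_apply]
  rw [h2] at h
  rw [← h, besselOp, besselOp, map_sub, map_smul, map_sum]
  simp only [postcomp_lineDeriv]

theorem besselOp_iterate_surjective {n : ℕ} (k : ℕ) (χ : 𝓢(E n, ℝ)) :
    ∃ η, besselOp^[k] η = χ :=
  (Function.Surjective.iterate (f := besselOp) (fun χ => besselOp_surjective χ) k) χ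

theorem besselOp_lineDeriv {n : ℕ} (v : E n) (η : 𝓢(E n, ℝ)) :
    besselOp (∂_{v} η) = ∂_{v} (besselOp η) := by
  unfold besselOp
  have h : ∀ ζ : 𝓢(E n, ℝ), (∂_{v} ζ : 𝓢(E n, ℝ)) = LineDeriv.lineDerivOpCLM ℝ 𝓢(E n, ℝ) v ζ :=
    fun _ => rfl
  rw [h (η - _), map_sub, map_smul, map_sum]
  simp only [← h]
  congr 2
  refine Finset.sum_congr rfl fun i _ => ?_
  rw [schwartz_lineDeriv_comm η, schwartz_lineDeriv_comm (∂_{basisVec i} η)]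

theorem besselOp_iterate_lineDeriv {n : ℕ} (v : E n) (k : ℕ) (η : 𝓢(E n, ℝ)) :
    besselOp^[k] (∂_{v} η) = ∂_{v} (besselOp^[k] η) := by
  induction k with
  | zero => rfl
  | succ k ih => rw [Function.iterate_succ_apply', ih, besselOp_lineDeriv,
      Function.iterate_succ_apply']

/-- The bilinear form `⟨(1 - c Δ)^k f, g⟩_{L²}` on `H^k`, defined recursively through first
derivatives. It is equivalent to the inner product of `H^k`, but has the simple symbol
`(1 + |ξ|²)^k`. -/
def besselForm (n : ℕ) : (k : ℕ) → Sobolev n k →L[ℝ] Sobolev n k →L[ℝ] ℝ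
  | 0 => (innerSL ℝ).bilinearComp Sobolev.toL2CLM Sobolev.toL2CLM
  | k + 1 => (besselForm n k).bilinearComp (Sobolev.lower k.le_succ) (Sobolev.lower k.le_succ) +
      besselConst • ∑ i, (besselForm n k).bilinearComp (Sobolev.D i) (Sobolev.D i)

/-- By induction, `⟨f, f⟩` is bounded below by the squares of the `H^k`-norms of `f` and of its
first derivatives. -/
theorem isCoercive_besselForm (n k : ℕ) : IsCoercive (besselForm n k) := by
  induction k with
  | zero =>
    obtain ⟨C, hC0, hC⟩ := Sobolev.exists_norm_zero_le n
    refine ⟨((C + 1) ^ 2)⁻¹, by positivity, fun f => ?_⟩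
    have h1 : besselForm n 0 f f = ‖f.toL2‖ ^ 2 := by
      simp [besselForm]
    rw [h1, mul_assoc, inv_mul_le_iff₀ (by positivity), ← mul_pow, ← pow_two]
    refine pow_le_pow_left₀ (norm_nonneg _) ((hC f).trans ?_) 2
    have := norm_nonneg f.toL2
    nlinarith
  | succ k ih =>
    obtain ⟨c, hc, hB⟩ := ih
    obtain ⟨C, hC0, hC⟩ := Sobolev.exists_norm_succ_le n k
    obtain ⟨c', hc'0, h1, h2⟩ : ∃ c' : ℝ, 0 < c' ∧ c' ≤ c ∧ c' ≤ besselConst * c :=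
      ⟨min c (besselConst * c), lt_min hc (mul_pos besselConst_pos hc), min_le_left _ _,
        min_le_right _ _⟩
    refine ⟨c' * (((C + 1) ^ 2 * (n + 1 : ℕ)))⁻¹, by positivity, fun f => ?_⟩
    have hB' : ∀ u : Sobolev n k, c * ‖u‖ ^ 2 ≤ besselForm n k u u := fun u => by
      have := hB u
      rwa [mul_assoc, ← pow_two] at this
    have hf := hC f
    have hL : ‖f.toL2‖ ≤ ‖Sobolev.lower k.le_succ f‖ := (Sobolev.lower k.le_succ f).norm_toL2_le
    have hform : besselForm n (k + 1) f f = besselForm n k (Sobolev.lower k.le_succ f)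
        (Sobolev.lower k.le_succ f) + besselConst * ∑ i, besselForm n k (Sobolev.D i f)
        (Sobolev.D i f) := by
      simp only [besselForm, _root_.add_apply, smul_apply, _root_.sum_apply,
        ContinuousLinearMap.bilinearComp_apply, smul_eq_mul]
    have hb1 := hB' (Sobolev.lower k.le_succ f)
    have hb2 := fun i => hB' (Sobolev.D i f)
    rw [hform]
    generalize besselForm n k (Sobolev.lower k.le_succ f) (Sobolev.lower k.le_succ f) = b at *
    have hL0 : 0 ≤ ‖Sobolev.lower k.le_succ f‖ := norm_nonneg _
    have hd0 : ∀ i, 0 ≤ ‖Sobolev.D i f‖ := fun i => norm_nonneg _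
    generalize ‖Sobolev.lower k.le_succ f‖ = L at *
    generalize ‖f.toL2‖ = l at *
    obtain ⟨d, hd⟩ : ∃ d : Fin n → ℝ, ∀ i, ‖Sobolev.D i f‖ = d i := ⟨_, fun _ => rfl⟩
    obtain ⟨β, hβ⟩ : ∃ β : Fin n → ℝ, ∀ i, besselForm n k (Sobolev.D i f) (Sobolev.D i f) = β i :=
      ⟨_, fun _ => rfl⟩
    simp only [hd, hβ] at hf hb2 hd0 ⊢
    have hS : c' * (L ^ 2 + ∑ i, d i ^ 2) ≤ b + besselConst * ∑ i, β i := by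
      rw [mul_add, Finset.mul_sum, Finset.mul_sum]
      refine add_le_add ((mul_le_mul_of_nonneg_right h1 (by positivity)).trans hb1)
        (Finset.sum_le_sum fun i _ => ?_)
      refine (mul_le_mul_of_nonneg_right h2 (by positivity)).trans ?_
      rw [mul_assoc]
      exact mul_le_mul_of_nonneg_left (hb2 i) besselConst_pos.le
    have h3 : ‖f‖ ≤ (C + 1) * (L + ∑ i, d i) := by
      have h5 : 0 ≤ ∑ i, d i := Finset.sum_nonneg fun i _ => hd0 i
      nlinarith
    have h4 : (L + ∑ i, d i) ^ 2 ≤ (n + 1 : ℕ) * (L ^ 2 + ∑ i, d i ^ 2) := by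
      have := sq_sum_le_card_mul_sum_sq (s := (Finset.univ : Finset (Option (Fin n))))
        (f := fun o => o.elim L d)
      simpa [Fintype.sum_option] using this
    have h6 : ‖f‖ ^ 2 ≤ (C + 1) ^ 2 * (n + 1 : ℕ) * (L ^ 2 + ∑ i, d i ^ 2) :=
      (pow_le_pow_left₀ (norm_nonneg _) h3 2).trans (by rw [mul_pow, mul_assoc]; gcongr)
    refine le_trans ?_ hS
    rw [mul_assoc, mul_assoc, ← pow_two]
    refine mul_le_mul_of_nonneg_left ?_ hc'0.le
    rwa [inv_mul_le_iff₀ (by positivity)]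

theorem besselForm_ofSchwartz {n : ℕ} (k : ℕ) (f : Sobolev n k) (η : 𝓢(E n, ℝ)) :
    besselForm n k f (ofSchwartz k η) = ∫ x, f.toL2 x * (besselOp^[k] η) x := by
  induction k generalizing η with
  | zero =>
    simp only [besselForm, ContinuousLinearMap.bilinearComp_apply, innerSL_apply_apply,
      L2.inner_def, Sobolev.toL2CLM_apply, toL2_ofSchwartz, Function.iterate_zero, id]
    refine integral_congr_ae ?_
    filter_upwards [η.coeFn_toLp 2 volume] with x hx
    rw [hx]; simp [mul_comm]
  | succ k ih =>
    have hint : ∀ (g : L2 n) (ζ : 𝓢(E n, ℝ)), Integrable fun x => g x * ζ x := fun g ζ =>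
      (Lp.memLp g).integrable_mul (ζ.memLp 2 volume)
    simp only [besselForm, _root_.add_apply, smul_apply, _root_.sum_apply,
        ContinuousLinearMap.bilinearComp_apply, smul_eq_mul, lower_ofSchwartz, D_ofSchwartz, ih,
        Sobolev.toL2_lower]
    have h1 : ∀ i, ∫ x, (Sobolev.D i f).toL2 x * (besselOp^[k] (∂_{basisVec i} η)) x
        = -∫ x, f.toL2 x * (∂_{basisVec i} (∂_{basisVec i} (besselOp^[k] η)) : 𝓢(E n, ℝ)) x := by
      intro i
      rw [(f.isPartial_D i).integral_schwartz, neg_neg, besselOp_iterate_lineDeriv]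
    simp only [h1]
    rw [Function.iterate_succ_apply']
    simp only [besselOp, _root_.sub_apply, smul_apply, _root_.sum_apply, mul_sub,
      smul_eq_mul, mul_left_comm _ besselConst]
    rw [integral_sub (hint _ _) ?_, integral_const_mul]
    · simp only [Finset.mul_sum]
      rw [integral_finsetSum _ fun i _ => hint _ _]
      simp [Finset.mul_sum, sub_eq_add_neg]
    · refine Integrable.const_mul ?_ _
      simp only [Finset.mul_sum]
      exact integrable_finsetSum _ fun i _ => hint _ _

/-- Schwartz functions are dense in `H^k`. -/
theorem denseRange_ofSchwartz (n k : ℕ) : DenseRange (ofSchwartz (n := n) k) := by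
  have h : (LinearMap.range (ofSchwartz (n := n) k)).topologicalClosure = ⊤ := by
    rw [Submodule.topologicalClosure_eq_top_iff, Submodule.eq_bot_iff]
    intro f0 hf0
    -- represent `⟨f0, ·⟩` through the coercive form, where orthogonality to all Schwartz
    -- functions can be read off
    let e := (isCoercive_besselForm n k).continuousLinearEquivOfBilin
    let v := e.symm f0
    have hv : ∀ η : 𝓢(E n, ℝ), ∫ x, v.toL2 x * (besselOp^[k] η) x = 0 := by
      intro η
      rw [← besselForm_ofSchwartz, ← IsCoercive.continuousLinearEquivOfBilin_apply
        (isCoercive_besselForm n k)]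
      rw [Submodule.mem_orthogonal'] at hf0
      have : (isCoercive_besselForm n k).continuousLinearEquivOfBilin v = f0 :=
        e.apply_symm_apply f0
      rw [this]
      exact hf0 _ (LinearMap.mem_range_self _ η)
    have hv0 : v.toL2 = 0 := by
      apply Lp.ext
      refine EventuallyEq.trans (ae_eq_zero_of_integral_contDiff_smul_eq_zero
        ((Lp.memLp v.toL2).locallyIntegrable (by norm_num)) ?_)
        (Lp.coeFn_zero ℝ 2 volume).symm
      intro g hg hgc
      obtain ⟨η, hη⟩ := besselOp_iterate_surjective k (hgc.toSchwartzMap hg)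
      have := hv η
      rw [hη] at this
      rw [← this]
      exact integral_congr_ae (ae_of_all _ fun x => mul_comm _ _)
    have hv1 : v = 0 := Sobolev.ext_toL2 (by rw [hv0, map_zero])
    have : f0 = e v := (e.apply_symm_apply f0).symm
    rw [this, hv1, map_zero]
  exact (Submodule.dense_iff_topologicalClosure_eq_top.2 h)

/-- Schwartz approximations of an element of `H^k` that converge both in `H^k` and pointwise
almost everywhere. -/
theorem exists_schwartz_seq {n k : ℕ} (f : Sobolev n k) : ∃ u : ℕ → 𝓢(E n, ℝ),
    Tendsto (fun m => ofSchwartz k (u m)) atTop (𝓝 f) ∧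
    ∀ᵐ x, Tendsto (fun m => u m x) atTop (𝓝 (f.toL2 x)) := by
  obtain ⟨F, hF, hlim⟩ := mem_closure_iff_seq_limit.1 (denseRange_ofSchwartz n k f)
  choose u hu using hF
  have h1 : Tendsto (fun m => (F m).toL2) atTop (𝓝 f.toL2) :=
    (Sobolev.toL2CLM.continuous.tendsto f).comp hlim
  obtain ⟨ns, hns, hae⟩ := (tendstoInMeasure_of_tendsto_Lp h1).exists_seq_tendsto_ae
  refine ⟨fun m => u (ns m), ?_, ?_⟩
  · simp only [hu]
    exact hlim.comp hns.tendsto_atTop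
  · have h2 : ∀ᵐ x, ∀ m, (F m).toL2 x = u m x := by
      rw [ae_all_iff]
      intro m
      rw [← hu m, toL2_ofSchwartz]
      exact (u m).coeFn_toLp 2 volume
    filter_upwards [hae, h2] with x hx hx2
    simpa only [hx2] using hx

/-! ### Products -/

theorem exists_eLpNorm_mul_le (n a b : ℕ) (hab : n < 2 * (a + b)) :
    ∃ C : ℝ≥0, ∀ (f : Sobolev n a) (g : Sobolev n b),
      eLpNorm (fun x => f.toL2 x * g.toL2 x) 2 volume ≤ C * (‖f‖ₑ * ‖g‖ₑ) := by
  obtain ⟨C, hC⟩ := exists_eLpNorm_mul_schwartz_le n a b hab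
  refine ⟨C, fun f g => ?_⟩
  obtain ⟨u, hu, hu'⟩ := exists_schwartz_seq f
  obtain ⟨v, hv, hv'⟩ := exists_schwartz_seq g
  have h1 := Lp.eLpNorm_lim_le_liminf_eLpNorm (p := 2) (μ := (volume : Measure (E n)))
    (f := fun m x => u m x * v m x)
    (fun m => ((u m).continuous.mul (v m).continuous).aestronglyMeasurable)
    (fun x => f.toL2 x * g.toL2 x) (by
      filter_upwards [hu', hv'] with x hx hy using hx.mul hy)
  refine h1.trans ?_
  have h2 : Tendsto (fun m => C * (‖ofSchwartz a (u m)‖ₑ * ‖ofSchwartz b (v m)‖ₑ)) atTop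
      (𝓝 (C * (‖f‖ₑ * ‖g‖ₑ))) := by
    refine ENNReal.Tendsto.const_mul ?_ (Or.inr ENNReal.coe_ne_top)
    exact ENNReal.Tendsto.mul hu.enorm (Or.inr enorm_ne_top) hv.enorm (Or.inr enorm_ne_top)
  rw [← h2.liminf_eq]
  exact liminf_le_liminf (Eventually.of_forall fun m => hC _ _)

theorem memLp_mul {n a b : ℕ} (hab : n < 2 * (a + b)) (f : Sobolev n a) (g : Sobolev n b) :
    MemLp (fun x => f.toL2 x * g.toL2 x) 2 volume := by
  obtain ⟨C, hC⟩ := exists_eLpNorm_mul_le n a b hab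
  refine ⟨(Lp.aestronglyMeasurable _).mul (Lp.aestronglyMeasurable _), (hC f g).trans_lt ?_⟩
  exact ENNReal.mul_lt_top ENNReal.coe_lt_top (ENNReal.mul_lt_top enorm_lt_top enorm_lt_top)

theorem Sobolev.coeFn_add {n k : ℕ} (f g : Sobolev n k) :
    (f + g).toL2 =ᵐ[volume] fun x => f.toL2 x + g.toL2 x := by
  rw [map_add]; exact Lp.coeFn_add _ _

theorem Sobolev.coeFn_smul {n k : ℕ} (c : ℝ) (f : Sobolev n k) :
    (c • f).toL2 =ᵐ[volume] fun x => c * f.toL2 x := by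
  rw [map_smul]; exact Lp.coeFn_smul _ _

/-- A bilinear map into `H^c` determined by multiplication of functions and a norm bound. -/
theorem exists_bilinear {n a b c : ℕ} {C : ℝ} (h : ∀ (f : Sobolev n a) (g : Sobolev n b),
    ∃ u : Sobolev n c, (u.toL2 =ᵐ[volume] fun x => f.toL2 x * g.toL2 x) ∧ ‖u‖ ≤ C * ‖f‖ * ‖g‖) :
    ∃ B : Sobolev n a →L[ℝ] Sobolev n b →L[ℝ] Sobolev n c,
      ∀ f g, (B f g).toL2 =ᵐ[volume] fun x => f.toL2 x * g.toL2 x := by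
  choose u hu hC using h
  have key : ∀ {v w : Sobolev n c} {F : E n → ℝ}, v.toL2 =ᵐ[volume] F → w.toL2 =ᵐ[volume] F →
      v = w := fun hv hw => Sobolev.ext_toL2 (Lp.ext (hv.trans hw.symm))
  refine ⟨LinearMap.mkContinuous₂ (LinearMap.mk₂ ℝ u ?_ ?_ ?_ ?_) C hC, hu⟩
  · intro f f' g
    refine key (hu _ _) ?_
    filter_upwards [Sobolev.coeFn_add (u f g) (u f' g), Sobolev.coeFn_add f f', hu f g, hu f' g]
      with x h1 h2 h3 h4
    rw [h1, h2, h3, h4, add_mul]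
  · intro r f g
    refine key (hu _ _) ?_
    filter_upwards [Sobolev.coeFn_smul r (u f g), Sobolev.coeFn_smul r f, hu f g]
      with x h1 h2 h3
    rw [h1, h2, h3, mul_assoc]
  · intro f g g'
    refine key (hu _ _) ?_
    filter_upwards [Sobolev.coeFn_add (u f g) (u f g'), Sobolev.coeFn_add g g', hu f g, hu f g']
      with x h1 h2 h3 h4
    rw [h1, h2, h3, h4, mul_add]
  · intro r f g
    refine key (hu _ _) ?_
    filter_upwards [Sobolev.coeFn_smul r (u f g), Sobolev.coeFn_smul r g, hu f g]
      with x h1 h2 h3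
    rw [h1, h2, h3, mul_left_comm]

theorem exists_mulL2 {n a b : ℕ} (hab : n < 2 * (a + b)) :
    ∃ B : Sobolev n a →L[ℝ] Sobolev n b →L[ℝ] Sobolev n 0,
      ∀ f g, (B f g).toL2 =ᵐ[volume] fun x => f.toL2 x * g.toL2 x := by
  obtain ⟨C, hC⟩ := exists_eLpNorm_mul_le n a b hab
  refine exists_bilinear (C := ‖Sobolev.ofL2 (n := n)‖ * C) fun f g =>
    ⟨Sobolev.ofL2 (memLp_mul hab f g).toLp, (memLp_mul hab f g).coeFn_toLp, ?_⟩
  refine (Sobolev.ofL2.le_opNorm _).trans ?_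
  rw [mul_assoc, mul_assoc]
  refine mul_le_mul_of_nonneg_left ?_ (norm_nonneg _)
  rw [Lp.norm_toLp]
  refine (ENNReal.toReal_mono ?_ (hC f g)).trans_eq (by simp)
  exact (ENNReal.mul_lt_top ENNReal.coe_lt_top (ENNReal.mul_lt_top enorm_lt_top enorm_lt_top)).ne

/-- The weak product rule. -/
theorem isPartial_mul {n a b : ℕ} (hab : n < 2 * (a + b + 1)) (i : Fin n) (f : Sobolev n (a + 1))
    (g : Sobolev n (b + 1)) {p q r : L2 n} (hp : p =ᵐ[volume] fun x => f.toL2 x * g.toL2 x)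
    (hq : q =ᵐ[volume] fun x => (Sobolev.D i f).toL2 x * g.toL2 x)
    (hr : r =ᵐ[volume] fun x => f.toL2 x * (Sobolev.D i g).toL2 x) : IsPartial i p (q + r) := by
  obtain ⟨B0, hB0⟩ := exists_mulL2 (n := n) (a := a + 1) (b := b + 1) (by omega)
  obtain ⟨B1, hB1⟩ := exists_mulL2 (n := n) (a := a) (b := b + 1) (by omega)
  obtain ⟨B2, hB2⟩ := exists_mulL2 (n := n) (a := a + 1) (b := b) (by omega)
  have ep : p = (B0 f g).toL2 := Lp.ext (hp.trans (hB0 f g).symm)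
  have eq : q = (B1 (Sobolev.D i f) g).toL2 := Lp.ext (hq.trans (hB1 _ g).symm)
  have er : r = (B2 f (Sobolev.D i g)).toL2 := Lp.ext (hr.trans (hB2 f _).symm)
  rw [ep, eq, er]
  obtain ⟨u, hu, -⟩ := exists_schwartz_seq f
  obtain ⟨v, hv, -⟩ := exists_schwartz_seq g
  have hDu := ((Sobolev.D i).continuous.tendsto f).comp hu
  have hDv := ((Sobolev.D i).continuous.tendsto g).comp hv
  have tl : ∀ {F : ℕ → Sobolev n 0} {G : Sobolev n 0}, Tendsto F atTop (𝓝 G) →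
      Tendsto (fun m => (F m).toL2) atTop (𝓝 G.toL2) := fun h =>
    (Sobolev.toL2CLM.continuous.tendsto _).comp h
  refine IsPartial.of_tendsto (l := atTop) (Eventually.of_forall fun m => ?_)
    (tl ((B0.continuous₂.tendsto (_, _)).comp (hu.prodMk_nhds hv)))
    ((tl ((B1.continuous₂.tendsto (_, _)).comp (hDu.prodMk_nhds hv))).add
      (tl ((B2.continuous₂.tendsto (_, _)).comp (hu.prodMk_nhds hDv))))
  have c : ∀ (k : ℕ) (w : 𝓢(E n, ℝ)), (ofSchwartz k w).toL2 =ᵐ[volume] w :=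
    fun k w => w.coeFn_toLp 2 volume
  refine isPartial_of_hasLineDerivAt (F := fun x => u m x * v m x)
    (G := fun x => (∂_{basisVec i} (u m) : 𝓢(E n, ℝ)) x * v m x
      + u m x * (∂_{basisVec i} (v m) : 𝓢(E n, ℝ)) x) ?_ ?_ fun x => ?_
  · filter_upwards [hB0 (ofSchwartz _ (u m)) (ofSchwartz _ (v m)), c (a + 1) (u m),
      c (b + 1) (v m)] with x h1 h2 h3
    rw [← h2, ← h3]; exact h1
  · refine (Lp.coeFn_add _ _).trans ?_
    simp only [Function.comp_apply, D_ofSchwartz, Function.uncurry_apply_pair]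
    filter_upwards [hB1 (ofSchwartz _ (∂_{basisVec i} (u m))) (ofSchwartz _ (v m)),
      hB2 (ofSchwartz _ (u m)) (ofSchwartz _ (∂_{basisVec i} (v m))), c (a + 1) (u m),
      c (b + 1) (v m), c a (∂_{basisVec i} (u m)), c b (∂_{basisVec i} (v m))]
      with x h1 h2 h3 h4 h5 h6
    rw [Pi.add_apply, h1, h2, h3, h4, h5, h6]
  · have := ((u m).hasFDerivAt x).mul ((v m).hasFDerivAt x)
    have h2 := this.hasLineDerivAt (basisVec i)
    have e : (∂_{basisVec i} (u m) : 𝓢(E n, ℝ)) x * v m x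
        + u m x * (∂_{basisVec i} (v m) : 𝓢(E n, ℝ)) x
        = (u m x • fderiv ℝ (v m) x + v m x • fderiv ℝ (u m) x) (basisVec i) := by
      rw [SchwartzMap.lineDerivOp_apply_eq_fderiv, SchwartzMap.lineDerivOp_apply_eq_fderiv]
      simp only [_root_.add_apply, _root_.smul_apply, smul_eq_mul]
      ring
    rw [e]
    exact h2

/-- The product estimate `H^a × H^b → H^c`, by induction on `c` with the Leibniz rule. -/
theorem exists_mul_bound {n : ℕ} (c : ℕ) : ∀ (a b : ℕ), c ≤ a → c ≤ b → n + 2 * c < 2 * (a + b) →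
    ∃ C : ℝ, ∀ (f : Sobolev n a) (g : Sobolev n b), ∃ u : Sobolev n c,
      (u.toL2 =ᵐ[volume] fun x => f.toL2 x * g.toL2 x) ∧ ‖u‖ ≤ C * ‖f‖ * ‖g‖ := by
  induction c with
  | zero =>
    intro a b _ _ h
    obtain ⟨B, hB⟩ := exists_mulL2 (n := n) (a := a) (b := b) (by omega)
    exact ⟨‖B‖, fun f g => ⟨B f g, hB f g, B.le_opNorm₂ f g⟩⟩
  | succ c ih =>
    rintro (_ | a) (_ | b) ha hb h
    · omega
    · omega
    · omega
    obtain ⟨B, hB⟩ := exists_mulL2 (n := n) (a := a + 1) (b := b + 1) (by omega)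
    obtain ⟨C1, h1⟩ := ih a (b + 1) (by omega) (by omega) (by omega)
    obtain ⟨C2, h2⟩ := ih (a + 1) b (by omega) (by omega) (by omega)
    obtain ⟨B1, hB1⟩ := exists_bilinear h1
    obtain ⟨B2, hB2⟩ := exists_bilinear h2
    obtain ⟨C, hC0, hC⟩ := Sobolev.exists_norm_succ_le n c
    refine ⟨C * (‖B‖ + ∑ i : Fin n, (‖B1‖ * ‖Sobolev.D (n := n) (k := a) i‖
      + ‖B2‖ * ‖Sobolev.D (n := n) (k := b) i‖)), fun f g => ?_⟩
    have hp : ∀ i, IsPartial i (B f g).toL2 (B1 (Sobolev.D i f) g + B2 f (Sobolev.D i g)).toL2 :=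
      fun i => by
        rw [map_add]
        exact isPartial_mul (by omega) i f g (hB f g) (hB1 _ _) (hB2 _ _)
    set u : Sobolev n (c + 1) := Sobolev.mk (B f g).toL2 (Sobolev.mem_succ fun i => ⟨_, hp i⟩)
      with hu
    have hD : ∀ i, Sobolev.D i u = B1 (Sobolev.D i f) g + B2 f (Sobolev.D i g) :=
      fun i => Sobolev.D_eq (hp i)
    refine ⟨u, hB f g, (hC u).trans ?_⟩
    rw [mul_assoc, mul_assoc]
    refine mul_le_mul_of_nonneg_left ?_ hC0
    rw [add_mul, Finset.sum_mul]
    refine add_le_add ?_ (Finset.sum_le_sum fun i _ => ?_)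
    · rw [← mul_assoc]
      exact ((B f g).norm_toL2_le).trans (B.le_opNorm₂ f g)
    · rw [hD, add_mul]
      refine (norm_add_le _ _).trans (add_le_add ?_ ?_)
      · refine (B1.le_opNorm₂ _ _).trans ?_
        calc ‖B1‖ * ‖Sobolev.D i f‖ * ‖g‖
            ≤ ‖B1‖ * (‖Sobolev.D (n := n) (k := a) i‖ * ‖f‖) * ‖g‖ := by
              gcongr; exact (Sobolev.D i).le_opNorm f
          _ = _ := by ring
      · refine (B2.le_opNorm₂ _ _).trans ?_
        calc ‖B2‖ * ‖f‖ * ‖Sobolev.D i g‖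
            ≤ ‖B2‖ * ‖f‖ * (‖Sobolev.D (n := n) (k := b) i‖ * ‖g‖) := by
              gcongr; exact (Sobolev.D i).le_opNorm g
          _ = _ := by ring

/-- The multiplication `H^a × H^b → H^c`, for `c ≤ a, b` and `a + b - c > n/2`. -/
def mulB {n a b c : ℕ} (ha : c ≤ a) (hb : c ≤ b) (h : n + 2 * c < 2 * (a + b)) :
    Sobolev n a →L[ℝ] Sobolev n b →L[ℝ] Sobolev n c :=
  (exists_bilinear (exists_mul_bound c a b ha hb h).choose_spec).choose

theorem coeFn_mulB {n a b c : ℕ} (ha : c ≤ a) (hb : c ≤ b) (h : n + 2 * c < 2 * (a + b))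
    (f : Sobolev n a) (g : Sobolev n b) :
    (mulB ha hb h f g).toL2 =ᵐ[volume] fun x => f.toL2 x * g.toL2 x :=
  (exists_bilinear (exists_mul_bound c a b ha hb h).choose_spec).choose_spec f g

/-! ### The Sobolev embedding -/

theorem exists_embedding_bound {n s : ℕ} (hs : n < 2 * s) : ∃ C, ∀ f : 𝓢(E n, ℝ),
    ‖(SchwartzMap.toZeroAtInftyCLM ℝ (E n) ℝ).toLinearMap f‖ ≤ C * ‖ofSchwartz s f‖ := by
  obtain ⟨C, hC⟩ := exists_sup_le n s hs
  refine ⟨max C 0, fun f => ?_⟩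
  rw [← ZeroAtInftyContinuousMap.norm_toBCF_eq_norm]
  refine (BoundedContinuousFunction.norm_le (by positivity)).2 fun x => ?_
  exact (hC f x).trans (by gcongr; exact le_max_left _ _)

open ZeroAtInfty in
/-- The Sobolev embedding `H^s → C₀`: the continuous representative. It is the extension of the
inclusion of Schwartz functions by density, and has this meaning only for `s > n/2`; for other `s`
nothing is claimed about it. -/
def emb {n s : ℕ} : Sobolev n s →L[ℝ] C₀(E n, ℝ) :=
  (SchwartzMap.toZeroAtInftyCLM ℝ (E n) ℝ).toLinearMap.extendOfNorm (ofSchwartz s)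

theorem emb_ofSchwartz {n s : ℕ} (hs : n < 2 * s) (f : 𝓢(E n, ℝ)) (x : E n) :
    emb (ofSchwartz s f) x = f x := by
  have := LinearMap.extendOfNorm_eq (denseRange_ofSchwartz n s) (exists_embedding_bound hs) f
  rw [emb, this]
  rfl

theorem abs_emb_le {n s : ℕ} (f : Sobolev n s) (x : E n) :
    |emb f x| ≤ ‖emb (n := n) (s := s)‖ * ‖f‖ := by
  refine le_trans ?_ (emb.le_opNorm f)
  rw [← ZeroAtInftyContinuousMap.norm_toBCF_eq_norm]
  exact (emb f).toBCF.norm_coe_le_norm x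

theorem tendstoUniformly_emb {n s : ℕ} {X : Type*} {l : Filter X} {F : X → Sobolev n s}
    {f : Sobolev n s} (h : Tendsto F l (𝓝 f)) :
    TendstoUniformly (fun x => ⇑(emb (F x))) (emb f) l := by
  have := (emb.continuous.tendsto f).comp h
  rwa [ZeroAtInftyContinuousMap.tendsto_iff_tendstoUniformly] at this

theorem emb_ae {n s : ℕ} (hs : n < 2 * s) (f : Sobolev n s) : f.toL2 =ᵐ[volume] emb f := by
  obtain ⟨u, hu, hu'⟩ := exists_schwartz_seq f
  filter_upwards [hu'] with x hx
  refine tendsto_nhds_unique hx ?_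
  have := (tendstoUniformly_emb hu).tendsto_at x
  simpa only [emb_ofSchwartz hs] using this

theorem emb_eq_of_ae {n s : ℕ} (hs : n < 2 * s) {f : Sobolev n s} {F : E n → ℝ}
    (hF : Continuous F) (h : f.toL2 =ᵐ[volume] F) (x : E n) : emb f x = F x :=
  congrFun ((Continuous.ae_eq_iff_eq volume (map_continuous (emb f)) hF).1
    ((emb_ae hs f).symm.trans h)) x

theorem emb_lower {n s m : ℕ} (hs : n < 2 * s) (h : s ≤ m) (f : Sobolev n m) (x : E n) :
    emb (Sobolev.lower h f) x = emb f x :=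
  emb_eq_of_ae hs (map_continuous _) (emb_ae (by omega) f) x

theorem emb_mulB {n a b c : ℕ} (ha : c ≤ a) (hb : c ≤ b) (hc : n < 2 * c)
    (h : n + 2 * c < 2 * (a + b)) (f : Sobolev n a) (g : Sobolev n b) (x : E n) :
    emb (mulB ha hb h f g) x = emb f x * emb g x := by
  refine emb_eq_of_ae hc (F := fun x => emb f x * emb g x)
    ((map_continuous _).mul (map_continuous _)) ?_ x
  filter_upwards [coeFn_mulB ha hb h f g, emb_ae (by omega) f, emb_ae (by omega) g] with x h1 h2 h3
  rw [h1, h2, h3]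

/-- The differential at `x` of the continuous representative of `f ∈ H^{s+1}`. -/
def grad {n s : ℕ} (f : Sobolev n (s + 1)) (x : E n) : E n →L[ℝ] ℝ :=
  ∑ j, emb (Sobolev.D j f) x • (EuclideanSpace.proj j : E n →L[ℝ] ℝ)

theorem grad_apply {n s : ℕ} (f : Sobolev n (s + 1)) (x v : E n) :
    grad f x v = ∑ j, emb (Sobolev.D j f) x * v j := by
  simp [grad]

/-- The continuous representatives of Schwartz approximations converge uniformly together with their
differentials. -/
theorem hasFDerivAt_emb {n s : ℕ} (hs : n < 2 * s) (f : Sobolev n (s + 1)) (x : E n) :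
    HasFDerivAt (emb f) (grad f x) x := by
  obtain ⟨u, hu, -⟩ := exists_schwartz_seq f
  have h0 : ∀ m x, HasFDerivAt (emb (ofSchwartz (s + 1) (u m))) (grad (ofSchwartz (s + 1) (u m)) x)
      x := by
    intro m x
    have e : (⇑(emb (ofSchwartz (s + 1) (u m)))) = u m :=
      funext fun y => emb_ofSchwartz (by omega) _ _
    have e2 : grad (ofSchwartz (s + 1) (u m)) x = fderiv ℝ (u m) x := by
      ext v
      rw [grad_apply]
      conv_rhs => rw [← (EuclideanSpace.basisFun (Fin n) ℝ).sum_repr v, map_sum]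
      refine Finset.sum_congr rfl fun j _ => ?_
      rw [D_ofSchwartz, emb_ofSchwartz hs, SchwartzMap.lineDerivOp_apply_eq_fderiv]
      simp [basisVec, mul_comm]
    rw [e, e2]
    exact (u m).hasFDerivAt x
  refine hasFDerivAt_of_tendstoUniformly (l := atTop) ?_ h0
    (fun y => (tendstoUniformly_emb hu).tendsto_at y) x
  rw [Metric.tendstoUniformly_iff]
  intro ε hε
  have h1 : ∀ᶠ m in atTop, ∀ j, ‖emb (Sobolev.D j (f - ofSchwartz (s + 1) (u m)))‖
      < ε / (n + 1) := by
    rw [eventually_all]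
    intro j
    have : Tendsto (fun m => ‖emb (Sobolev.D j (f - ofSchwartz (s + 1) (u m)))‖) atTop (𝓝 0) := by
      have h0 : Tendsto (fun m => f - ofSchwartz (s + 1) (u m)) atTop (𝓝 0) := by
        simpa using (tendsto_const_nhds (x := f)).sub hu
      have h2 := ((emb.comp (Sobolev.D (n := n) (k := s) j)).continuous.norm.tendsto 0).comp h0
      rw [map_zero, norm_zero] at h2
      exact h2
    exact this.eventually_lt_const (by positivity)
  filter_upwards [h1] with m hm y
  rw [dist_eq_norm]
  have e : grad f y - grad (ofSchwartz (s + 1) (u m)) y =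
      grad (f - ofSchwartz (s + 1) (u m)) y := by
    ext v
    simp only [sub_apply, grad_apply, map_sub, ZeroAtInftyContinuousMap.sub_apply, sub_mul,
      Finset.sum_sub_distrib]
  rw [e, grad]
  calc _ ≤ ∑ j, ‖emb (Sobolev.D j (f - ofSchwartz (s + 1) (u m))) y •
        (EuclideanSpace.proj j : E n →L[ℝ] ℝ)‖ := norm_sum_le _ _
    _ ≤ ∑ j : Fin n, ε / (n + 1) := by
        refine Finset.sum_le_sum fun j _ => ?_
        rw [norm_smul]
        have h3 : ‖(EuclideanSpace.proj j : E n →L[ℝ] ℝ)‖ ≤ 1 :=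
          ContinuousLinearMap.opNorm_le_bound _ zero_le_one fun v => by
            simpa using PiLp.norm_apply_le v j
        have h4 : ‖emb (Sobolev.D j (f - ofSchwartz (s + 1) (u m))) y‖ ≤ ε / (n + 1) := by
          refine le_trans ?_ (hm j).le
          rw [← ZeroAtInftyContinuousMap.norm_toBCF_eq_norm]
          exact (emb (Sobolev.D j (f - ofSchwartz (s + 1) (u m)))).toBCF.norm_coe_le_norm y
        calc _ ≤ ε / (n + 1) * 1 := by gcongr
          _ = _ := mul_one _
    _ < ε := by
        rw [Finset.sum_const, Finset.card_univ, Fintype.card_fin, nsmul_eq_mul, ← mul_div_assoc,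
          div_lt_iff₀ (by positivity)]
        nlinarith

/-! ### The maps `id + w` -/

/-- The continuous vector field on `ℝⁿ` represented by a tuple of Sobolev functions. -/
def disp {n k : ℕ} (w : Fin n → Sobolev n k) (x : E n) : E n :=
  WithLp.toLp 2 fun i => emb (w i) x

/-- The map `id + w`. -/
def phi {n k : ℕ} (w : Fin n → Sobolev n k) (x : E n) : E n := x + disp w x

/-- The differential of the vector field `w`. -/
def ddisp {n σ : ℕ} (w : Fin n → Sobolev n (σ + 1)) (x : E n) : E n →L[ℝ] E n :=
  ∑ i, (grad (w i) x).smulRight (basisVec i)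

/-- The differential of `id + w`. -/
def dphi {n σ : ℕ} (w : Fin n → Sobolev n (σ + 1)) (x : E n) : E n →L[ℝ] E n := 1 + ddisp w x

/-- The pointwise inverse of the differential of `id + w`. -/
def dinv {n σ : ℕ} (w : Fin n → Sobolev n (σ + 1)) (x : E n) : E n →L[ℝ] E n :=
  Ring.inverse (dphi w x)

@[simp] theorem disp_apply {n k : ℕ} (w : Fin n → Sobolev n k) (x : E n) (i : Fin n) :
    disp w x i = emb (w i) x := rfl

theorem ddisp_apply {n σ : ℕ} (w : Fin n → Sobolev n (σ + 1)) (x v : E n) (i : Fin n) :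
    ddisp w x v i = grad (w i) x v := by
  simp [ddisp, Finset.sum_apply, Pi.single_apply]

theorem disp_add {n k : ℕ} (w h : Fin n → Sobolev n k) (x : E n) :
    disp (w + h) x = disp w x + disp h x := by
  ext i; simp

theorem disp_sub {n k : ℕ} (w h : Fin n → Sobolev n k) (x : E n) :
    disp (w - h) x = disp w x - disp h x := by
  ext i; simp

theorem grad_sub {n σ : ℕ} (f g : Sobolev n (σ + 1)) (x : E n) :
    grad (f - g) x = grad f x - grad g x := by
  ext v
  simp only [_root_.sub_apply, grad_apply, map_sub, ZeroAtInftyContinuousMap.sub_apply, sub_mul,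
    Finset.sum_sub_distrib]

theorem ddisp_sub {n σ : ℕ} (w h : Fin n → Sobolev n (σ + 1)) (x : E n) :
    ddisp (w - h) x = ddisp w x - ddisp h x := by
  ext v i
  rw [_root_.sub_apply, PiLp.sub_apply, ddisp_apply, ddisp_apply, ddisp_apply, Pi.sub_apply,
    grad_sub, _root_.sub_apply]

theorem continuous_disp {n k : ℕ} (w : Fin n → Sobolev n k) : Continuous (disp w) :=
  (PiLp.continuous_toLp 2 _).comp (continuous_pi fun i => map_continuous (emb (w i)))

theorem continuous_phi {n k : ℕ} (w : Fin n → Sobolev n k) : Continuous (phi w) :=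
  continuous_id.add (continuous_disp w)

theorem continuous_grad {n σ : ℕ} (f : Sobolev n (σ + 1)) : Continuous (grad f) :=
  continuous_finsetSum _ fun j _ =>
    (map_continuous (emb (Sobolev.D j f))).smul continuous_const

theorem continuous_ddisp {n σ : ℕ} (w : Fin n → Sobolev n (σ + 1)) : Continuous (ddisp w) :=
  continuous_finsetSum _ fun i _ =>
    ((ContinuousLinearMap.smulRightL ℝ (E n) (E n)).flip (basisVec i)).continuous.comp
      (continuous_grad (w i))

theorem continuous_dphi {n σ : ℕ} (w : Fin n → Sobolev n (σ + 1)) : Continuous (dphi w) :=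
  continuous_const.add (continuous_ddisp w)

theorem norm_grad_le {n σ : ℕ} (f : Sobolev n (σ + 1)) (x : E n) :
    ‖grad f x‖ ≤ ∑ j, |emb (Sobolev.D j f) x| := by
  refine (norm_sum_le _ _).trans (Finset.sum_le_sum fun j _ => ?_)
  rw [norm_smul, Real.norm_eq_abs]
  refine mul_le_of_le_one_right (abs_nonneg _) ?_
  exact ContinuousLinearMap.opNorm_le_bound _ zero_le_one fun v => by
    simpa using PiLp.norm_apply_le v j

theorem norm_ddisp_le_sum {n σ : ℕ} (w : Fin n → Sobolev n (σ + 1)) (x : E n) :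
    ‖ddisp w x‖ ≤ ∑ i, ∑ j, |emb (Sobolev.D j (w i)) x| := by
  refine (norm_sum_le _ _).trans (Finset.sum_le_sum fun i _ => ?_)
  rw [ContinuousLinearMap.norm_smulRight_apply]
  simpa using norm_grad_le (w i) x

theorem exists_norm_disp_le (n k : ℕ) : ∃ C : ℝ, 0 < C ∧ ∀ (w : Fin n → Sobolev n k) (x : E n),
    ‖disp w x‖ ≤ C * ‖w‖ := by
  refine ⟨n * ‖emb (n := n) (s := k)‖ + 1, by positivity, fun w x => ?_⟩
  have h1 : ‖disp w x‖ ≤ ∑ i, |emb (w i) x| := by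
    rw [EuclideanSpace.norm_eq]
    refine Real.sqrt_le_iff.2 ⟨by positivity, ?_⟩
    exact Finset.sum_sq_le_sq_sum_of_nonneg fun i _ => abs_nonneg (emb (w i) x)
  calc ‖disp w x‖ ≤ ∑ i : Fin n, ‖emb (n := n) (s := k)‖ * ‖w‖ := h1.trans
        (Finset.sum_le_sum fun i _ => (abs_emb_le _ _).trans (by gcongr; exact norm_le_pi_norm w i))
    _ = n * ‖emb (n := n) (s := k)‖ * ‖w‖ := by simp [mul_assoc]
    _ ≤ _ := by gcongr; linarith

theorem exists_norm_ddisp_le (n σ : ℕ) : ∃ C : ℝ, 0 < C ∧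
    ∀ (w : Fin n → Sobolev n (σ + 1)) (x : E n), ‖ddisp w x‖ ≤ C * ‖w‖ := by
  refine ⟨∑ i : Fin n, ∑ j : Fin n, ‖emb (n := n) (s := σ)‖ * ‖Sobolev.D (n := n) (k := σ) j‖ + 1,
    by positivity, fun w x => ?_⟩
  refine (norm_ddisp_le_sum w x).trans ?_
  calc _ ≤ ∑ i : Fin n, ∑ j : Fin n, ‖emb (n := n) (s := σ)‖ * ‖Sobolev.D (n := n) (k := σ) j‖
        * ‖w‖ := by
        refine Finset.sum_le_sum fun i _ => Finset.sum_le_sum fun j _ => ?_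
        refine (abs_emb_le _ _).trans ?_
        rw [mul_assoc]
        gcongr
        exact ((Sobolev.D j).le_opNorm _).trans (by gcongr; exact norm_le_pi_norm w i)
    _ = (∑ i : Fin n, ∑ j : Fin n, ‖emb (n := n) (s := σ)‖ * ‖Sobolev.D (n := n) (k := σ) j‖)
        * ‖w‖ := by simp only [Finset.sum_mul]
    _ ≤ _ := by gcongr; linarith

theorem tendsto_ddisp {n σ : ℕ} (w : Fin n → Sobolev n (σ + 1)) :
    Tendsto (ddisp w) (cocompact (E n)) (𝓝 0) := by
  refine squeeze_zero_norm (norm_ddisp_le_sum w) ?_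
  have h : ∀ i j, Tendsto (fun x => |emb (Sobolev.D j (w i)) x|) (cocompact (E n)) (𝓝 0) :=
    fun i j => by simpa using (zero_at_infty (emb (Sobolev.D j (w i)))).abs
  simpa using tendsto_finsetSum Finset.univ fun i _ => tendsto_finsetSum Finset.univ
    fun j _ => h i j

theorem hasFDerivAt_disp {n σ : ℕ} (hσ : n < 2 * σ) (w : Fin n → Sobolev n (σ + 1)) (x : E n) :
    HasFDerivAt (disp w) (ddisp w x) x := by
  rw [← hasFDerivWithinAt_univ, hasFDerivWithinAt_euclidean]
  intro i
  rw [hasFDerivWithinAt_univ]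
  have e : (EuclideanSpace.proj i : E n →L[ℝ] ℝ).comp (ddisp w x) = grad (w i) x := by
    ext v
    simp [ddisp_apply]
  exact e ▸ hasFDerivAt_emb hσ (w i) x

theorem hasFDerivAt_phi {n σ : ℕ} (hσ : n < 2 * σ) (w : Fin n → Sobolev n (σ + 1)) (x : E n) :
    HasFDerivAt (phi w) (dphi w x) x := (hasFDerivAt_id x).add (hasFDerivAt_disp hσ w x)

theorem contDiff_phi {n σ : ℕ} (hσ : n < 2 * σ) (w : Fin n → Sobolev n (σ + 1)) :
    ContDiff ℝ 1 (phi w) := by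
  rw [contDiff_one_iff_fderiv]
  refine ⟨fun x => (hasFDerivAt_phi hσ w x).differentiableAt, ?_⟩
  rw [show fderiv ℝ (phi w) = dphi w from funext fun x => (hasFDerivAt_phi hσ w x).fderiv]
  exact continuous_dphi w

/-! ### The domain of the chart -/

/-- The set of the `w` such that `id + w` is a diffeomorphism: the image of the chart. -/
def diffeoSet (n k : ℕ) : Set (Fin n → Sobolev n k) :=
  {w | ∃ e : E n ≃ E n, IsDiffeo e ∧ ∀ x, e x = phi w x}

open Classical in
/-- The inverse of the diffeomorphism `id + w` (the identity if `id + w` is not one). -/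
def psi {n k : ℕ} (w : Fin n → Sobolev n k) (x : E n) : E n :=
  if h : w ∈ diffeoSet n k then h.choose.symm x else x

theorem psi_spec {n k : ℕ} {w : Fin n → Sobolev n k} (hw : w ∈ diffeoSet n k) :
    ∃ e : E n ≃ E n, IsDiffeo e ∧ ⇑e = phi w ∧ ⇑e.symm = psi w := by
  refine ⟨hw.choose, hw.choose_spec.1, funext hw.choose_spec.2, funext fun x => ?_⟩
  rw [psi, dif_pos hw]

theorem phi_psi {n k : ℕ} {w : Fin n → Sobolev n k} (hw : w ∈ diffeoSet n k) (y : E n) :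
    phi w (psi w y) = y := by
  obtain ⟨e, -, h1, h2⟩ := psi_spec hw
  rw [← h1, ← h2, e.apply_symm_apply]

theorem psi_phi {n k : ℕ} {w : Fin n → Sobolev n k} (hw : w ∈ diffeoSet n k) (x : E n) :
    psi w (phi w x) = x := by
  obtain ⟨e, -, h1, h2⟩ := psi_spec hw
  rw [← h1, ← h2, e.symm_apply_apply]

theorem contDiff_psi {n k : ℕ} {w : Fin n → Sobolev n k} (hw : w ∈ diffeoSet n k) :
    ContDiff ℝ 1 (psi w) := by
  obtain ⟨e, he, h1, h2⟩ := psi_spec hw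
  rw [← h2]
  exact he.contDiff_symm

theorem continuous_psi {n k : ℕ} {w : Fin n → Sobolev n k} (hw : w ∈ diffeoSet n k) :
    Continuous (psi w) := (contDiff_psi hw).continuous

theorem det_dphi_pos {n σ : ℕ} (hσ : n < 2 * σ) {w : Fin n → Sobolev n (σ + 1)}
    (hw : w ∈ diffeoSet n (σ + 1)) (x : E n) :
    0 < (dphi w x).det := by
  obtain ⟨e, he, h1, h2⟩ := psi_spec hw
  have := he.det_pos x
  rwa [h1, (hasFDerivAt_phi hσ w x).fderiv] at this

theorem fderiv_psi_mul_dphi {n σ : ℕ} (hσ : n < 2 * σ) {w : Fin n → Sobolev n (σ + 1)}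
    (hw : w ∈ diffeoSet n (σ + 1)) (x : E n) : fderiv ℝ (psi w) (phi w x) * dphi w x = 1 := by
  have h1 := ((contDiff_psi hw).differentiable (by norm_num) (phi w x)).hasFDerivAt.comp x
    (hasFDerivAt_phi hσ w x)
  have h2 : psi w ∘ phi w = id := funext (psi_phi hw)
  rw [h2] at h1
  exact h1.unique (hasFDerivAt_id x)

theorem isUnit_dphi {n σ : ℕ} (hσ : n < 2 * σ) {w : Fin n → Sobolev n (σ + 1)}
    (hw : w ∈ diffeoSet n (σ + 1)) (x : E n) :
    IsUnit (dphi w x) := by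
  have h1 := fderiv_psi_mul_dphi hσ hw x
  have h2 : dphi w x * fderiv ℝ (psi w) (phi w x) = 1 := by
    have h3 := (hasFDerivAt_phi hσ w (psi w (phi w x))).comp (phi w x)
      ((contDiff_psi hw).differentiable (by norm_num) (phi w x)).hasFDerivAt
    have h4 : phi w ∘ psi w = id := funext (phi_psi hw)
    rw [h4, psi_phi hw] at h3
    exact h3.unique (hasFDerivAt_id _)
  exact ⟨⟨_, _, h2, h1⟩, rfl⟩

theorem dinv_mul_dphi {n σ : ℕ} (hσ : n < 2 * σ) {w : Fin n → Sobolev n (σ + 1)}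
    (hw : w ∈ diffeoSet n (σ + 1)) (x : E n) :
    dinv w x * dphi w x = 1 := Ring.inverse_mul_cancel _ (isUnit_dphi hσ hw x)

theorem dphi_mul_dinv {n σ : ℕ} (hσ : n < 2 * σ) {w : Fin n → Sobolev n (σ + 1)}
    (hw : w ∈ diffeoSet n (σ + 1)) (x : E n) :
    dphi w x * dinv w x = 1 := Ring.mul_inverse_cancel _ (isUnit_dphi hσ hw x)

theorem hasFDerivAt_psi {n σ : ℕ} (hσ : n < 2 * σ) {w : Fin n → Sobolev n (σ + 1)}
    (hw : w ∈ diffeoSet n (σ + 1)) (y : E n) :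
    HasFDerivAt (psi w) (dinv w (psi w y)) y := by
  have h := ((contDiff_psi hw).differentiable (by norm_num) y).hasFDerivAt
  have h1 := fderiv_psi_mul_dphi hσ hw (psi w y)
  rw [phi_psi hw] at h1
  have h2 : fderiv ℝ (psi w) y = dinv w (psi w y) :=
    left_inv_eq_right_inv h1 (dphi_mul_dinv hσ hw _)
  rwa [h2] at h

theorem continuous_dinv {n σ : ℕ} (hσ : n < 2 * σ) {w : Fin n → Sobolev n (σ + 1)}
    (hw : w ∈ diffeoSet n (σ + 1)) :
    Continuous (dinv w) := by
  rw [continuous_iff_continuousAt]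
  intro x
  obtain ⟨u, hu⟩ := isUnit_dphi hσ hw x
  refine ContinuousAt.comp (g := Ring.inverse) ?_ (continuous_dphi w).continuousAt
  rw [← hu]
  exact NormedRing.inverse_continuousAt u

/-- The inverse of the differential is bounded, because the differential tends to `1` at
infinity. -/
theorem exists_norm_dinv_le {n σ : ℕ} (hσ : n < 2 * σ) {w : Fin n → Sobolev n (σ + 1)}
    (hw : w ∈ diffeoSet n (σ + 1)) :
    ∃ C : ℝ, 0 < C ∧ ∀ x, ‖dinv w x‖ ≤ C := by
  have h1 : Tendsto (dphi w) (cocompact (E n)) (𝓝 1) := by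
    have := (tendsto_const_nhds (x := (1 : E n →L[ℝ] E n))).add (tendsto_ddisp w)
    rwa [add_zero] at this
  have h2 : Tendsto (fun x => ‖dinv w x‖) (cocompact (E n)) (𝓝 ‖(1 : E n →L[ℝ] E n)‖) := by
    have := (NormedRing.inverse_continuousAt (1 : (E n →L[ℝ] E n)ˣ)).tendsto
    simp only [Units.val_one, Ring.inverse_one] at this
    exact (this.comp h1).norm
  have h3 := h2.eventually_lt_const (lt_add_one _)
  obtain ⟨K, hK, hK'⟩ := mem_cocompact.1 h3
  obtain ⟨C, hC⟩ := hK.exists_bound_of_continuousOn (continuous_dinv hσ hw).continuousOn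
  refine ⟨max C (‖(1 : E n →L[ℝ] E n)‖ + 1), by positivity, fun x => ?_⟩
  by_cases hx : x ∈ K
  · exact (hC x hx).trans (le_max_left _ _)
  · exact (le_of_lt (hK' hx)).trans (le_max_right _ _)

theorem exists_lipschitzWith_psi {n σ : ℕ} (hσ : n < 2 * σ) {w : Fin n → Sobolev n (σ + 1)}
    (hw : w ∈ diffeoSet n (σ + 1)) :
    ∃ C : ℝ, 0 < C ∧ ∀ x y, ‖psi w x - psi w y‖ ≤ C * ‖x - y‖ := by
  obtain ⟨C, hC0, hC⟩ := exists_norm_dinv_le hσ hw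
  refine ⟨C, hC0, fun x y => ?_⟩
  exact convex_univ.norm_image_sub_le_of_norm_hasFDerivWithin_le (s := Set.univ)
    (fun z _ => (hasFDerivAt_psi hσ hw z).hasFDerivWithinAt) (fun z _ => hC _)
    (Set.mem_univ _) (Set.mem_univ _)

theorem isUnit_one_add_of_norm_lt {n : ℕ} {K : E n →L[ℝ] E n} (hK : ‖K‖ < 1) :
    IsUnit (1 + K) := by
  have := (Units.oneSub (-K) (by rwa [norm_neg])).isUnit
  simpa using this

theorem det_mul {n : ℕ} (A B : E n →L[ℝ] E n) : (A * B).det = A.det * B.det :=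
  LinearMap.det_comp (A : E n →ₗ[ℝ] E n) (B : E n →ₗ[ℝ] E n)

/-- The determinant stays positive along the segment from `1` to `1 + K`, which consists of
invertible maps. -/
theorem det_one_add_pos {n : ℕ} {K : E n →L[ℝ] E n} (hK : ‖K‖ < 1) : 0 < (1 + K).det := by
  have hne : ∀ t ∈ Set.Icc (0 : ℝ) 1, (1 + t • K).det ≠ 0 := by
    intro t ht
    have h1 : ‖t • K‖ < 1 := by
      rw [norm_smul, Real.norm_eq_abs, abs_of_nonneg ht.1]
      exact (mul_le_of_le_one_left (norm_nonneg _) ht.2).trans_lt hK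
    obtain ⟨u, hu⟩ := isUnit_one_add_of_norm_lt h1
    have h2 : (1 + t • K).det * (↑u⁻¹ : E n →L[ℝ] E n).det = 1 := by
      rw [← hu, ← det_mul, u.mul_inv]
      exact LinearMap.det_id
    exact left_ne_zero_of_mul_eq_one h2
  have hc : ContinuousOn (fun t : ℝ => (1 + t • K).det) (Set.Icc 0 1) :=
    (ContinuousLinearMap.continuous_det.comp
      (continuous_const.add (continuous_id.smul continuous_const))).continuousOn
  have h0 : (1 + (0 : ℝ) • K).det = 1 := by
    have e : 1 + (0 : ℝ) • K = 1 := (congrArg (1 + ·) (zero_smul ℝ K)).trans (add_zero _)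
    rw [e]
    exact LinearMap.det_id
  by_contra h
  rw [not_lt] at h
  have h3 : (0 : ℝ) ∈ (fun t : ℝ => (1 + t • K).det) '' Set.Icc 0 1 :=
    intermediate_value_Icc' zero_le_one hc ⟨by simpa using h, by simp only [h0]; exact zero_le_one⟩
  obtain ⟨t, ht, ht'⟩ := h3
  exact hne t ht ht'

/-- Diffeomorphisms are stable under small perturbations in `H^{σ+1}`, because these are small in
`C¹`. -/
theorem isOpen_diffeoSet {n σ : ℕ} (hσ : n < 2 * σ) : IsOpen (diffeoSet n (σ + 1)) := by
  rw [Metric.isOpen_iff]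
  intro w hw
  obtain ⟨C, hC0, hC⟩ := exists_norm_dinv_le hσ hw
  obtain ⟨C', hC0', hC'⟩ := exists_norm_ddisp_le n σ
  refine ⟨1 / (2 * (C' * C)), by positivity, fun v hv => ?_⟩
  set h := v - w with hh
  have hvh : ‖h‖ < 1 / (2 * (C' * C)) := by rwa [mem_ball_iff_norm] at hv
  have hv' : v = w + h := by rw [hh]; abel
  have hK : ∀ x, ‖ddisp h x * dinv w x‖ ≤ 1 / 2 := fun x => by
    calc _ ≤ ‖ddisp h x‖ * ‖dinv w x‖ := norm_mul_le _ _
      _ ≤ (C' * (1 / (2 * (C' * C)))) * C := by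
        gcongr
        · exact (hC' h x).trans (by gcongr)
        · exact hC x
      _ = 1 / 2 := by field_simp
  obtain ⟨e, he, h1, h2⟩ := psi_spec hw
  -- `(id + v) ∘ (id + w)⁻¹ = id + h ∘ (id + w)⁻¹` is a perturbation of the identity.
  set F : E n → E n := fun y => y + disp h (psi w y) with hF
  have hF1 : ∀ x, F (phi w x) = phi v x := fun x => by
    rw [hv', hF]
    dsimp only
    rw [psi_phi hw, phi, phi, disp_add, add_assoc]
  have hg : ∀ y, HasFDerivAt (fun y => disp h (psi w y))
      (ddisp h (psi w y) * dinv w (psi w y)) y := fun y =>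
    (hasFDerivAt_disp hσ h (psi w y)).comp y (hasFDerivAt_psi hσ hw y)
  have happ : ApproximatesLinearOn F (ContinuousLinearEquiv.refl ℝ (E n) : E n →L[ℝ] E n)
      Set.univ (1 / 2) := by
    rw [ApproximatesLinearOn.approximatesLinearOn_iff_lipschitzOnWith]
    have e1 : F - ⇑(ContinuousLinearEquiv.refl ℝ (E n) : E n →L[ℝ] E n)
        = fun y => disp h (psi w y) := by
      funext y; simp [hF]
    rw [e1]
    exact convex_univ.lipschitzOnWith_of_nnnorm_hasFDerivWithin_le
      (fun y _ => (hg y).hasFDerivWithinAt) fun y _ => by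
        rw [← NNReal.coe_le_coe]; simpa using hK (psi w y)
  have hN : Subsingleton (E n) ∨ (1 / 2 : ℝ≥0) <
      ‖((ContinuousLinearEquiv.refl ℝ (E n)).symm : E n →L[ℝ] E n)‖₊⁻¹ := by
    rcases subsingleton_or_nontrivial (E n) with hs | hs
    · exact Or.inl hs
    · refine Or.inr ?_
      have : ‖((ContinuousLinearEquiv.refl ℝ (E n)).symm : E n →L[ℝ] E n)‖₊ = 1 :=
        NNReal.eq (ContinuousLinearMap.norm_id (𝕜 := ℝ) (E := E n))
      rw [this, inv_one]
      exact NNReal.half_lt_self one_ne_zero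
  let eF : E n ≃ₜ E n := happ.toHomeomorph F hN
  have heF : ⇑eF = F := rfl
  let e0 : E n ≃ₜ E n := ⟨e, he.contDiff.continuous, he.contDiff_symm.continuous⟩
  let ev : E n ≃ₜ E n := e0.trans eF
  have hev : ⇑ev = phi v := funext fun x => by
    change F (e x) = _
    rw [h1, hF1]
  have hd : ∀ x, dphi v x = (1 + ddisp h x * dinv w x) * dphi w x := fun x => by
    rw [add_mul, one_mul, mul_assoc, dinv_mul_dphi hσ hw, mul_one, hh, ddisp_sub, dphi, dphi]
    abel
  have hu : ∀ x, IsUnit (dphi v x) := fun x => by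
    rw [hd]
    exact (isUnit_one_add_of_norm_lt ((hK x).trans_lt (by norm_num))).mul (isUnit_dphi hσ hw x)
  have hdet : ∀ x, 0 < (dphi v x).det := fun x => by
    have := mul_pos (det_one_add_pos ((hK x).trans_lt (by norm_num))) (det_dphi_pos hσ hw x)
    rwa [hd, det_mul]
  refine ⟨ev.toEquiv, ⟨?_, ?_, ?_⟩, fun x => congrFun hev x⟩
  · exact hev ▸ contDiff_phi hσ v
  · refine ev.contDiff_symm (f₀' := fun x => ContinuousLinearEquiv.ofUnit (hu x).unit)
      (fun x => ?_) (hev ▸ contDiff_phi hσ v)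
    rw [hev]
    exact hasFDerivAt_phi hσ v x
  · intro x
    have : fderiv ℝ ev.toEquiv x = dphi v x := by
      change fderiv ℝ ev x = _
      rw [hev]
      exact (hasFDerivAt_phi hσ v x).fderiv
    rw [this]
    exact hdet x

/-! ### Dependence of the inverse on the vector field -/

/-- For `A = (1 + dw)⁻¹` and `B = (1 + dv)⁻¹` one has `B - A = -B (dv - dw) A`; for `v` close to
`w`, the part of the right-hand side that contains `B - A` is absorbed in the left-hand side. -/
theorem exists_norm_dinv_sub_le {n σ : ℕ} (hσ : n < 2 * σ) {w : Fin n → Sobolev n (σ + 1)}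
    (hw : w ∈ diffeoSet n (σ + 1)) : ∃ C : ℝ, 0 < C ∧ ∀ᶠ v in 𝓝 w, v ∈ diffeoSet n (σ + 1) ∧
      ∀ x, ‖dinv v x - dinv w x‖ ≤ C * ‖v - w‖ := by
  obtain ⟨C, hC0, hC⟩ := exists_norm_dinv_le hσ hw
  obtain ⟨C', hC0', hC'⟩ := exists_norm_ddisp_le n σ
  refine ⟨2 * (C * (C' * C)), by positivity, ?_⟩
  filter_upwards [(isOpen_diffeoSet hσ).mem_nhds hw,
    Metric.ball_mem_nhds w (ε := 1 / (2 * (C' * C))) (by positivity)] with v hv hvw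
  refine ⟨hv, fun x => ?_⟩
  rw [mem_ball_iff_norm, lt_div_iff₀ (by positivity)] at hvw
  have e : dinv v x - dinv w x = -(dinv v x * (ddisp (v - w) x * dinv w x)) := by
    have h1 : ddisp (v - w) x = dphi v x - dphi w x := by
      rw [ddisp_sub, dphi, dphi]; abel
    rw [h1, sub_mul, mul_sub, dphi_mul_dinv hσ hw, mul_one, ← mul_assoc, dinv_mul_dphi hσ hv,
      one_mul, neg_sub]
  have h2 : ‖dinv v x - dinv w x‖ ≤ (C + ‖dinv v x - dinv w x‖) * (C' * ‖v - w‖ * C) := by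
    have h3 : ‖dinv v x‖ ≤ C + ‖dinv v x - dinv w x‖ := by
      have := norm_add_le (dinv w x) (dinv v x - dinv w x)
      rw [add_sub_cancel] at this
      linarith [hC x]
    calc ‖dinv v x - dinv w x‖ ≤ ‖dinv v x‖ * (‖ddisp (v - w) x‖ * ‖dinv w x‖) := by
          conv_lhs => rw [e, norm_neg]
          exact (norm_mul_le _ _).trans (by gcongr; exact norm_mul_le _ _)
      _ ≤ _ := by
          gcongr
          · exact hC' _ _
          · exact hC x
  nlinarith [norm_nonneg (dinv v x - dinv w x), norm_nonneg (v - w)]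

/-- The inverses depend on the vector field in a Lipschitz manner, uniformly on `ℝⁿ`. -/
theorem exists_norm_psi_sub_le {n σ : ℕ} (hσ : n < 2 * σ) {w : Fin n → Sobolev n (σ + 1)}
    (hw : w ∈ diffeoSet n (σ + 1)) : ∃ C : ℝ, 0 < C ∧ ∀ v ∈ diffeoSet n (σ + 1),
      ∀ y, ‖psi v y - psi w y‖ ≤ C * ‖v - w‖ := by
  obtain ⟨C, hC0, hC⟩ := exists_lipschitzWith_psi hσ hw
  obtain ⟨C', hC0', hC'⟩ := exists_norm_disp_le n (σ + 1)
  refine ⟨C * C', by positivity, fun v hv y => ?_⟩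
  have h1 : psi v y - psi w y = psi w (phi w (psi v y)) - psi w (phi v (psi v y)) := by
    rw [psi_phi hw, phi_psi hv]
  have h2 : phi w (psi v y) - phi v (psi v y) = -disp (v - w) (psi v y) := by
    rw [disp_sub, phi, phi]; abel
  rw [h1]
  refine (hC _ _).trans ?_
  rw [h2, norm_neg, mul_assoc]
  gcongr
  exact hC' _ _

/-! ### Functions with a Sobolev representative -/

/-- The function `F` is almost everywhere equal to an element of `H^k`. -/
def IsSob {n : ℕ} (k : ℕ) (F : E n → ℝ) : Prop := ∃ u : Sobolev n k, u.toL2 =ᵐ[volume] F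

open Classical in
/-- The element of `H^k` that agrees almost everywhere with `F` (zero if there is none). -/
def ofFun {n : ℕ} (k : ℕ) (F : E n → ℝ) : Sobolev n k :=
  if h : ∃ u : Sobolev n k, u.toL2 =ᵐ[volume] F then h.choose else 0

theorem Sobolev.ext_ae {n k : ℕ} {u v : Sobolev n k} {F : E n → ℝ} (hu : u.toL2 =ᵐ[volume] F)
    (hv : v.toL2 =ᵐ[volume] F) : u = v := Sobolev.ext_toL2 (Lp.ext (hu.trans hv.symm))

theorem IsSob.coeFn {n k : ℕ} {F : E n → ℝ} (h : IsSob k F) :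
    (ofFun k F).toL2 =ᵐ[volume] F := by
  have h' : ∃ u : Sobolev n k, u.toL2 =ᵐ[volume] F := h
  rw [ofFun, dif_pos h']
  exact h'.choose_spec

theorem isSob_zero {n : ℕ} {F : E n → ℝ} (h : MemLp F 2 volume) : IsSob 0 F :=
  ⟨Sobolev.ofL2 h.toLp, h.coeFn_toLp⟩

theorem ofFun_toL2 {n k m : ℕ} {F : E n → ℝ} (h : IsSob k F) (h' : IsSob m F) :
    (ofFun k F).toL2 = (ofFun m F).toL2 := Lp.ext (h.coeFn.trans h'.coeFn.symm)

theorem norm_le_of_ae_le_add {n : ℕ} {f g h : L2 n} {a b : ℝ} (ha : 0 ≤ a) (hb : 0 ≤ b)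
    (H : ∀ᵐ x, |f x| ≤ a * |g x| + b * |h x|) : ‖f‖ ≤ a * ‖g‖ + b * ‖h‖ := by
  have h1 : ‖f‖ ≤ ‖a • |g| + b • |h|‖ := by
    refine Lp.norm_le_norm_of_ae_le ?_
    filter_upwards [H, Lp.coeFn_add (a • |g|) (b • |h|), Lp.coeFn_smul a |g|, Lp.coeFn_smul b |h|,
      Lp.coeFn_abs g, Lp.coeFn_abs h] with x h1 h2 h3 h4 h5 h6
    rw [h2, Pi.add_apply, h3, h4, Pi.smul_apply, Pi.smul_apply, h5, h6, Real.norm_eq_abs,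
      Real.norm_eq_abs, smul_eq_mul, smul_eq_mul]
    exact h1.trans (le_abs_self _)
  refine h1.trans ((norm_add_le _ _).trans ?_)
  rw [norm_smul, norm_smul, norm_abs_eq_norm, norm_abs_eq_norm, Real.norm_eq_abs,
    Real.norm_eq_abs, abs_of_nonneg ha, abs_of_nonneg hb]

/-- A family of functions depends continuously on a parameter as a map into `H^{k+1}` as soon as it
does so in `L²` and its weak derivatives do in `H^k`. -/
theorem isSob_succ {n k : ℕ} {X : Type*} [TopologicalSpace X] {S : Set X} {F : X → E n → ℝ}
    (h0 : ∀ p ∈ S, IsSob 0 (F p)) (hc : ContinuousOn (fun p => ofFun 0 (F p)) S)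
    {G : Fin n → X → Sobolev n k}
    (hG : ∀ p ∈ S, ∀ i, IsPartial i (ofFun 0 (F p)).toL2 (G i p).toL2)
    (hGc : ∀ i, ContinuousOn (G i) S) :
    (∀ p ∈ S, IsSob (k + 1) (F p)) ∧ ContinuousOn (fun p => ofFun (k + 1) (F p)) S := by
  have h1 : ∀ p ∈ S, IsSob (k + 1) (F p) := fun p hp =>
    ⟨Sobolev.mk (ofFun 0 (F p)).toL2 (Sobolev.mem_succ fun i => ⟨_, hG p hp i⟩), (h0 p hp).coeFn⟩
  have h2 : ∀ p ∈ S, (ofFun (k + 1) (F p)).toL2 = (ofFun 0 (F p)).toL2 := fun p hp =>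
    ofFun_toL2 (h1 p hp) (h0 p hp)
  have h3 : ∀ p ∈ S, ∀ i, Sobolev.D i (ofFun (k + 1) (F p)) = G i p := fun p hp i =>
    Sobolev.D_eq (by rw [h2 p hp]; exact hG p hp i)
  refine ⟨h1, fun p hp => ?_⟩
  refine Sobolev.tendsto_succ_iff.2 ⟨?_, fun i => ?_⟩
  · rw [h2 p hp]
    refine (Sobolev.tendsto_zero_iff.1 (hc p hp)).congr' ?_
    filter_upwards [self_mem_nhdsWithin] with q hq using (h2 q hq).symm
  · rw [h3 p hp i]
    refine Tendsto.congr' ?_ (hGc i p hp)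
    filter_upwards [self_mem_nhdsWithin] with q hq using (h3 q hq i).symm

/-! ### Multiplication by the entries of the inverse differential -/

/-- The entries of the matrix `(d(id + w))⁻¹`. -/
def entry {n σ : ℕ} (j l : Fin n) (w : Fin n → Sobolev n (σ + 1)) (x : E n) : ℝ :=
  dinv w x (basisVec l) j

/-- Multiplication of `g` by an entry of `(d(id + w))⁻¹`. -/
def mulEntry {n σ k : ℕ} (j l : Fin n) (g : Sobolev n k) (w : Fin n → Sobolev n (σ + 1)) :
    Sobolev n k := ofFun k fun x => entry j l w x * g.toL2 x

theorem abs_entry_le {n : ℕ} (A : E n →L[ℝ] E n) (j l : Fin n) : |A (basisVec l) j| ≤ ‖A‖ := by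
  have h1 := PiLp.norm_apply_le (A (basisVec l)) j
  have h2 := A.le_opNorm (basisVec l)
  rw [PiLp.norm_single, norm_one, mul_one] at h2
  exact h1.trans h2

theorem continuous_entry {n σ : ℕ} (hσ : n < 2 * σ) {w : Fin n → Sobolev n (σ + 1)}
    (hw : w ∈ diffeoSet n (σ + 1)) (j l : Fin n) : Continuous (entry j l w) :=
  (EuclideanSpace.proj j : E n →L[ℝ] ℝ).continuous.comp
    ((continuous_dinv hσ hw).clm_apply continuous_const)

theorem isSob_entry_mul_zero {n σ : ℕ} (hσ : n < 2 * σ) {w : Fin n → Sobolev n (σ + 1)}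
    (hw : w ∈ diffeoSet n (σ + 1)) (j l : Fin n) (g : L2 n) :
    IsSob 0 fun x => entry j l w x * g x := by
  obtain ⟨C, hC0, hC⟩ := exists_norm_dinv_le hσ hw
  refine isSob_zero ((Lp.memLp g).of_le_mul (c := C)
    ((continuous_entry hσ hw j l).aestronglyMeasurable.mul (Lp.aestronglyMeasurable g))
    (ae_of_all _ fun x => ?_))
  rw [norm_mul]
  gcongr
  exact (abs_entry_le _ j l).trans (hC x)

theorem continuousOn_entry_mul_zero {n σ : ℕ} (hσ : n < 2 * σ) (j l : Fin n) :
    ContinuousOn (fun p : L2 n × (Fin n → Sobolev n (σ + 1)) =>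
      ofFun 0 fun x => entry j l p.2 x * p.1 x) (Prod.snd ⁻¹' diffeoSet n (σ + 1)) := by
  rintro ⟨g, w⟩ (hw : w ∈ diffeoSet n (σ + 1))
  refine ContinuousAt.continuousWithinAt (Sobolev.tendsto_zero_iff.2 ?_)
  rw [tendsto_iff_norm_sub_tendsto_zero]
  obtain ⟨C, hC0, hC⟩ := exists_norm_dinv_le hσ hw
  obtain ⟨C', hC0', hC'⟩ := exists_norm_dinv_sub_le hσ hw
  have h1 : Tendsto (fun p : L2 n × (Fin n → Sobolev n (σ + 1)) =>
      (C + C' * ‖p.2 - w‖) * ‖p.1 - g‖ + C' * ‖p.2 - w‖ * ‖g‖) (𝓝 (g, w)) (𝓝 0) := by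
    have : Continuous (fun p : L2 n × (Fin n → Sobolev n (σ + 1)) =>
      (C + C' * ‖p.2 - w‖) * ‖p.1 - g‖ + C' * ‖p.2 - w‖ * ‖g‖) := by fun_prop
    simpa using this.tendsto (g, w)
  refine squeeze_zero' (Eventually.of_forall fun _ => norm_nonneg _) ?_ h1
  filter_upwards [(continuous_snd.tendsto (g, w)).eventually hC'] with ⟨f, v⟩ ⟨hv, hvC⟩
  refine norm_le_of_ae_le_add (by positivity) (by positivity) ?_
  filter_upwards [Lp.coeFn_sub (ofFun 0 fun x => entry j l v x * f x).toL2
      (ofFun 0 fun x => entry j l w x * g x).toL2, (isSob_entry_mul_zero hσ hv j l f).coeFn,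
    (isSob_entry_mul_zero hσ hw j l g).coeFn, Lp.coeFn_sub f g] with x h1 h2 h3 h4
  rw [h1, Pi.sub_apply, h2, h3, h4, Pi.sub_apply]
  have e : entry j l v x * f x - entry j l w x * g x
      = entry j l v x * (f x - g x) + (entry j l v x - entry j l w x) * g x := by ring
  have h5 : |entry j l v x - entry j l w x| ≤ C' * ‖v - w‖ :=
    (abs_entry_le (dinv v x - dinv w x) j l).trans (hvC x)
  have h6 : |entry j l v x| ≤ C + C' * ‖v - w‖ := by
    have := abs_add_le (entry j l w x) (entry j l v x - entry j l w x)
    rw [add_sub_cancel] at this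
    have h7 : |entry j l w x| ≤ C := (abs_entry_le _ j l).trans (hC x)
    linarith
  rw [e]
  refine (abs_add_le _ _).trans ?_
  rw [abs_mul, abs_mul]
  gcongr

/-- A sequence of tuples of Schwartz functions approximating `w`. -/
theorem exists_schwartz_tuple {n k : ℕ} (w : Fin n → Sobolev n k) :
    ∃ u : ℕ → Fin n → 𝓢(E n, ℝ), Tendsto (fun m i => ofSchwartz k (u m i)) atTop (𝓝 w) := by
  choose u hu _ using fun i => exists_schwartz_seq (w i)
  exact ⟨fun m i => u i m, tendsto_pi_nhds.2 hu⟩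

theorem hasDerivAt_ringInverse {R : Type*} [NormedRing R] [HasSummableGeomSeries R]
    [NormedAlgebra ℝ R] {m : ℝ → R} {m' : R} {t : ℝ} (hm : HasDerivAt m m' t)
    (hu : IsUnit (m t)) : HasDerivAt (fun s => Ring.inverse (m s))
      (-(Ring.inverse (m t) * m' * Ring.inverse (m t))) t := by
  obtain ⟨U, hU⟩ := hu
  have h := hasFDerivAt_ringInverse (𝕜 := ℝ) U
  rw [hU] at h
  have h2 := h.comp_hasDerivAt t hm
  rw [← hU, Ring.inverse_unit]
  exact h2

/-- The formula `∂ᵢ A = -A (∂ᵢ dw) A` for `A = (1 + dw)⁻¹`, in coordinates. -/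
theorem hasLineDerivAt_dinv_schwartz {n σ : ℕ} (hσ : n < 2 * σ) {u : Fin n → 𝓢(E n, ℝ)}
    (hu : (fun i => ofSchwartz (σ + 1) (u i)) ∈ diffeoSet n (σ + 1)) (i j l : Fin n) (x : E n) :
    HasLineDerivAt ℝ (entry j l fun i => ofSchwartz (σ + 1) (u i))
      (-∑ p, ∑ q, entry j p (fun i => ofSchwartz (σ + 1) (u i)) x *
        (entry q l (fun i => ofSchwartz (σ + 1) (u i)) x *
          (∂_{basisVec i} (∂_{basisVec q} (u p)) : 𝓢(E n, ℝ)) x)) x (basisVec i) := by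
  set w := fun i => ofSchwartz (σ + 1) (u i) with hw
  have h1 : HasDerivAt (fun t : ℝ => dphi w (x + t • basisVec i))
      (∑ p, ∑ q, (∂_{basisVec i} (∂_{basisVec q} (u p)) : 𝓢(E n, ℝ)) x •
        (EuclideanSpace.proj q : E n →L[ℝ] ℝ).smulRight (basisVec p)) 0 := by
    have e : (fun t : ℝ => dphi w (x + t • basisVec i)) = fun t : ℝ =>
        1 + ∑ p, ∑ q, (∂_{basisVec q} (u p) : 𝓢(E n, ℝ)) (x + t • basisVec i) •
        (EuclideanSpace.proj q : E n →L[ℝ] ℝ).smulRight (basisVec p) := by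
      funext t
      rw [dphi, ddisp]
      congr 1
      refine Finset.sum_congr rfl fun p _ => ?_
      ext v r
      simp [grad_apply, hw, D_ofSchwartz, emb_ofSchwartz hσ,
        Pi.single_apply]
    rw [e]
    refine HasDerivAt.const_add _ (HasDerivAt.fun_sum fun p _ => HasDerivAt.fun_sum fun q _ => ?_)
    have h : HasDerivAt (fun t : ℝ => (∂_{basisVec q} (u p) : 𝓢(E n, ℝ)) (x + t • basisVec i))
        ((∂_{basisVec i} (∂_{basisVec q} (u p)) : 𝓢(E n, ℝ)) x) 0 := by
      rw [SchwartzMap.lineDerivOp_apply_eq_fderiv]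
      exact ((∂_{basisVec q} (u p) : 𝓢(E n, ℝ)).hasFDerivAt x).hasLineDerivAt (basisVec i)
    exact HasDerivAt.smul_const (F := E n →L[ℝ] E n) h _
  have h2 : IsUnit (dphi w (x + (0 : ℝ) • basisVec i)) := isUnit_dphi hσ hu _
  have hx : x + (0 : ℝ) • basisVec i = x := by simp
  have h3 := hasDerivAt_ringInverse h1 h2
  rw [hx] at h3
  have h4 := ((EuclideanSpace.proj j : E n →L[ℝ] ℝ).comp
    (ContinuousLinearMap.apply ℝ (E n) (basisVec l))).hasFDerivAt.comp_hasDerivAt (0 : ℝ) h3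
  refine HasDerivAt.congr_deriv h4 ?_
  simp only [ContinuousLinearMap.comp_apply, ContinuousLinearMap.apply_apply,
    map_neg, Finset.mul_sum, Finset.sum_mul, map_sum]
  congr 1
  refine Finset.sum_congr rfl fun p _ => Finset.sum_congr rfl fun q _ => ?_
  simp only [ContinuousLinearMap.mul_def, ContinuousLinearMap.comp_apply, _root_.smul_apply,
    ContinuousLinearMap.smulRight_apply, map_smul, smul_eq_mul]
  simp only [entry, dinv, PiLp.proj_apply]
  ring

theorem coeFn_sum {n : ℕ} {ι : Type*} (s : Finset ι) (f : ι → L2 n) :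
    (∑ a ∈ s, f a : L2 n) =ᵐ[volume] fun x => ∑ a ∈ s, f a x := by
  classical
  induction s using Finset.induction_on with
  | empty =>
    filter_upwards [Lp.coeFn_zero ℝ 2 (volume : Measure (E n))] with x hx
    rw [Finset.sum_empty, Finset.sum_empty, hx, Pi.zero_apply]
  | insert a s ha ih =>
    rw [Finset.sum_insert ha]
    filter_upwards [Lp.coeFn_add (f a) (∑ a ∈ s, f a), ih] with x h1 h2
    rw [h1, Pi.add_apply, h2, Finset.sum_insert ha]

theorem coeFn_sum_sum {n : ℕ} (f : Fin n → Fin n → L2 n) :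
    (∑ a, ∑ b, f a b : L2 n) =ᵐ[volume] fun x => ∑ a, ∑ b, f a b x := by
  have h : ∀ᵐ x, ∀ a, (∑ b, f a b : L2 n) x = ∑ b, f a b x :=
    ae_all_iff.2 fun a => coeFn_sum _ _
  filter_upwards [coeFn_sum Finset.univ fun a => ∑ b, f a b, h] with x h1 h2
  rw [h1]
  simp only [h2]

theorem coeFn_ofSchwartz {n : ℕ} (k : ℕ) (u : 𝓢(E n, ℝ)) :
    (ofSchwartz k u).toL2 =ᵐ[volume] u := u.coeFn_toLp 2 volume

theorem isPartial_entry_mul_schwartz {n σ : ℕ} (hσ : n < 2 * σ) {u : Fin n → 𝓢(E n, ℝ)}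
    {w : Fin n → Sobolev n (σ + 1)} (hwu : w = fun i => ofSchwartz (σ + 1) (u i))
    (hw : w ∈ diffeoSet n (σ + 1)) (f : 𝓢(E n, ℝ)) (i j l : Fin n) {p q : L2 n}
    {r : Fin n → Fin n → L2 n} (hp : p =ᵐ[volume] fun x => entry j l w x * f x)
    (hq : q =ᵐ[volume] fun x => entry j l w x * (∂_{basisVec i} f : 𝓢(E n, ℝ)) x)
    (hr : ∀ a b, r a b =ᵐ[volume] fun x => entry j a w x * (entry b l w x * (f x *
          (∂_{basisVec i} (∂_{basisVec b} (u a)) : 𝓢(E n, ℝ)) x))) :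
    IsPartial i p (q - ∑ a, ∑ b, r a b) := by
  refine isPartial_of_hasLineDerivAt (F := fun x => entry j l w x * f x)
    (G := fun x => entry j l w x * (∂_{basisVec i} f : 𝓢(E n, ℝ)) x -
      ∑ a, ∑ b, entry j a w x * (entry b l w x * (f x *
        (∂_{basisVec i} (∂_{basisVec b} (u a)) : 𝓢(E n, ℝ)) x))) hp ?_ fun x => ?_
  · have hr' : ∀ᵐ x, ∀ a b, r a b x = entry j a w x * (entry b l w x * (f x *
          (∂_{basisVec i} (∂_{basisVec b} (u a)) : 𝓢(E n, ℝ)) x)) := by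
      rw [ae_all_iff]; intro a; rw [ae_all_iff]; exact hr a
    filter_upwards [hq, hr', Lp.coeFn_sub q (∑ a, ∑ b, r a b), coeFn_sum_sum r] with x h1 h2 h3 h4
    rw [h3, Pi.sub_apply, h1, h4]
    simp only [h2]
  · subst hwu
    have h1 := hasLineDerivAt_dinv_schwartz hσ hw i j l x
    have h2 := (f.hasFDerivAt x).hasLineDerivAt (basisVec i)
    have h3 := HasDerivAt.mul h1 h2
    refine HasDerivAt.congr_deriv h3 ?_
    rw [SchwartzMap.lineDerivOp_apply_eq_fderiv]
    simp only [zero_smul, add_zero, neg_mul, Finset.sum_mul]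
    rw [add_comm, sub_eq_add_neg]
    congr 2
    refine Finset.sum_congr rfl fun a _ => Finset.sum_congr rfl fun b _ => ?_
    ring

/-- The weak derivative `∂ᵢ` of the product of `g` and an entry of `(d(id + w))⁻¹`, where `B` is the
multiplication of functions. -/
def mulEntryDeriv {n k τ : ℕ} (B : Sobolev n (k + 1) →L[ℝ] Sobolev n τ →L[ℝ] Sobolev n k)
    (i j l : Fin n) (g : Sobolev n (k + 1)) (w : Fin n → Sobolev n (τ + 1 + 1)) : Sobolev n k :=
  mulEntry j l (Sobolev.D i g) w - ∑ a, ∑ b, mulEntry j a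
        (mulEntry b l (B g (Sobolev.D i (Sobolev.D b (w a)))) w) w

/-- The pairs `(g, w)` for which `id + w` is a diffeomorphism. -/
abbrev pairSet (n k m : ℕ) : Set (Sobolev n k × (Fin n → Sobolev n m)) :=
  Prod.snd ⁻¹' diffeoSet n m

theorem isOpen_pairSet {n σ : ℕ} (hσ : n < 2 * σ) (k : ℕ) : IsOpen (pairSet n k (σ + 1)) :=
  (isOpen_diffeoSet hσ).preimage continuous_snd

theorem continuousOn_mulEntryDeriv {n k τ : ℕ}
    (B : Sobolev n (k + 1) →L[ℝ] Sobolev n τ →L[ℝ] Sobolev n k)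
    (H : ∀ j l, ContinuousOn (fun p : Sobolev n k × (Fin n → Sobolev n (τ + 1 + 1)) =>
      mulEntry j l p.1 p.2) (pairSet n k (τ + 1 + 1))) (i j l : Fin n) :
    ContinuousOn (fun p : Sobolev n (k + 1) × (Fin n → Sobolev n (τ + 1 + 1)) =>
      mulEntryDeriv B i j l p.1 p.2) (pairSet n (k + 1) (τ + 1 + 1)) := by
  have H' : ∀ j l, ∀ f : Sobolev n (k + 1) × (Fin n → Sobolev n (τ + 1 + 1)) → Sobolev n k,
      ContinuousOn f (pairSet n (k + 1) (τ + 1 + 1)) →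
      ContinuousOn (fun p => mulEntry j l (f p) p.2) (pairSet n (k + 1) (τ + 1 + 1)) :=
    fun j l f hf => ContinuousOn.comp (f := fun p => (f p, p.2))
      (g := fun p : Sobolev n k × (Fin n → Sobolev n (τ + 1 + 1)) => mulEntry j l p.1 p.2)
      (H j l) (hf.prodMk continuousOn_snd) fun p hp => hp
  unfold mulEntryDeriv
  refine ContinuousOn.sub
    (H' j l (fun p => Sobolev.D i p.1) ((Sobolev.D i).continuous.comp continuous_fst).continuousOn)
    (continuousOn_finsetSum _ fun a _ => continuousOn_finsetSum _ fun b _ =>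
      H' j a (fun p => mulEntry b l (B p.1 (Sobolev.D i (Sobolev.D b (p.2 a)))) p.2)
        (H' b l (fun p => B p.1 (Sobolev.D i (Sobolev.D b (p.2 a)))) (Continuous.continuousOn ?_)))
  exact B.continuous₂.comp (continuous_fst.prodMk ((Sobolev.D i).continuous.comp
          ((Sobolev.D b).continuous.comp ((continuous_apply a).comp continuous_snd))))

theorem isPartial_mulEntryDeriv_schwartz {n k τ : ℕ} (hσ : n < 2 * (τ + 1))
    {B : Sobolev n (k + 1) →L[ℝ] Sobolev n τ →L[ℝ] Sobolev n k}
    (hB : ∀ f g, (B f g).toL2 =ᵐ[volume] fun x => f.toL2 x * g.toL2 x)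
    (H : ∀ j l, ∀ p ∈ pairSet n k (τ + 1 + 1), IsSob k fun x => entry j l p.2 x * p.1.toL2 x)
    {u : Fin n → 𝓢(E n, ℝ)}
    {w : Fin n → Sobolev n (τ + 1 + 1)} (hwu : w = fun i => ofSchwartz (τ + 1 + 1) (u i))
    (hw : w ∈ diffeoSet n (τ + 1 + 1)) (f : 𝓢(E n, ℝ)) (i j l : Fin n) :
    IsPartial i (ofFun 0 fun x => entry j l w x * (ofSchwartz (k + 1) f).toL2 x).toL2
      (mulEntryDeriv B i j l (ofSchwartz (k + 1) f) w).toL2 := by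
  have hc : ∀ j l (g : Sobolev n k), (mulEntry j l g w).toL2 =ᵐ[volume]
      fun x => entry j l w x * g.toL2 x := fun j l g => (H j l (g, w) hw).coeFn
  rw [mulEntryDeriv, map_sub, map_sum]
  simp only [map_sum]
  refine isPartial_entry_mul_schwartz hσ hwu hw f i j l ?_ ?_ fun a b => ?_
  · filter_upwards [(isSob_entry_mul_zero hσ hw j l (ofSchwartz (k + 1) f).toL2).coeFn,
        coeFn_ofSchwartz (k + 1) f] with x h1 h2
    rw [← h2]
    exact h1
  · rw [D_ofSchwartz]
    filter_upwards [hc j l (ofSchwartz k (∂_{basisVec i} f)),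
      coeFn_ofSchwartz k (∂_{basisVec i} f)] with x h1 h2
    rw [← h2]
    exact h1
  · have e : Sobolev.D i (Sobolev.D b (w a)) = ofSchwartz τ (∂_{basisVec i} (∂_{basisVec b} (u a)))
        := by rw [hwu, D_ofSchwartz, D_ofSchwartz]
    rw [e]
    filter_upwards [hc j a (mulEntry b l (B (ofSchwartz (k + 1) f)
          (ofSchwartz τ (∂_{basisVec i} (∂_{basisVec b} (u a))))) w),
      hc b l (B (ofSchwartz (k + 1) f) (ofSchwartz τ (∂_{basisVec i} (∂_{basisVec b} (u a))))),
      hB (ofSchwartz (k + 1) f) (ofSchwartz τ (∂_{basisVec i} (∂_{basisVec b} (u a)))),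
      coeFn_ofSchwartz (k + 1) f,
      coeFn_ofSchwartz τ (∂_{basisVec i} (∂_{basisVec b} (u a)))] with x h1 h2 h3 h4 h5
    rw [h1, h2, h3, h4, h5]

theorem continuousOn_entry_mul_toL2 {n σ : ℕ} (hσ : n < 2 * σ) (k : ℕ) (j l : Fin n) :
    ContinuousOn (fun p : Sobolev n k × (Fin n → Sobolev n (σ + 1)) =>
        ofFun 0 fun x => entry j l p.2 x * p.1.toL2 x) (pairSet n k (σ + 1)) := by
  have h1 : Continuous (fun p : Sobolev n k × (Fin n → Sobolev n (σ + 1)) => p.1.toL2) :=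
    (Sobolev.toL2CLM (n := n) (k := k)).continuous.comp continuous_fst
  have h2 : Continuous (fun p : Sobolev n k × (Fin n → Sobolev n (σ + 1)) => (p.1.toL2, p.2)) :=
    h1.prodMk continuous_snd
  have h3 : Set.MapsTo (fun p : Sobolev n k × (Fin n → Sobolev n (σ + 1)) => (p.1.toL2, p.2))
      (pairSet n k (σ + 1)) (Prod.snd ⁻¹' diffeoSet n (σ + 1)) := fun _ hp => hp
  have h4 := ContinuousOn.comp (continuousOn_entry_mul_zero hσ j l) h2.continuousOn h3
  simp only [Function.comp_def] at h4
  exact h4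

/-- Multiplication by an entry of `(d(id + w))⁻¹` maps `H^k` to itself for `k ≤ σ`, continuously in
the function and in `w`. The induction on `k` rests on `∂ᵢ A = -A (∂ᵢ dw) A` for
`A = (1 + dw)⁻¹`. -/
theorem isSob_entry_mul {n σ : ℕ} (hσ : n < 2 * σ) (k : ℕ) : k ≤ σ → ∀ j l : Fin n,
    (∀ p ∈ pairSet n k (σ + 1), IsSob k fun x => entry j l p.2 x * p.1.toL2 x) ∧
    ContinuousOn (fun p : Sobolev n k × (Fin n → Sobolev n (σ + 1)) => mulEntry j l p.1 p.2)
      (pairSet n k (σ + 1)) := by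
  induction k with
  | zero => exact fun _ j l => ⟨fun p hp => isSob_entry_mul_zero hσ hp j l _,
      continuousOn_entry_mul_toL2 hσ 0 j l⟩
  | succ k ih =>
    intro hk j l
    obtain ⟨τ, rfl⟩ : ∃ τ, σ = τ + 1 := ⟨σ - 1, by omega⟩
    have ih' := ih (by omega)
    obtain ⟨B, hB⟩ : ∃ B : Sobolev n (k + 1) →L[ℝ] Sobolev n τ →L[ℝ] Sobolev n k,
        ∀ f g, (B f g).toL2 =ᵐ[volume] fun x => f.toL2 x * g.toL2 x :=
      ⟨_, coeFn_mulB (by omega) (by omega) (by omega)⟩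
    have hGc := fun i => continuousOn_mulEntryDeriv B (fun j l => (ih' j l).2) i j l
    refine isSob_succ (fun p hp => isSob_entry_mul_zero hσ hp j l _)
      (continuousOn_entry_mul_toL2 hσ _ j l)
      (G := fun i p => mulEntryDeriv B i j l p.1 p.2) ?_ hGc
    rintro ⟨g, w⟩ hw i
    obtain ⟨f, hf, -⟩ := exists_schwartz_seq g
    obtain ⟨u, hu⟩ := exists_schwartz_tuple w
    have hlim := hf.prodMk_nhds hu
    have hS := (isOpen_pairSet hσ (k + 1)).mem_nhds hw
    have t1 := ((continuousOn_entry_mul_toL2 hσ _ j l).continuousAt hS).tendsto.comp hlim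
    have t2 := ((hGc i).continuousAt hS).tendsto.comp hlim
    refine IsPartial.of_tendsto (l := atTop) ?_ (Sobolev.tendsto_zero_iff.1 t1)
      ((Sobolev.toL2CLM.continuous.tendsto _).comp t2)
    filter_upwards [hlim.eventually hS] with m hm
    exact isPartial_mulEntryDeriv_schwartz hσ hB (fun j l => (ih' j l).1) rfl hm (f m) i j l

/-! ### Composition with the inverse diffeomorphism -/

theorem exists_abs_det_le (n : ℕ) (R : ℝ) : ∃ K : ℝ≥0, 1 ≤ K ∧ ∀ A : E n →L[ℝ] E n, ‖A‖ ≤ R →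
    |A.det| ≤ K := by
  have := FiniteDimensional.proper ℝ (E n →L[ℝ] E n)
  obtain ⟨K, hK⟩ := (isCompact_closedBall (0 : E n →L[ℝ] E n) R).exists_bound_of_continuousOn
    (ContinuousLinearMap.continuous_det (𝕜 := ℝ) (E := E n)).continuousOn
  exact ⟨max K.toNNReal 1, le_max_right _ _, fun A hA => by
    rw [NNReal.coe_max]
    exact ((hK A (by simpa using hA)).trans (Real.le_coe_toNNReal K)).trans (le_max_left _ _)⟩

theorem ae_comp_psi {n σ : ℕ} (hσ : n < 2 * σ) {w : Fin n → Sobolev n (σ + 1)}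
    (hw : w ∈ diffeoSet n (σ + 1)) {p : E n → Prop} (h : ∀ᵐ x, p x) : ∀ᵐ y, p (psi w y) := by
  rw [ae_iff] at h ⊢
  have h1 := addHaar_image_eq_zero_of_differentiableOn_of_addHaar_eq_zero (volume : Measure (E n))
    (f := phi w) ((contDiff_phi hσ w).differentiable (by norm_num)).differentiableOn h
  have h2 : {y | ¬ p (psi w y)} ⊆ phi w '' {x | ¬ p x} :=
    fun y hy => ⟨psi w y, hy, phi_psi hw y⟩
  exact measure_mono_null h2 h1

/-- The change of variables `y = x + w(x)` bounds composition with the inverse of `id + w` on `L²`,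
uniformly for `w` in bounded sets. -/
theorem eLpNorm_comp_psi_le {n σ : ℕ} (hσ : n < 2 * σ) (w₀ : Fin n → Sobolev n (σ + 1)) :
    ∃ K : ℝ≥0, ∀ᶠ w in 𝓝 w₀, w ∈ diffeoSet n (σ + 1) → ∀ f : E n → ℝ,
      eLpNorm (fun y => f (psi w y)) 2 volume ≤ K * eLpNorm f 2 volume := by
  obtain ⟨C, hC0, hC⟩ := exists_norm_ddisp_le n σ
  obtain ⟨K, hK1, hK⟩ := exists_abs_det_le n (‖(1 : E n →L[ℝ] E n)‖ + C * (‖w₀‖ + 1))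
  refine ⟨K, ?_⟩
  filter_upwards [Metric.ball_mem_nhds w₀ one_pos] with w hw₀ hw f
  have hdet : ∀ x, |(dphi w x).det| ≤ K := fun x => hK _ <| by
    have h1 : ‖w‖ ≤ ‖w₀‖ + 1 := by
      rw [mem_ball_iff_norm] at hw₀
      linarith [norm_sub_norm_le w w₀]
    exact (norm_add_le _ _).trans (by gcongr; exact (hC w x).trans (by gcongr))
  have himg : phi w '' Set.univ = Set.univ := by
    rw [Set.image_univ]
    exact Set.range_eq_univ.2 fun y => ⟨_, phi_psi hw y⟩
  have h1 := lintegral_image_eq_lintegral_abs_det_fderiv_mul (volume : Measure (E n))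
    MeasurableSet.univ (fun x _ => (hasFDerivAt_phi hσ w x).hasFDerivWithinAt)
    (fun x _ y _ h => by rw [← psi_phi hw x, h, psi_phi hw]) fun y => ‖f (psi w y)‖ₑ ^ 2
  simp only [himg, Measure.restrict_univ, psi_phi hw] at h1
  have h2 : eLpNorm (fun y => f (psi w y)) 2 volume ^ 2
      ≤ ((K : ℝ≥0∞) * eLpNorm f 2 volume) ^ 2 := by
    rw [eLpNorm_two_sq, h1, mul_pow, eLpNorm_two_sq, ← lintegral_const_mul' _ _ (by simp)]
    refine lintegral_mono fun x => ?_
    gcongr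
    calc ENNReal.ofReal |(dphi w x).det| ≤ K :=
          ENNReal.ofReal_le_of_le_toReal (by simpa using hdet x)
      _ ≤ (K : ℝ≥0∞) ^ 2 := le_self_pow₀ (by rw [ENNReal.one_le_coe_iff]; exact hK1) two_ne_zero
  exact (ENNReal.pow_le_pow_left_iff two_ne_zero).1 h2

theorem isSob_comp_psi_zero {n σ : ℕ} (hσ : n < 2 * σ) {w : Fin n → Sobolev n (σ + 1)}
    (hw : w ∈ diffeoSet n (σ + 1)) (f : L2 n) : IsSob 0 fun y => f (psi w y) := by
  obtain ⟨K, hK⟩ := eLpNorm_comp_psi_le hσ w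
  refine isSob_zero ⟨((Lp.stronglyMeasurable f).comp_measurable
    (continuous_psi hw).measurable).aestronglyMeasurable, ?_⟩
  exact (hK.self_of_nhds hw f).trans_lt (ENNReal.mul_lt_top ENNReal.coe_lt_top (Lp.memLp f).2)

/-- Composition with `(id + w)⁻¹` on `L²`. -/
def compL2 {n k : ℕ} (f : L2 n) (w : Fin n → Sobolev n k) : L2 n :=
  (ofFun 0 fun y => f (psi w y)).toL2

theorem coeFn_compL2 {n σ : ℕ} (hσ : n < 2 * σ) {w : Fin n → Sobolev n (σ + 1)}
    (hw : w ∈ diffeoSet n (σ + 1)) (f : L2 n) :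
    compL2 f w =ᵐ[volume] fun y => f (psi w y) := (isSob_comp_psi_zero hσ hw f).coeFn

theorem exists_norm_compL2_sub_le {n σ : ℕ} (hσ : n < 2 * σ) (w₀ : Fin n → Sobolev n (σ + 1)) :
    ∃ K : ℝ, 0 < K ∧ ∀ᶠ w in 𝓝 w₀, w ∈ diffeoSet n (σ + 1) → ∀ f g : L2 n,
      ‖compL2 f w - compL2 g w‖ ≤ K * ‖f - g‖ := by
  obtain ⟨K, hK⟩ := eLpNorm_comp_psi_le hσ w₀
  refine ⟨K + 1, by positivity, ?_⟩
  filter_upwards [hK] with w hKw hw f g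
  have h1 : eLpNorm (compL2 f w - compL2 g w) 2 volume ≤ K * eLpNorm (f - g) 2 volume := by
    refine le_trans (le_of_eq (eLpNorm_congr_ae ?_)) (hKw hw (f - g : L2 n))
    filter_upwards [Lp.coeFn_sub (compL2 f w) (compL2 g w), coeFn_compL2 hσ hw f,
      coeFn_compL2 hσ hw g, ae_comp_psi hσ hw (Lp.coeFn_sub f g)] with x h1 h2 h3 h4
    rw [h1, h4, Pi.sub_apply, Pi.sub_apply, h2, h3]
  rw [Lp.norm_def, Lp.norm_def]
  have h2 := ENNReal.toReal_mono
    (ENNReal.mul_lt_top ENNReal.coe_lt_top (Lp.memLp (f - g)).2).ne h1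
  rw [ENNReal.toReal_mul, ENNReal.coe_toReal] at h2
  refine h2.trans ?_
  gcongr
  linarith

theorem tendsto_compL2_of_hasCompactSupport {n σ : ℕ} (hσ : n < 2 * σ)
    {w₀ : Fin n → Sobolev n (σ + 1)} (hw₀ : w₀ ∈ diffeoSet n (σ + 1)) {v : E n → ℝ}
    (hv : HasCompactSupport v) (hvc : Continuous v) {f : L2 n} (hf : f =ᵐ[volume] v) :
    Tendsto (fun w => compL2 f w) (𝓝 w₀) (𝓝 (compL2 f w₀)) := by
  obtain ⟨C, hC0, hC⟩ := exists_norm_psi_sub_le hσ hw₀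
  obtain ⟨C', hC0', hC'⟩ := exists_norm_disp_le n (σ + 1)
  obtain ⟨R, hR⟩ := hv.isCompact.isBounded.exists_norm_le
  -- all the functions `v ∘ (id + w)⁻¹` with `w` near `w₀` vanish outside this ball
  set B := Metric.closedBall (0 : E n) (R + C' * (‖w₀‖ + 1)) with hB
  have hBf : volume B ≠ ∞ := (isCompact_closedBall _ _).measure_lt_top.ne
  set b : L2 n := indicatorConstLp 2 Metric.isClosed_closedBall.measurableSet hBf (1 : ℝ) with hb
  have hsupp : ∀ w ∈ diffeoSet n (σ + 1), ‖w‖ ≤ ‖w₀‖ + 1 → ∀ y, y ∉ B → v (psi w y) = 0 := by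
    intro w hw hwn y hy
    by_contra h
    refine hy ?_
    have h1 := hR _ (subset_tsupport v (Function.mem_support.2 h))
    rw [hB, mem_closedBall_zero_iff, ← phi_psi hw y]
    exact (norm_add_le _ _).trans (by gcongr; exact (hC' w _).trans (by gcongr))
  rw [Metric.tendsto_nhds]
  intro ε hε
  have huc := Metric.uniformContinuous_iff.1 (hv.uniformContinuous_of_continuous hvc)
    (ε / (2 * (‖b‖ + 1))) (by positivity)
  obtain ⟨δ, hδ, hδ'⟩ := huc
  filter_upwards [(isOpen_diffeoSet hσ).mem_nhds hw₀, Metric.ball_mem_nhds w₀ one_pos,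
    Metric.ball_mem_nhds w₀ (show 0 < δ / C by positivity)] with w hw hw1 hwδ
  have hwn : ‖w‖ ≤ ‖w₀‖ + 1 := by
    rw [mem_ball_iff_norm] at hw1
    linarith [norm_sub_norm_le w w₀]
  rw [mem_ball_iff_norm, lt_div_iff₀ hC0] at hwδ
  rw [dist_eq_norm]
  have key : ‖compL2 f w - compL2 f w₀‖ ≤ ε / (2 * (‖b‖ + 1)) * ‖b‖ + 0 * ‖b‖ := by
    refine norm_le_of_ae_le_add (by positivity) le_rfl ?_
    filter_upwards [Lp.coeFn_sub (compL2 f w) (compL2 f w₀), coeFn_compL2 hσ hw f,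
      coeFn_compL2 hσ hw₀ f, ae_comp_psi hσ hw hf, ae_comp_psi hσ hw₀ hf,
      indicatorConstLp_coeFn (p := 2) (hs := Metric.isClosed_closedBall.measurableSet) (hμs := hBf)
        (c := (1 : ℝ))] with y h1 h2 h3 h4 h5 h6
    rw [h1, Pi.sub_apply, h2, h3, h4, h5]
    change b y = B.indicator (fun _ => (1 : ℝ)) y at h6
    rw [h6]
    by_cases hy : y ∈ B
    · have h7 : dist (psi w y) (psi w₀ y) < δ := by
        rw [dist_eq_norm]
        exact (hC w hw y).trans_lt (by linarith)
      have h8 := (hδ' h7).le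
      rw [Real.dist_eq] at h8
      rw [Set.indicator_of_mem hy, abs_one, mul_one, zero_mul, add_zero]
      exact h8
    · rw [hsupp w hw hwn y hy, hsupp w₀ hw₀ (by linarith) y hy]
      rw [Set.indicator_of_notMem hy]
      simp
  refine key.trans_lt ?_
  rw [zero_mul, add_zero, div_mul_eq_mul_div, div_lt_iff₀ (by positivity)]
  nlinarith [norm_nonneg b]

/-- The composition operators are locally uniformly bounded on `L²`, so that continuity needs to be
checked only on continuous functions with compact support. -/
theorem continuousOn_compL2 {n σ : ℕ} (hσ : n < 2 * σ) :
    ContinuousOn (fun p : L2 n × (Fin n → Sobolev n (σ + 1)) => compL2 p.1 p.2)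
      (Prod.snd ⁻¹' diffeoSet n (σ + 1)) := by
  rintro ⟨f, w₀⟩ (hw₀ : w₀ ∈ diffeoSet n (σ + 1))
  refine ContinuousAt.continuousWithinAt (Metric.tendsto_nhds.2 fun ε hε => ?_)
  obtain ⟨K, hK0, hK⟩ := exists_norm_compL2_sub_le hσ w₀
  obtain ⟨v, hv, hv2, hvc, hvm⟩ := (Lp.memLp f).exists_hasCompactSupport_eLpNorm_sub_le
    (p := 2) (by simp) (ε := ENNReal.ofReal (ε / (4 * K)))
    (by rw [Ne, ENNReal.ofReal_eq_zero, not_le]; positivity)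
  have hfg : ‖f - hvm.toLp‖ ≤ ε / (4 * K) := by
    rw [Lp.norm_def]
    refine ENNReal.toReal_le_of_le_ofReal (by positivity) (le_trans (le_of_eq ?_) hv2)
    refine eLpNorm_congr_ae ?_
    filter_upwards [Lp.coeFn_sub f hvm.toLp, hvm.coeFn_toLp] with x h1 h2
    rw [h1, Pi.sub_apply, Pi.sub_apply, h2]
  have h1 := Metric.tendsto_nhds.1 ((tendsto_compL2_of_hasCompactSupport hσ hw₀ hv hvc
    hvm.coeFn_toLp).comp (continuous_snd.tendsto (f, w₀))) (ε / 4) (by positivity)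
  filter_upwards [(continuous_snd.tendsto (f, w₀)).eventually hK,
    (continuous_snd.tendsto (f, w₀)).eventually ((isOpen_diffeoSet hσ).mem_nhds hw₀), h1,
    (continuous_fst.tendsto (f, w₀)).eventually (Metric.ball_mem_nhds f
      (show 0 < ε / (4 * K) by positivity))] with ⟨g, w⟩ h2 h3 h4 h5
  rw [dist_eq_norm]
  rw [Function.comp_apply, dist_eq_norm] at h4
  replace h5 : ‖g - f‖ < ε / (4 * K) := mem_ball_iff_norm.1 h5
  have a1 := h2 h3 g f
  have a2 := h2 h3 f hvm.toLp
  have a3 := hK.self_of_nhds hw₀ hvm.toLp f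
  rw [norm_sub_rev hvm.toLp f] at a3
  have e : compL2 g w - compL2 f w₀ = (compL2 g w - compL2 f w) +
      (compL2 f w - compL2 hvm.toLp w) + (compL2 hvm.toLp w - compL2 hvm.toLp w₀)
      + (compL2 hvm.toLp w₀ - compL2 f w₀) := by abel
  have h6 : K * ‖g - f‖ < ε / 4 := by
    calc _ < K * (ε / (4 * K)) := by gcongr
      _ = ε / 4 := by field_simp
  have h7 : K * ‖f - hvm.toLp‖ ≤ ε / 4 := by
    calc _ ≤ K * (ε / (4 * K)) := by gcongr
      _ = ε / 4 := by field_simp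
  dsimp only
  rw [e]
  calc _ ≤ _ := norm_add₄_le
    _ < ε := by linarith

/-- Composition with `(id + w)⁻¹` on `H^k`. -/
def compPsi {n m k : ℕ} (f : Sobolev n k) (w : Fin n → Sobolev n m) : Sobolev n k :=
  ofFun k fun y => f.toL2 (psi w y)

theorem continuousOn_ofFun_comp_psi {n σ : ℕ} (hσ : n < 2 * σ) (k : ℕ) :
    ContinuousOn (fun p : Sobolev n k × (Fin n → Sobolev n (σ + 1)) =>
        ofFun 0 fun y => p.1.toL2 (psi p.2 y)) (pairSet n k (σ + 1)) := by
  have h1 : Continuous (fun p : Sobolev n k × (Fin n → Sobolev n (σ + 1)) => p.1.toL2) :=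
    (Sobolev.toL2CLM (n := n) (k := k)).continuous.comp continuous_fst
  have h2 : Continuous (fun p : Sobolev n k × (Fin n → Sobolev n (σ + 1)) => (p.1.toL2, p.2)) :=
    h1.prodMk continuous_snd
  have h3 : Set.MapsTo (fun p : Sobolev n k × (Fin n → Sobolev n (σ + 1)) => (p.1.toL2, p.2))
      (pairSet n k (σ + 1)) (Prod.snd ⁻¹' diffeoSet n (σ + 1)) := fun _ hp => hp
  have h4 := ContinuousOn.comp (continuousOn_compL2 hσ) h2.continuousOn h3
  have h5 := (Sobolev.ofL2 (n := n)).continuous.comp_continuousOn h4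
  simp only [Function.comp_def, compL2, Sobolev.ofL2_toL2] at h5
  exact h5

/-- The weak derivative `∂ᵢ` of `f ∘ (id + w)⁻¹`, by the chain rule. -/
def compPsiDeriv {n σ k : ℕ} (i : Fin n) (f : Sobolev n (k + 1))
    (w : Fin n → Sobolev n (σ + 1)) : Sobolev n k :=
  ∑ j, compPsi (mulEntry j i (Sobolev.D j f) w) w

theorem isPartial_compPsiDeriv_schwartz {n σ k : ℕ} (hσ : n < 2 * σ) (hk : k ≤ σ)
    (H : ∀ p ∈ pairSet n k (σ + 1), IsSob k fun y => p.1.toL2 (psi p.2 y))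
    {w : Fin n → Sobolev n (σ + 1)} (hw : w ∈ diffeoSet n (σ + 1)) (f : 𝓢(E n, ℝ)) (i : Fin n) :
    IsPartial i (ofFun 0 fun y => (ofSchwartz (k + 1) f).toL2 (psi w y)).toL2
      (compPsiDeriv i (ofSchwartz (k + 1) f) w).toL2 := by
  refine isPartial_of_hasLineDerivAt (F := fun y => f (psi w y))
    (G := fun y => ∑ j, entry j i w (psi w y) * (∂_{basisVec j} f : 𝓢(E n, ℝ)) (psi w y))
    ?_ ?_ fun y => ?_
  · filter_upwards [(isSob_comp_psi_zero hσ hw (ofSchwartz (k + 1) f).toL2).coeFn,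
      ae_comp_psi hσ hw (coeFn_ofSchwartz (k + 1) f)] with y h1 h2
    rw [← h2]
    exact h1
  · rw [compPsiDeriv, map_sum]
    have h : ∀ᵐ y, ∀ j, (compPsi (mulEntry j i (Sobolev.D j (ofSchwartz (k + 1) f)) w) w).toL2 y
        = entry j i w (psi w y) * (∂_{basisVec j} f : 𝓢(E n, ℝ)) (psi w y) := by
      rw [ae_all_iff]
      intro j
      rw [D_ofSchwartz]
      filter_upwards [(H (mulEntry j i (ofSchwartz k (∂_{basisVec j} f)) w, w) hw).coeFn,
        ae_comp_psi hσ hw (((isSob_entry_mul hσ k hk j i).1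
          (ofSchwartz k (∂_{basisVec j} f), w) hw).coeFn),
        ae_comp_psi hσ hw (coeFn_ofSchwartz k (∂_{basisVec j} f))] with y h1 h2 h3
      rw [← h3, ← h2]
      exact h1
    filter_upwards [h, coeFn_sum Finset.univ fun j => (compPsi (mulEntry j i
      (Sobolev.D j (ofSchwartz (k + 1) f)) w) w).toL2] with y h1 h2
    rw [h2]
    exact Finset.sum_congr rfl fun j _ => h1 j
  · have h1 := ((f.hasFDerivAt (psi w y)).comp y (hasFDerivAt_psi hσ hw y)).hasLineDerivAt
      (basisVec i)
    refine HasDerivAt.congr_deriv h1 ?_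
    rw [ContinuousLinearMap.comp_apply]
    conv_lhs => rw [← (EuclideanSpace.basisFun (Fin n) ℝ).sum_repr (dinv w (psi w y) (basisVec i)),
      map_sum]
    refine Finset.sum_congr rfl fun j _ => ?_
    rw [SchwartzMap.lineDerivOp_apply_eq_fderiv]
    simp [entry]

/-- Composition with `(id + w)⁻¹` maps `H^k` to itself for `k ≤ σ + 1`, continuously in the
function and in `w`. -/
theorem isSob_comp_psi {n σ : ℕ} (hσ : n < 2 * σ) (k : ℕ) : k ≤ σ + 1 →
    (∀ p ∈ pairSet n k (σ + 1), IsSob k fun y => p.1.toL2 (psi p.2 y)) ∧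
    ContinuousOn (fun p : Sobolev n k × (Fin n → Sobolev n (σ + 1)) => compPsi p.1 p.2)
      (pairSet n k (σ + 1)) := by
  induction k with
  | zero => exact fun _ => ⟨fun p hp => isSob_comp_psi_zero hσ hp _,
      continuousOn_ofFun_comp_psi hσ 0⟩
  | succ k ih =>
    intro hk
    have ih' := ih (by omega)
    have hGc : ∀ i, ContinuousOn (fun p : Sobolev n (k + 1) × (Fin n → Sobolev n (σ + 1)) =>
        compPsiDeriv i p.1 p.2) (pairSet n (k + 1) (σ + 1)) := by
      intro i
      refine continuousOn_finsetSum _ fun j _ => ?_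
      have c1 : Continuous (fun p : Sobolev n (k + 1) × (Fin n → Sobolev n (σ + 1)) =>
          (Sobolev.D j p.1, p.2)) :=
        ((Sobolev.D j).continuous.comp continuous_fst).prodMk continuous_snd
      have c2 := ContinuousOn.comp (isSob_entry_mul hσ k (by omega) j i).2 c1.continuousOn
        (s := pairSet n (k + 1) (σ + 1)) fun p hp => hp
      have c3 := c2.prodMk (continuousOn_snd (s := pairSet n (k + 1) (σ + 1)))
      have c4 := ContinuousOn.comp ih'.2 c3 fun p hp => hp
      simp only [Function.comp_def] at c4
      exact c4
    refine isSob_succ (fun p hp => isSob_comp_psi_zero hσ hp _)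
      (continuousOn_ofFun_comp_psi hσ _) (G := fun i p => compPsiDeriv i p.1 p.2) ?_ hGc
    rintro ⟨g, w⟩ hw i
    obtain ⟨f, hf, -⟩ := exists_schwartz_seq g
    have hlim := hf.prodMk_nhds (tendsto_const_nhds (x := w))
    have hS := (isOpen_pairSet hσ (k + 1)).mem_nhds hw
    have t1 := ((continuousOn_ofFun_comp_psi hσ _).continuousAt hS).tendsto.comp hlim
    have t2 := ((hGc i).continuousAt hS).tendsto.comp hlim
    exact IsPartial.of_tendsto (l := atTop) (Eventually.of_forall fun m =>
        isPartial_compPsiDeriv_schwartz hσ (by omega) ih'.1 hw (f m) i)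
      (Sobolev.tendsto_zero_iff.1 t1) ((Sobolev.toL2CLM.continuous.tendsto _).comp t2)

/-! ### The inverse diffeomorphism and composition with `id + w` -/

/-- The vector field `(id + w)⁻¹ - id = -w ∘ (id + w)⁻¹`. -/
def invField {n m : ℕ} (w : Fin n → Sobolev n m) (i : Fin n) : Sobolev n m := -compPsi (w i) w

theorem emb_compPsi {n σ : ℕ} (hσ : n < 2 * σ) {w : Fin n → Sobolev n (σ + 1)}
    (hw : w ∈ diffeoSet n (σ + 1)) (f : Sobolev n (σ + 1)) (y : E n) :
    emb (compPsi f w) y = emb f (psi w y) := by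
  refine emb_eq_of_ae (by omega) (F := fun y => emb f (psi w y))
    ((map_continuous (emb f)).comp (continuous_psi hw)) ?_ y
  filter_upwards [((isSob_comp_psi hσ (σ + 1) le_rfl).1 (f, w) hw).coeFn,
    ae_comp_psi hσ hw (emb_ae (by omega) f)] with y h1 h2
  rw [← h2]
  exact h1

theorem phi_invField {n σ : ℕ} (hσ : n < 2 * σ) {w : Fin n → Sobolev n (σ + 1)}
    (hw : w ∈ diffeoSet n (σ + 1)) : phi (invField w) = psi w := by
  funext y
  have h1 : disp (invField w) y = -disp w (psi w y) := by
    ext i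
    simp only [disp_apply, PiLp.neg_apply, invField, map_neg, ZeroAtInftyContinuousMap.neg_apply,
      emb_compPsi hσ hw]
  have h2 := phi_psi hw y
  rw [phi] at h2
  rw [phi, h1]
  nth_rewrite 1 [← h2]
  abel

theorem invField_mem {n σ : ℕ} (hσ : n < 2 * σ) {w : Fin n → Sobolev n (σ + 1)}
    (hw : w ∈ diffeoSet n (σ + 1)) : invField w ∈ diffeoSet n (σ + 1) := by
  obtain ⟨e, he, h1, h2⟩ := psi_spec hw
  refine ⟨e.symm, ⟨he.contDiff_symm, he.contDiff, fun y => ?_⟩, fun y => ?_⟩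
  · rw [h2, (hasFDerivAt_psi hσ hw y).fderiv]
    have h3 : (dinv w (psi w y)).det * (dphi w (psi w y)).det = 1 := by
      rw [← det_mul, dinv_mul_dphi hσ hw]
      exact LinearMap.det_id
    exact pos_of_mul_pos_left (by rw [h3]; exact one_pos) (det_dphi_pos hσ hw _).le
  · rw [phi_invField hσ hw, h2]

theorem psi_invField {n σ : ℕ} (hσ : n < 2 * σ) {w : Fin n → Sobolev n (σ + 1)}
    (hw : w ∈ diffeoSet n (σ + 1)) : psi (invField w) = phi w := by
  funext x
  have h := psi_phi (invField_mem hσ hw) (phi w x)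
  rwa [phi_invField hσ hw, psi_phi hw] at h

theorem continuousOn_invField {n σ : ℕ} (hσ : n < 2 * σ) :
    ContinuousOn (fun w : Fin n → Sobolev n (σ + 1) => invField w) (diffeoSet n (σ + 1)) := by
  refine continuousOn_pi.2 fun i => ContinuousOn.neg ?_
  have h1 : Continuous (fun w : Fin n → Sobolev n (σ + 1) => (w i, w)) :=
    (continuous_apply i).prodMk continuous_id
  have h2 := ContinuousOn.comp (isSob_comp_psi hσ (σ + 1) le_rfl).2 h1.continuousOn
    (s := diffeoSet n (σ + 1)) fun w hw => hw
  simp only [Function.comp_def] at h2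
  exact h2

/-- Composition with `id + w` on `H^k`. -/
def compPhi {n m k : ℕ} (f : Sobolev n k) (w : Fin n → Sobolev n m) : Sobolev n k :=
  ofFun k fun x => f.toL2 (phi w x)

theorem compPhi_eq {n σ k : ℕ} (hσ : n < 2 * σ) {w : Fin n → Sobolev n (σ + 1)}
    (hw : w ∈ diffeoSet n (σ + 1)) (f : Sobolev n k) : compPhi f w = compPsi f (invField w) := by
  rw [compPhi, compPsi, psi_invField hσ hw]

theorem isSob_comp_phi {n σ k : ℕ} (hσ : n < 2 * σ) (hk : k ≤ σ + 1)
    {w : Fin n → Sobolev n (σ + 1)} (hw : w ∈ diffeoSet n (σ + 1)) (f : Sobolev n k) :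
    IsSob k fun x => f.toL2 (phi w x) := by
  have := (isSob_comp_psi hσ k hk).1 (f, invField w) (invField_mem hσ hw)
  rwa [psi_invField hσ hw] at this

theorem coeFn_compPhi {n σ k : ℕ} (hσ : n < 2 * σ) (hk : k ≤ σ + 1)
    {w : Fin n → Sobolev n (σ + 1)} (hw : w ∈ diffeoSet n (σ + 1)) (f : Sobolev n k) :
    (compPhi f w).toL2 =ᵐ[volume] fun x => f.toL2 (phi w x) := (isSob_comp_phi hσ hk hw f).coeFn

theorem emb_compPhi {n σ : ℕ} (hσ : n < 2 * σ) {w : Fin n → Sobolev n (σ + 1)}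
    (hw : w ∈ diffeoSet n (σ + 1)) (f : Sobolev n (σ + 1)) (x : E n) :
    emb (compPhi f w) x = emb f (phi w x) := by
  rw [compPhi_eq hσ hw, emb_compPsi hσ (invField_mem hσ hw), psi_invField hσ hw]

theorem continuousOn_compPhi {n σ : ℕ} (hσ : n < 2 * σ) {k : ℕ} (hk : k ≤ σ + 1) :
    ContinuousOn (fun p : Sobolev n k × (Fin n → Sobolev n (σ + 1)) => compPhi p.1 p.2)
      (pairSet n k (σ + 1)) := by
  have h1 : ContinuousOn (fun p : Sobolev n k × (Fin n → Sobolev n (σ + 1)) =>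
      (p.1, invField p.2)) (pairSet n k (σ + 1)) :=
    continuousOn_fst.prodMk ((continuousOn_invField hσ).comp continuousOn_snd fun p hp => hp)
  have h2 := ContinuousOn.comp (isSob_comp_psi hσ k hk).2 h1 fun p hp => invField_mem hσ hp
  refine h2.congr fun p hp => ?_
  simp only [Function.comp_apply]
  exact compPhi_eq hσ hp p.1

/-- Functions in `H^s`, `s > n/2`, are determined by their continuous representatives. -/
theorem Sobolev.ext_emb {n k : ℕ} (hk : n < 2 * k) {f g : Sobolev n k}
    (h : ∀ x, emb f x = emb g x) : f = g :=
  Sobolev.ext_ae (emb_ae hk f) (by rw [show ⇑(emb f) = emb g from funext h]; exact emb_ae hk g)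

theorem exists_compPhi_clm {n σ : ℕ} (hσ : n < 2 * σ) {w : Fin n → Sobolev n (σ + 1)}
    (hw : w ∈ diffeoSet n (σ + 1)) :
    ∃ T : Sobolev n (σ + 1) →L[ℝ] Sobolev n (σ + 1), ∀ f, T f = compPhi f w := by
  refine ⟨⟨{ toFun := fun f => compPhi f w, map_add' := fun f g => ?_, map_smul' := fun c f => ?_ },
    ?_⟩, fun f => rfl⟩
  · refine Sobolev.ext_emb (by omega) fun x => ?_
    simp only [map_add, ZeroAtInftyContinuousMap.add_apply, emb_compPhi hσ hw]
  · refine Sobolev.ext_emb (by omega) fun x => ?_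
    simp only [map_smul, ZeroAtInftyContinuousMap.smul_apply, emb_compPhi hσ hw, RingHom.id_apply]
  · have h1 : Continuous (fun f : Sobolev n (σ + 1) => (f, w)) :=
      continuous_id.prodMk continuous_const
    exact (continuousOn_compPhi hσ le_rfl).comp_continuous h1 fun _ => hw

open Classical in
/-- Composition with `id + w` as an operator on `H^{σ+1}` (zero if `id + w` is not a
diffeomorphism). -/
def compOp {n σ : ℕ} (w : Fin n → Sobolev n (σ + 1)) :
    Sobolev n (σ + 1) →L[ℝ] Sobolev n (σ + 1) :=
  if h : ∃ T : Sobolev n (σ + 1) →L[ℝ] Sobolev n (σ + 1), ∀ f, T f = compPhi f w then h.choose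
    else 0

theorem compOp_apply {n σ : ℕ} (hσ : n < 2 * σ) {w : Fin n → Sobolev n (σ + 1)}
    (hw : w ∈ diffeoSet n (σ + 1)) (f : Sobolev n (σ + 1)) : compOp w f = compPhi f w := by
  rw [compOp, dif_pos (exists_compPhi_clm hσ hw)]
  exact (exists_compPhi_clm hσ hw).choose_spec f

theorem emb_compOp {n σ : ℕ} (hσ : n < 2 * σ) {w : Fin n → Sobolev n (σ + 1)}
    (hw : w ∈ diffeoSet n (σ + 1)) (f : Sobolev n (σ + 1)) (x : E n) :
    emb (compOp w f) x = emb f (phi w x) := by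
  rw [compOp_apply hσ hw, emb_compPhi hσ hw]

theorem continuousOn_compOp_apply {n σ : ℕ} (hσ : n < 2 * σ) :
    ContinuousOn (fun p : Sobolev n (σ + 1) × (Fin n → Sobolev n (σ + 1)) => compOp p.2 p.1)
      (pairSet n (σ + 1) (σ + 1)) :=
  (continuousOn_compPhi hσ le_rfl).congr fun p hp => compOp_apply hσ hp p.1

/-- The composition operators are locally uniformly bounded: this is joint continuity at `(0, w₀)`,
by homogeneity in the function. -/
theorem exists_norm_compOp_le {n σ : ℕ} (hσ : n < 2 * σ) {w₀ : Fin n → Sobolev n (σ + 1)}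
    (hw₀ : w₀ ∈ diffeoSet n (σ + 1)) : ∃ C : ℝ, 0 < C ∧ ∀ᶠ w in 𝓝 w₀, ‖compOp w‖ ≤ C := by
  have h1 : ContinuousAt (fun p : Sobolev n (σ + 1) × (Fin n → Sobolev n (σ + 1)) =>
      compOp p.2 p.1) (0, w₀) :=
    (continuousOn_compOp_apply hσ).continuousAt ((isOpen_pairSet hσ _).mem_nhds hw₀)
  have h2 : ∀ᶠ p : Sobolev n (σ + 1) × (Fin n → Sobolev n (σ + 1)) in 𝓝 (0, w₀),
      ‖compOp p.2 p.1‖ < 1 := by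
    refine h1.norm.tendsto.eventually_lt_const ?_
    simp
  rw [nhds_prod_eq, eventually_prod_iff] at h2
  obtain ⟨p, hp, q, hq, hpq⟩ := h2
  obtain ⟨δ, hδ, hδ'⟩ := Metric.eventually_nhds_iff.1 hp
  refine ⟨2 / δ, by positivity, ?_⟩
  filter_upwards [hq] with w hw
  refine (compOp w).opNorm_le_of_shell (ε := δ) hδ (by positivity) (c := (2 : ℝ)) (by norm_num)
    fun f h1 h2 => ?_
  have h3 := hpq (hδ' (by rwa [dist_zero_right])) hw
  rw [Real.norm_ofNat] at h1
  refine h3.le.trans ?_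
  rw [div_mul_eq_mul_div, le_div_iff₀ hδ]
  linarith

/-! ### Change of the regularity index -/

/-- The inclusion `H^m → H^k` on tuples. -/
def lowerVec {n m k : ℕ} (d : ℕ) (h : k ≤ m) : (Fin d → Sobolev n m) →L[ℝ] (Fin d → Sobolev n k) :=
  ContinuousLinearMap.pi fun i => (Sobolev.lower h).comp (ContinuousLinearMap.proj i)

@[simp] theorem lowerVec_apply {n m k d : ℕ} (h : k ≤ m) (w : Fin d → Sobolev n m) (i : Fin d) :
    lowerVec d h w i = Sobolev.lower h (w i) := rfl

theorem phi_lowerVec {n m k : ℕ} (hk : n < 2 * k) (h : k ≤ m) (w : Fin n → Sobolev n m) :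
    phi (lowerVec n h w) = phi w := by
  funext x
  rw [phi, phi]
  congr 1
  ext i
  simp [emb_lower hk h]

theorem lowerVec_mem_iff {n m k : ℕ} (hk : n < 2 * k) (h : k ≤ m) {w : Fin n → Sobolev n m} :
    lowerVec n h w ∈ diffeoSet n k ↔ w ∈ diffeoSet n m := by
  simp only [diffeoSet, Set.mem_ofPred_eq, phi_lowerVec hk h]

theorem psi_lowerVec {n m k : ℕ} (hk : n < 2 * k) (h : k ≤ m) {w : Fin n → Sobolev n m}
    (hw : w ∈ diffeoSet n m) : psi (lowerVec n h w) = psi w := by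
  funext x
  have h1 := phi_psi ((lowerVec_mem_iff hk h).2 hw) x
  rw [phi_lowerVec hk h] at h1
  rw [← psi_phi hw (psi (lowerVec n h w) x), h1]

theorem lowerVec_invField {n σ τ : ℕ} (hσ : n < 2 * σ) (h : σ + 1 ≤ τ + 1)
    {w : Fin n → Sobolev n (τ + 1)} (hw : w ∈ diffeoSet n (τ + 1)) :
    lowerVec n h (invField w) = invField (lowerVec n h w) := by
  have hw' := (lowerVec_mem_iff (k := σ + 1) (by omega) h).2 hw
  have h1 := phi_invField (by omega) hw
  have h2 := phi_invField hσ hw'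
  rw [psi_lowerVec (by omega) h hw, ← h1] at h2
  funext i
  refine Sobolev.ext_emb (by omega) fun x => ?_
  rw [lowerVec_apply, emb_lower (by omega)]
  have h3 := congrFun h2 x
  simp only [phi] at h3
  exact (congrFun (congrArg (fun v : E n => (v : Fin n → ℝ)) (add_left_cancel h3)) i).symm

/-! ### Differentiability of composition in the diffeomorphism -/

theorem contDiffOn_succ_of_hasFDerivAt {X Y : Type*} [NormedAddCommGroup X] [NormedSpace ℝ X]
    [NormedAddCommGroup Y] [NormedSpace ℝ Y] {O : Set X} (hO : IsOpen O) {f : X → Y}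
    {f' : X → X →L[ℝ] Y} {r : ℕ} (h : ∀ w ∈ O, HasFDerivAt f (f' w) w)
    (h' : ContDiffOn ℝ r f' O) : ContDiffOn ℝ (r + 1 : ℕ) f O := by
  have := (contDiffOn_succ_iff_fderiv_of_isOpen (n := (r : WithTop ℕ∞)) hO).2
    ⟨fun w hw => (h w hw).differentiableAt.differentiableWithinAt, by simp,
      h'.congr fun w hw => (h w hw).fderiv⟩
  exact_mod_cast this

/-- The multiplication of the Banach algebra `H^{σ+1}`. -/
def mulS {n σ : ℕ} (hσ : n < 2 * σ) :
    Sobolev n (σ + 1) →L[ℝ] Sobolev n (σ + 1) →L[ℝ] Sobolev n (σ + 1) :=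
  mulB le_rfl le_rfl (by omega)

theorem emb_mulS {n σ : ℕ} (hσ : n < 2 * σ) (f g : Sobolev n (σ + 1)) (x : E n) :
    emb (mulS hσ f g) x = emb f x * emb g x := emb_mulB _ _ (by omega) _ f g x

/-- The pointwise scalar product `(a, h) ↦ ∑ⱼ aⱼ hⱼ` of two tuples of Sobolev functions. -/
def pairing {n σ : ℕ} (hσ : n < 2 * σ) : (Fin n → Sobolev n (σ + 1)) →L[ℝ]
    (Fin n → Sobolev n (σ + 1)) →L[ℝ] Sobolev n (σ + 1) :=
  ∑ j, (mulS hσ).bilinearComp (ContinuousLinearMap.proj j) (ContinuousLinearMap.proj j)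

theorem pairing_apply {n σ : ℕ} (hσ : n < 2 * σ) (a h : Fin n → Sobolev n (σ + 1)) :
    pairing hσ a h = ∑ j, mulS hσ (a j) (h j) := by
  simp [pairing]

/-- Evaluation of the continuous representative. -/
def evalAt {n k : ℕ} (x : E n) : Sobolev n k →L[ℝ] ℝ :=
  LinearMap.mkContinuous
    { toFun := fun f => emb f x
      map_add' := fun f g => by simp
      map_smul' := fun c f => by simp } ‖emb (n := n) (s := k)‖ fun f => abs_emb_le f x

@[simp] theorem evalAt_apply {n k : ℕ} (x : E n) (f : Sobolev n k) : evalAt x f = emb f x := rfl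

theorem phi_add_smul {n k : ℕ} (w h : Fin n → Sobolev n k) (t : ℝ) (x : E n) :
    phi (w + t • h) x = phi w x + t • disp h x := by
  ext i
  simp [phi, add_assoc]

theorem continuousOn_compOp_segment {n σ : ℕ} (hσ : n < 2 * σ) (f : Sobolev n (σ + 1))
    {w h : Fin n → Sobolev n (σ + 1)}
    (hwh : ∀ t ∈ Set.Icc (0 : ℝ) 1, w + t • h ∈ diffeoSet n (σ + 1)) :
    ContinuousOn (fun t : ℝ => compOp (w + t • h) f) (Set.Icc 0 1) := by
  have h1 : Continuous (fun t : ℝ => (f, w + t • h)) := by fun_prop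
  have h2 := ContinuousOn.comp (continuousOn_compOp_apply hσ) h1.continuousOn
    (s := Set.Icc (0 : ℝ) 1) hwh
  simp only [Function.comp_def] at h2
  exact h2

/-- The fundamental theorem of calculus for `t ↦ f ∘ (id + w + t h)` in `H^{σ+1}`. It is checked
pointwise, by means of the continuous representatives. -/
theorem compOp_sub_eq_integral {n σ : ℕ} (hσ : n < 2 * σ) (f : Sobolev n (σ + 1 + 1))
    {w h : Fin n → Sobolev n (σ + 1)}
    (hwh : ∀ t ∈ Set.Icc (0 : ℝ) 1, w + t • h ∈ diffeoSet n (σ + 1)) :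
    compOp (w + h) (Sobolev.lower (Nat.le_succ _) f) - compOp w (Sobolev.lower (Nat.le_succ _) f)
      = ∫ t in (0 : ℝ)..1, pairing hσ (fun j => compOp (w + t • h) (Sobolev.D j f)) h := by
  have hc : ContinuousOn (fun t : ℝ => pairing hσ
      (fun j => compOp (w + t • h) (Sobolev.D j f)) h) (Set.Icc 0 1) :=
    ((pairing hσ).continuous.comp_continuousOn (continuousOn_pi.2 fun j =>
      continuousOn_compOp_segment hσ (Sobolev.D j f) hwh)).clm_apply continuousOn_const
  have hi : IntervalIntegrable (fun t : ℝ => pairing hσ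
      (fun j => compOp (w + t • h) (Sobolev.D j f)) h) volume 0 1 :=
    ContinuousOn.intervalIntegrable (by rwa [Set.uIcc_of_le zero_le_one])
  refine Sobolev.ext_emb (by omega) fun x => ?_
  have e1 := (evalAt (k := σ + 1) x).intervalIntegral_comp_comm hi
  simp only [evalAt_apply] at e1
  rw [← e1]
  have hd : ∀ t ∈ Set.uIcc (0 : ℝ) 1, HasDerivAt (fun t : ℝ => emb f (phi w x + t • disp h x))
      (emb (pairing hσ (fun j => compOp (w + t • h) (Sobolev.D j f)) h) x) t := by
    intro t ht
    rw [Set.uIcc_of_le zero_le_one] at ht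
    have h1 : HasDerivAt (fun t : ℝ => phi w x + t • disp h x) (disp h x) t := by
      simpa using ((hasDerivAt_id t).smul_const (disp h x)).const_add (phi w x)
    have h2 := (hasFDerivAt_emb (s := σ + 1) (by omega) f
      (phi w x + t • disp h x)).comp_hasDerivAt t h1
    refine HasDerivAt.congr_deriv h2 ?_
    rw [grad_apply, ← evalAt_apply, pairing_apply, map_sum]
    refine Finset.sum_congr rfl fun j _ => ?_
    rw [evalAt_apply, emb_mulS, emb_compOp hσ (hwh t ht), phi_add_smul, disp_apply]
  have e2 := intervalIntegral.integral_eq_sub_of_hasDerivAt hd ?_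
  · rw [e2, map_sub, ZeroAtInftyContinuousMap.sub_apply]
    have hw0 : w ∈ diffeoSet n (σ + 1) := by simpa using hwh 0 (by simp)
    have hw1 : w + h ∈ diffeoSet n (σ + 1) := by simpa using hwh 1 (by simp)
    rw [emb_compOp hσ hw0, emb_compOp hσ hw1, emb_lower (by omega), emb_lower (by omega)]
    have := phi_add_smul w h 1 x
    rw [one_smul] at this
    rw [this, zero_smul, add_zero]
  · refine ContinuousOn.intervalIntegrable ?_
    rw [Set.uIcc_of_le zero_le_one]
    exact (evalAt (k := σ + 1) x).continuous.comp_continuousOn hc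

/-- The remainder in the first-order expansion of `w ↦ f ∘ (id + w)`. -/
theorem norm_compOp_sub_sub_le {n σ : ℕ} (hσ : n < 2 * σ) (f : Sobolev n (σ + 1 + 1))
    {w h : Fin n → Sobolev n (σ + 1)}
    (hwh : ∀ t ∈ Set.Icc (0 : ℝ) 1, w + t • h ∈ diffeoSet n (σ + 1))
    (a : Fin n → Sobolev n (σ + 1)) {ε : ℝ} (hε : 0 ≤ ε)
    (ha : ∀ t ∈ Set.Icc (0 : ℝ) 1, ∀ j, ‖compOp (w + t • h) (Sobolev.D j f) - a j‖ ≤ ε) :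
    ‖compOp (w + h) (Sobolev.lower (Nat.le_succ _) f)
      - compOp w (Sobolev.lower (Nat.le_succ _) f) - pairing hσ a h‖
      ≤ ‖pairing hσ‖ * ε * ‖h‖ := by
  have hc : ContinuousOn (fun t : ℝ => pairing hσ
      (fun j => compOp (w + t • h) (Sobolev.D j f)) h) (Set.Icc 0 1) :=
    ((pairing hσ).continuous.comp_continuousOn (continuousOn_pi.2 fun j =>
      continuousOn_compOp_segment hσ (Sobolev.D j f) hwh)).clm_apply continuousOn_const
  have hi : IntervalIntegrable (fun t : ℝ => pairing hσ
      (fun j => compOp (w + t • h) (Sobolev.D j f)) h) volume 0 1 :=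
    ContinuousOn.intervalIntegrable (by rwa [Set.uIcc_of_le zero_le_one])
  have e : pairing hσ a h = ∫ _ in (0 : ℝ)..1, pairing hσ a h := by simp
  rw [compOp_sub_eq_integral hσ f hwh, e, ← intervalIntegral.integral_sub hi (by simp)]
  refine (intervalIntegral.norm_integral_le_of_norm_le_const (C := ‖pairing hσ‖ * ε * ‖h‖)
    fun t ht => ?_).trans (by simp)
  rw [Set.uIoc_of_le zero_le_one] at ht
  rw [← _root_.sub_apply, ← map_sub]
  refine ((pairing hσ).le_opNorm₂ _ _).trans ?_
  gcongr
  exact (pi_norm_le_iff_of_nonneg hε).2 fun j => ha t ⟨ht.1.le, ht.2⟩ j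

/-- Composition with `id + w` as an operator `H^m → H^{σ+1}`. -/
def compLow {n σ m : ℕ} (hm : σ + 1 ≤ m) (w : Fin n → Sobolev n (σ + 1)) :
    Sobolev n m →L[ℝ] Sobolev n (σ + 1) := (compOp w).comp (Sobolev.lower hm)

theorem compLow_apply {n σ m : ℕ} (hm : σ + 1 ≤ m) (w : Fin n → Sobolev n (σ + 1))
    (f : Sobolev n m) : compLow hm w f = compOp w (Sobolev.lower hm f) := rfl

/-- For an operator `T`, the bilinear map `(h, f) ↦ ∑ⱼ T(∂ⱼ f) hⱼ`: the derivative of composition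
when `T` is composition itself. -/
def gradMul {n σ : ℕ} (hσ : n < 2 * σ) (k : ℕ) : (Sobolev n k →L[ℝ] Sobolev n (σ + 1)) →L[ℝ]
    (Fin n → Sobolev n (σ + 1)) →L[ℝ] Sobolev n (k + 1) →L[ℝ] Sobolev n (σ + 1) :=
  LinearMap.mkContinuous₂ (LinearMap.mk₂ ℝ
    (fun T h => ∑ j, ((mulS hσ).flip (h j)).comp (T.comp (Sobolev.D j)))
    (fun T T' h => by ext1 f; simp [Finset.sum_add_distrib])
    (fun c T h => by ext1 f; simp [Finset.smul_sum])
    (fun T h h' => by ext1 f; simp [Finset.sum_add_distrib])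
    (fun c T h => by ext1 f; simp [Finset.smul_sum]))
    (∑ j : Fin n, ‖(mulS hσ).flip‖ * ‖Sobolev.D (n := n) (k := k) j‖) fun T h => by
      change ‖∑ j, ((mulS hσ).flip (h j)).comp (T.comp (Sobolev.D j))‖ ≤ _
      refine (norm_sum_le _ _).trans ?_
      rw [Finset.sum_mul, Finset.sum_mul]
      refine Finset.sum_le_sum fun j _ => ?_
      refine (((mulS hσ).flip (h j)).opNorm_comp_le (T.comp (Sobolev.D j))).trans ?_
      calc _ ≤ (‖(mulS hσ).flip‖ * ‖h‖) * (‖T‖ * ‖Sobolev.D (n := n) (k := k) j‖) := by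
            gcongr
            · exact ((mulS hσ).flip.le_opNorm _).trans (by gcongr; exact norm_le_pi_norm h j)
            · exact T.opNorm_comp_le (Sobolev.D j)
        _ = _ := by ring

theorem gradMul_apply {n σ k : ℕ} (hσ : n < 2 * σ) (T : Sobolev n k →L[ℝ] Sobolev n (σ + 1))
    (h : Fin n → Sobolev n (σ + 1)) (f : Sobolev n (k + 1)) :
    gradMul hσ k T h f = pairing hσ (fun j => T (Sobolev.D j f)) h := by
  rw [pairing_apply]
  simp [gradMul]

theorem exists_ball_diffeoSet {n σ : ℕ} (hσ : n < 2 * σ) {w : Fin n → Sobolev n (σ + 1)}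
    (hw : w ∈ diffeoSet n (σ + 1)) : ∃ δ > 0, ∀ h : Fin n → Sobolev n (σ + 1), ‖h‖ < δ →
      ∀ t ∈ Set.Icc (0 : ℝ) 1, w + t • h ∈ diffeoSet n (σ + 1) := by
  obtain ⟨δ, hδ, hδ'⟩ := Metric.isOpen_iff.1 (isOpen_diffeoSet hσ) w hw
  refine ⟨δ, hδ, fun h hh t ht => hδ' ?_⟩
  rw [mem_ball_iff_norm, add_sub_cancel_left, norm_smul, Real.norm_eq_abs, abs_of_nonneg ht.1]
  exact (mul_le_of_le_one_left (norm_nonneg _) ht.2).trans_lt hh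

theorem norm_smul_le_of_mem_Icc {V : Type*} [NormedAddCommGroup V] [NormedSpace ℝ V] {t : ℝ}
    (ht : t ∈ Set.Icc (0 : ℝ) 1) (h : V) : ‖t • h‖ ≤ ‖h‖ := by
  rw [norm_smul, Real.norm_eq_abs, abs_of_nonneg ht.1]
  exact mul_le_of_le_one_left (norm_nonneg _) ht.2

theorem exists_norm_D_le (n k : ℕ) : ∃ K : ℝ, 0 < K ∧ ∀ (j : Fin n) (f : Sobolev n (k + 1)),
    ‖Sobolev.D j f‖ ≤ K * ‖f‖ := by
  refine ⟨∑ j : Fin n, ‖Sobolev.D (n := n) (k := k) j‖ + 1, by positivity, fun j f => ?_⟩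
  refine ((Sobolev.D j).le_opNorm f).trans ?_
  gcongr
  have := Finset.single_le_sum (f := fun j => ‖Sobolev.D (n := n) (k := k) j‖)
    (fun _ _ => norm_nonneg _) (Finset.mem_univ j)
  linarith

/-- Loss of one derivative makes composition continuous, in fact locally Lipschitz, in the operator
norm. -/
theorem continuousOn_compLow {n σ : ℕ} (hσ : n < 2 * σ) {m : ℕ} (hm : σ + 1 ≤ m)
    (hm' : σ + 2 ≤ m) : ContinuousOn (compLow hm : (Fin n → Sobolev n (σ + 1)) →
      Sobolev n m →L[ℝ] Sobolev n (σ + 1)) (diffeoSet n (σ + 1)) := by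
  suffices H : ContinuousOn (compLow (Nat.le_succ (σ + 1)) : (Fin n → Sobolev n (σ + 1)) →
      Sobolev n (σ + 1 + 1) →L[ℝ] Sobolev n (σ + 1)) (diffeoSet n (σ + 1)) from
    (H.clm_comp (continuousOn_const (c := Sobolev.lower hm')))
  intro w hw
  refine ContinuousAt.continuousWithinAt ?_
  obtain ⟨C, hC0, hC⟩ := exists_norm_compOp_le hσ hw
  obtain ⟨δ, hδ, hδ'⟩ := Metric.eventually_nhds_iff.1 hC
  obtain ⟨ρ, hρ, hρ'⟩ := exists_ball_diffeoSet hσ hw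
  obtain ⟨K, hK0, hK⟩ := exists_norm_D_le n (σ + 1)
  rw [ContinuousAt, tendsto_iff_norm_sub_tendsto_zero]
  have h1 : Tendsto (fun v : Fin n → Sobolev n (σ + 1) => ‖pairing hσ‖ * (C * K) * ‖v - w‖) (𝓝 w)
      (𝓝 0) := by
    have : Continuous (fun v : Fin n → Sobolev n (σ + 1) =>
      ‖pairing hσ‖ * (C * K) * ‖v - w‖) := by fun_prop
    simpa using this.tendsto w
  refine squeeze_zero' (Eventually.of_forall fun _ => norm_nonneg _) ?_ h1
  filter_upwards [Metric.ball_mem_nhds w hδ, Metric.ball_mem_nhds w hρ] with v hv1 hv2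
  rw [mem_ball_iff_norm] at hv1 hv2
  refine ContinuousLinearMap.opNorm_le_bound _ (by positivity) fun f => ?_
  have h2 := norm_compOp_sub_sub_le hσ f (hρ' (v - w) hv2) 0 (ε := C * (K * ‖f‖)) (by positivity)
    fun t ht j => by
      rw [Pi.zero_apply, sub_zero]
      refine (ContinuousLinearMap.le_opNorm _ _).trans ?_
      gcongr
      · refine hδ' ?_
        rw [dist_eq_norm, add_sub_cancel_left]
        exact (norm_smul_le_of_mem_Icc ht _).trans_lt hv1
      · exact hK j f
  rw [map_zero, _root_.zero_apply, sub_zero, add_sub_cancel] at h2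
  refine h2.trans (le_of_eq ?_)
  ring

/-- For fixed `f ∈ H^{σ+2}`, the map `w ↦ f ∘ (id + w)` into `H^{σ+1}` is differentiable. -/
theorem hasFDerivAt_compOp_apply {n σ : ℕ} (hσ : n < 2 * σ) (f : Sobolev n (σ + 1 + 1))
    {w : Fin n → Sobolev n (σ + 1)} (hw : w ∈ diffeoSet n (σ + 1)) :
    HasFDerivAt (fun w => compOp w (Sobolev.lower (Nat.le_succ _) f))
      (pairing hσ fun j => compOp w (Sobolev.D j f)) w := by
  rw [hasFDerivAt_iff_isLittleO_nhds_zero, Asymptotics.isLittleO_iff]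
  intro c hc
  obtain ⟨ρ, hρ, hρ'⟩ := exists_ball_diffeoSet hσ hw
  have h1 : ∀ j, ∀ᶠ v in 𝓝 w, ‖compOp v (Sobolev.D j f) - compOp w (Sobolev.D j f)‖
      < c / (‖pairing hσ‖ + 1) := by
    intro j
    have h2 : Continuous (fun v : Fin n → Sobolev n (σ + 1) => (Sobolev.D j f, v)) :=
      continuous_const.prodMk continuous_id
    have h3 := ((continuousOn_compOp_apply hσ).continuousAt ((isOpen_pairSet hσ _).mem_nhds
      (show (Sobolev.D j f, w) ∈ pairSet n (σ + 1) (σ + 1) from hw))).tendsto.comp (h2.tendsto w)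
    exact (tendsto_iff_norm_sub_tendsto_zero.1 h3).eventually_lt_const (by positivity)
  obtain ⟨δ, hδ, hδ'⟩ := Metric.eventually_nhds_iff.1 (eventually_all.2 h1)
  filter_upwards [Metric.ball_mem_nhds 0 hδ, Metric.ball_mem_nhds 0 hρ] with h hh1 hh2
  rw [mem_ball_zero_iff] at hh1 hh2
  refine (norm_compOp_sub_sub_le hσ f (hρ' h hh2) _ (ε := c / (‖pairing hσ‖ + 1))
    (by positivity) fun t ht j => (hδ' ?_ j).le).trans ?_
  · rw [dist_eq_norm, add_sub_cancel_left]
    exact (norm_smul_le_of_mem_Icc ht _).trans_lt hh1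
  · gcongr
    rw [← mul_div_assoc, div_le_iff₀ (by positivity)]
    nlinarith [norm_nonneg (pairing hσ)]

/-- Loss of two derivatives makes composition differentiable in the operator norm. -/
theorem hasFDerivAt_compLow {n σ : ℕ} (hσ : n < 2 * σ) {k : ℕ} (hk : σ + 1 ≤ k)
    (hk' : σ + 2 ≤ k) (hk1 : σ + 1 ≤ k + 1) {w : Fin n → Sobolev n (σ + 1)}
    (hw : w ∈ diffeoSet n (σ + 1)) :
    HasFDerivAt (compLow hk1 : (Fin n → Sobolev n (σ + 1)) →
      Sobolev n (k + 1) →L[ℝ] Sobolev n (σ + 1)) (gradMul hσ k (compLow hk w)) w := by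
  rw [hasFDerivAt_iff_isLittleO_nhds_zero, Asymptotics.isLittleO_iff]
  intro c hc
  obtain ⟨ρ, hρ, hρ'⟩ := exists_ball_diffeoSet hσ hw
  obtain ⟨K, hK0, hK⟩ := exists_norm_D_le n k
  have h1 : ∀ᶠ v in 𝓝 w, ‖(compLow hk v : Sobolev n k →L[ℝ] Sobolev n (σ + 1)) - compLow hk w‖
      < c / (‖pairing hσ‖ * K + 1) := by
    have h3 := ((continuousOn_compLow hσ hk hk').continuousAt
      ((isOpen_diffeoSet hσ).mem_nhds hw)).tendsto
    exact (tendsto_iff_norm_sub_tendsto_zero.1 h3).eventually_lt_const (by positivity)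
  obtain ⟨δ, hδ, hδ'⟩ := Metric.eventually_nhds_iff.1 h1
  filter_upwards [Metric.ball_mem_nhds 0 hδ, Metric.ball_mem_nhds 0 hρ] with h hh1 hh2
  rw [mem_ball_zero_iff] at hh1 hh2
  refine ContinuousLinearMap.opNorm_le_bound _ (by positivity) fun f => ?_
  have h2 := norm_compOp_sub_sub_le hσ (Sobolev.lower (by omega) f : Sobolev n (σ + 1 + 1))
    (hρ' h hh2) (fun j => compLow hk w (Sobolev.D j f))
    (ε := c / (‖pairing hσ‖ * K + 1) * (K * ‖f‖)) (by positivity) fun t ht j => by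
      rw [Sobolev.lower_D hk, ← compLow_apply, ← _root_.sub_apply]
      refine (ContinuousLinearMap.le_opNorm _ _).trans ?_
      gcongr
      · refine (hδ' ?_).le
        rw [dist_eq_norm, add_sub_cancel_left]
        exact (norm_smul_le_of_mem_Icc ht _).trans_lt hh1
      · exact hK j f
  rw [← gradMul_apply] at h2
  refine LE.le.trans (le_of_eq ?_) (h2.trans ?_)
  · rfl
  · have h3 : ‖pairing hσ‖ * (c / (‖pairing hσ‖ * K + 1) * (K * ‖f‖)) * ‖h‖
        = (‖pairing hσ‖ * K) / (‖pairing hσ‖ * K + 1) * (c * ‖h‖ * ‖f‖) := by ring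
    rw [h3]
    refine mul_le_of_le_one_left (by positivity) ?_
    rw [div_le_one (by positivity)]
    linarith

/-- Composition with `id + w`, as an operator `H^m → H^{σ+1}`, is `C^r` in `w` for
`m ≥ σ + 1 + (r + 1)`. -/
theorem contDiffOn_compLow {n σ : ℕ} (hσ : n < 2 * σ) (r : ℕ) : ∀ {m : ℕ} (hm : σ + 1 ≤ m),
    σ + r + 2 ≤ m → ContDiffOn ℝ r (compLow hm : (Fin n → Sobolev n (σ + 1)) →
      Sobolev n m →L[ℝ] Sobolev n (σ + 1)) (diffeoSet n (σ + 1)) := by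
  induction r with
  | zero =>
    intro m hm h
    rw [Nat.cast_zero, contDiffOn_zero]
    exact continuousOn_compLow hσ hm (by omega)
  | succ r ih =>
    intro m hm h
    obtain ⟨k, rfl⟩ : ∃ k, m = k + 1 := ⟨m - 1, by omega⟩
    have hk : σ + 1 ≤ k := by omega
    refine contDiffOn_succ_of_hasFDerivAt (isOpen_diffeoSet hσ)
      (fun w hw => hasFDerivAt_compLow hσ hk (by omega) hm hw) ?_
    have h1 : ContDiff ℝ r (gradMul hσ k) := ContinuousLinearMap.contDiff
      (E := Sobolev n k →L[ℝ] Sobolev n (σ + 1))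
      (F := (Fin n → Sobolev n (σ + 1)) →L[ℝ] Sobolev n (k + 1) →L[ℝ] Sobolev n (σ + 1)) _
    exact h1.comp_contDiffOn (ih hk (by omega))

/-- The map `(u, v) ↦ L v u` is differentiable at `(u, w)` as soon as `L` is continuous at `w` in
the operator norm and `v ↦ L v u` is differentiable, since the mixed term `(L v' - L w) (u' - u)` is
of higher order. Because of this, composition as a map of two variables is differentiable although
the composition operator need not be. -/
theorem hasFDerivAt_clm_apply_of_continuousAt {X Y Z : Type*} [NormedAddCommGroup X]
    [NormedSpace ℝ X] [NormedAddCommGroup Y] [NormedSpace ℝ Y] [NormedAddCommGroup Z]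
    [NormedSpace ℝ Z] {L : X → Y →L[ℝ] Z} {w : X} {u : Y} {G : X →L[ℝ] Z}
    (hL : ContinuousAt L w) (hG : HasFDerivAt (fun v => L v u) G w) :
    HasFDerivAt (fun p : Y × X => L p.2 p.1)
      ((L w).comp (ContinuousLinearMap.fst ℝ Y X) + G.comp (ContinuousLinearMap.snd ℝ Y X))
      (u, w) := by
  have h1 : HasFDerivAt (fun p : Y × X => L w p.1) ((L w).comp (ContinuousLinearMap.fst ℝ Y X))
      (u, w) := ((L w).comp (ContinuousLinearMap.fst ℝ Y X)).hasFDerivAt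
  have h2 : HasFDerivAt (fun p : Y × X => L p.2 u) (G.comp (ContinuousLinearMap.snd ℝ Y X))
      (u, w) := HasFDerivAt.comp (f := Prod.snd) (u, w) hG hasFDerivAt_snd
  have h3 : HasFDerivAt (fun p : Y × X => (L p.2 - L w) (p.1 - u)) (0 : Y × X →L[ℝ] Z) (u, w) := by
    rw [hasFDerivAt_iff_isLittleO, Asymptotics.isLittleO_iff]
    intro c hc
    have h4 : Tendsto (fun p : Y × X => ‖L p.2 - L w‖) (𝓝 (u, w)) (𝓝 0) :=
      (tendsto_iff_norm_sub_tendsto_zero.1 hL.tendsto).comp (continuous_snd.tendsto (u, w))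
    filter_upwards [h4.eventually_lt_const hc] with p hp
    simp only [sub_self, _root_.zero_apply, sub_zero]
    refine (ContinuousLinearMap.le_opNorm _ _).trans ?_
    gcongr
    exact norm_fst_le (p - (u, w))
  have h5 := (h1.add h2).add h3
  rw [add_zero] at h5
  refine (h5.sub_const (L w u)).congr_of_eventuallyEq (Eventually.of_forall fun p => ?_)
  simp only [Pi.add_apply, _root_.sub_apply, map_sub]
  abel

/-- Composition `H^m × D^{σ+1} → H^{σ+1}` is `C^r` for `m ≥ σ + 1 + r`. -/
theorem contDiffOn_compLow_apply {n σ : ℕ} (hσ : n < 2 * σ) (r : ℕ) : ∀ {m : ℕ} (hm : σ + 1 ≤ m),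
    σ + 1 + r ≤ m → ContDiffOn ℝ r
      (fun p : Sobolev n m × (Fin n → Sobolev n (σ + 1)) => compLow hm p.2 p.1)
      (pairSet n m (σ + 1)) := by
  induction r with
  | zero =>
    intro m hm h
    rw [Nat.cast_zero, contDiffOn_zero]
    have h1 : Continuous (fun p : Sobolev n m × (Fin n → Sobolev n (σ + 1)) =>
        (Sobolev.lower hm p.1, p.2)) :=
      ((Sobolev.lower hm).continuous.comp continuous_fst).prodMk continuous_snd
    have h2 := ContinuousOn.comp (continuousOn_compOp_apply hσ) h1.continuousOn
      (s := pairSet n m (σ + 1)) fun p hp => hp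
    simp only [Function.comp_def] at h2
    exact h2
  | succ r ih =>
    intro m hm h
    obtain ⟨k, rfl⟩ : ∃ k, m = k + 1 := ⟨m - 1, by omega⟩
    have hk : σ + 1 ≤ k := by omega
    refine contDiffOn_succ_of_hasFDerivAt (isOpen_pairSet hσ _)
      (f' := fun p => (compLow hm p.2).comp (ContinuousLinearMap.fst ℝ _ _)
        + (pairing hσ fun j => compLow hk p.2 (Sobolev.D j p.1)).comp
          (ContinuousLinearMap.snd ℝ _ _)) ?_ ?_
    · rintro ⟨f, w⟩ (hw : w ∈ diffeoSet n (σ + 1))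
      refine hasFDerivAt_clm_apply_of_continuousAt ((continuousOn_compLow hσ hm
        (by omega)).continuousAt ((isOpen_diffeoSet hσ).mem_nhds hw)) ?_
      have := hasFDerivAt_compOp_apply hσ (Sobolev.lower (by omega) f : Sobolev n (σ + 1 + 1)) hw
      simp only [Sobolev.lower_D hk] at this
      exact this
    · have c1 : ContDiffOn ℝ r (fun p : Sobolev n (k + 1) × (Fin n → Sobolev n (σ + 1)) =>
          (compLow hm p.2 : Sobolev n (k + 1) →L[ℝ] Sobolev n (σ + 1)))
          (pairSet n (k + 1) (σ + 1)) :=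
        (contDiffOn_compLow hσ r hm (by omega)).comp contDiffOn_snd fun p hp => hp
      have c2 : ContDiffOn ℝ r (fun p : Sobolev n (k + 1) × (Fin n → Sobolev n (σ + 1)) =>
          fun j => compLow hk p.2 (Sobolev.D j p.1)) (pairSet n (k + 1) (σ + 1)) := by
        refine contDiffOn_pi.2 fun j => ?_
        have c3 : ContDiff ℝ r (fun p : Sobolev n (k + 1) × (Fin n → Sobolev n (σ + 1)) =>
            (Sobolev.D j p.1, p.2)) :=
          ((Sobolev.D j).contDiff.comp contDiff_fst).prodMk contDiff_snd
        have c4 := (ih hk (by omega)).comp c3.contDiffOn (s := pairSet n (k + 1) (σ + 1))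
          fun p hp => hp
        simp only [Function.comp_def] at c4
        exact c4
      exact (c1.clm_comp contDiffOn_const).add
        (((pairing hσ).contDiff.comp_contDiffOn c2).clm_comp contDiffOn_const)

/-! ### Differentiability of the inversion -/

theorem isOpen_diffeoSet_of_le {n σ m : ℕ} (hσ : n < 2 * σ) (hm : σ + 1 ≤ m) :
    IsOpen (diffeoSet n m) := by
  have h1 : diffeoSet n m = lowerVec n hm ⁻¹' diffeoSet n (σ + 1) :=
    Set.ext fun w => (lowerVec_mem_iff (by omega) hm).symm
  rw [h1]
  exact (isOpen_diffeoSet hσ).preimage (lowerVec n hm).continuous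

theorem phi_zero (n k : ℕ) : phi (0 : Fin n → Sobolev n k) = id := by
  funext x
  ext i
  simp [phi]

theorem zero_mem_diffeoSet (n k : ℕ) : (0 : Fin n → Sobolev n k) ∈ diffeoSet n k :=
  ⟨Equiv.refl _, isDiffeo_refl n, fun x => by rw [phi_zero]; rfl⟩

theorem compOp_zero {n σ : ℕ} (hσ : n < 2 * σ) (f : Sobolev n (σ + 1)) :
    compOp (0 : Fin n → Sobolev n (σ + 1)) f = f := by
  refine Sobolev.ext_emb (by omega) fun x => ?_
  rw [emb_compOp hσ (zero_mem_diffeoSet _ _), phi_zero, id]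

/-- With `z = -h ∘ (id + w + h)⁻¹` one has `(id + w + h)⁻¹ = (id + w)⁻¹ ∘ (id + z)`. This expresses
the inverse at `w + h` by the inverse at `w` and by compositions only. -/
theorem invField_add {n σ : ℕ} (hσ : n < 2 * σ) {w h z : Fin n → Sobolev n (σ + 1)}
    (hw : w ∈ diffeoSet n (σ + 1)) (hwh : w + h ∈ diffeoSet n (σ + 1))
    (hz : z ∈ diffeoSet n (σ + 1)) (hzh : ∀ i, z i = -compOp (invField (w + h)) (h i)) (i : Fin n) :
    invField (w + h) i = z i + compOp z (invField w i) := by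
  refine Sobolev.ext_emb (by omega) fun x => ?_
  have h1 : disp z x = -disp h (psi (w + h) x) := by
    ext j
    simp only [disp_apply, PiLp.neg_apply, hzh, map_neg, ZeroAtInftyContinuousMap.neg_apply,
      emb_compOp hσ (invField_mem hσ hwh), phi_invField hσ hwh]
  have h2 : phi z x = phi w (psi (w + h) x) := by
    have h3 := phi_psi hwh x
    rw [phi, disp_add] at h3
    rw [phi, phi, h1]
    nth_rewrite 1 [← h3]
    abel
  have h4 : psi w (phi z x) = psi (w + h) x := by rw [h2, psi_phi hw]
  have h5 : disp (invField (w + h)) x = disp z x + disp (invField w) (phi z x) := by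
    have h6 := congrFun (phi_invField hσ hwh) x
    have h7 := congrFun (phi_invField hσ hw) (phi z x)
    rw [h4, ← h6, phi, phi, phi] at h7
    have h8 : x + (disp z x + disp (invField w) (x + disp z x)) =
        x + disp (invField (w + h)) x := by
      rw [← add_assoc]; exact h7
    exact (add_left_cancel h8).symm
  rw [map_add, ZeroAtInftyContinuousMap.add_apply, emb_compOp hσ hz]
  exact congrArg (fun v : E n => v i) h5

/-- The derivative of the inversion at `w`, where `J = (id + w)⁻¹ - id` and `L` is the operator of
composition with `(id + w)⁻¹`. -/
def invDeriv {n σ m : ℕ} (hσ : n < 2 * σ) (J : Fin n → Sobolev n (σ + 1 + 1))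
    (L : Sobolev n m →L[ℝ] Sobolev n (σ + 1)) :
    (Fin n → Sobolev n m) →L[ℝ] (Fin n → Sobolev n (σ + 1)) :=
  ContinuousLinearMap.pi fun i => -(L.comp (ContinuousLinearMap.proj i) +
    (pairing hσ fun j => Sobolev.D j (J i)).comp
      (ContinuousLinearMap.pi fun j => L.comp (ContinuousLinearMap.proj j)))

/-- The derivative at `0` of `h ↦ -(L h) h`, componentwise, for an `L` that is only continuous. -/
theorem hasFDerivAt_apply_self {ι Y Z : Type*} [Fintype ι] [NormedAddCommGroup Y]
    [NormedSpace ℝ Y] [NormedAddCommGroup Z] [NormedSpace ℝ Z] {L : (ι → Y) → Y →L[ℝ] Z}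
    (hL : ContinuousAt L 0) : HasFDerivAt (fun (h : ι → Y) i => -L h (h i))
      (ContinuousLinearMap.pi fun i => -((L 0).comp (ContinuousLinearMap.proj i))) 0 := by
  refine hasFDerivAt_pi.2 fun i => ?_
  have h0 : HasFDerivAt (fun v => L v (0 : Y)) (0 : (ι → Y) →L[ℝ] Z) 0 := by
    simp only [map_zero]
    exact hasFDerivAt_const _ _
  have h1 := hasFDerivAt_clm_apply_of_continuousAt hL h0
  have h2 : HasFDerivAt (fun h : ι → Y => (h i, h))
      ((ContinuousLinearMap.proj i : (ι → Y) →L[ℝ] Y).prod (ContinuousLinearMap.id ℝ _)) 0 :=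
    ((ContinuousLinearMap.proj i : (ι → Y) →L[ℝ] Y).prod
      (ContinuousLinearMap.id ℝ _)).hasFDerivAt
  have h3 := (HasFDerivAt.comp (f := fun h : ι → Y => (h i, h))
    (g := fun p : Y × (ι → Y) => L p.2 p.1) 0 h1 h2).neg
  refine h3.congr_fderiv ?_
  ext1 h
  simp

theorem continuousAt_compLow_invField {n σ m : ℕ} (hσ : n < 2 * σ) (hm : σ + 1 ≤ m)
    (hm' : σ + 1 + 1 ≤ m) {w : Fin n → Sobolev n m} (hw : w ∈ diffeoSet n m) :
    ContinuousAt (fun h : Fin n → Sobolev n m =>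
      (compLow hm (invField (lowerVec n hm (w + h))) : Sobolev n m →L[ℝ] Sobolev n (σ + 1))) 0 := by
  have hw' : lowerVec n hm w ∈ diffeoSet n (σ + 1) := (lowerVec_mem_iff (by omega) hm).2 hw
  have c1 : Tendsto (fun h : Fin n → Sobolev n m => lowerVec n hm (w + h)) (𝓝 0)
      (𝓝 (lowerVec n hm w)) := by
    have : Continuous (fun h : Fin n → Sobolev n m => lowerVec n hm (w + h)) :=
      (lowerVec n hm).continuous.comp (continuous_const.add continuous_id)
    simpa only [add_zero] using this.tendsto 0
  have c2 := ((continuousOn_invField hσ).continuousAt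
    ((isOpen_diffeoSet hσ).mem_nhds hw')).tendsto.comp c1
  have c3 := ((continuousOn_compLow hσ hm (by omega)).continuousAt
    ((isOpen_diffeoSet hσ).mem_nhds (invField_mem hσ hw'))).tendsto.comp c2
  rw [ContinuousAt, add_zero]
  exact c3

/-- The derivative at `0` of `k ↦ k + J ∘ (id + k)`. -/
theorem hasFDerivAt_add_compOp {n σ : ℕ} (hσ : n < 2 * σ) (J : Fin n → Sobolev n (σ + 1 + 1)) :
    HasFDerivAt (fun (k : Fin n → Sobolev n (σ + 1)) i =>
      k i + compOp k (Sobolev.lower (Nat.le_succ (σ + 1)) (J i)))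
      (ContinuousLinearMap.pi fun i => (ContinuousLinearMap.proj i :
        (Fin n → Sobolev n (σ + 1)) →L[ℝ] Sobolev n (σ + 1)) +
        pairing hσ fun j => Sobolev.D j (J i)) 0 := by
  refine hasFDerivAt_pi.2 fun i => ?_
  have h1 := hasFDerivAt_compOp_apply hσ (J i) (zero_mem_diffeoSet n (σ + 1))
  simp only [compOp_zero hσ] at h1
  exact (ContinuousLinearMap.proj i :
      (Fin n → Sobolev n (σ + 1)) →L[ℝ] Sobolev n (σ + 1)).hasFDerivAt.add h1

/-- The inversion is differentiable: by `invField_add` it is, near `w`, the composition of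
`h ↦ z = -h ∘ (id + w + h)⁻¹` and of the map in `hasFDerivAt_add_compOp`. The former is
differentiable at `0` because the inversion is continuous. -/
theorem hasFDerivAt_invField {n σ m : ℕ} (hσ : n < 2 * σ) (hm : σ + 1 ≤ m) (hm' : σ + 1 + 1 ≤ m)
    {w : Fin n → Sobolev n m} (hw : w ∈ diffeoSet n m) :
    HasFDerivAt (fun v : Fin n → Sobolev n m => invField (lowerVec n hm v))
      (invDeriv hσ (invField (lowerVec n hm' w)) (compLow hm (invField (lowerVec n hm w)))) w := by
  have hw' : lowerVec n hm w ∈ diffeoSet n (σ + 1) := (lowerVec_mem_iff (by omega) hm).2 hw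
  have hw'' : lowerVec n hm' w ∈ diffeoSet n (σ + 1 + 1) := (lowerVec_mem_iff (by omega) hm').2 hw
  obtain ⟨J, hJ⟩ : ∃ J, J = invField (lowerVec n hm' w) := ⟨_, rfl⟩
  have hJlow : ∀ i, invField (lowerVec n hm w) i = Sobolev.lower (Nat.le_succ (σ + 1)) (J i) := by
    intro i
    have := lowerVec_invField hσ (Nat.le_succ (σ + 1)) hw''
    rw [hJ]
    exact (congrFun this i).symm
  rw [← hJ]
  -- the operator of composition with the inverse at `w + h`, as a function of `h`
  obtain ⟨L, hL⟩ : ∃ L : (Fin n → Sobolev n m) → Sobolev n m →L[ℝ] Sobolev n (σ + 1),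
    L = fun h => compLow hm (invField (lowerVec n hm (w + h))) := ⟨_, rfl⟩
  have hL0 : compLow hm (invField (lowerVec n hm w)) = L 0 := by
    simp only [hL, add_zero]
  rw [hL0]
  have hz := hasFDerivAt_apply_self (hL ▸ continuousAt_compLow_invField hσ hm hm' hw :
    ContinuousAt L 0)
  -- the vector field `z` of `invField_add`
  obtain ⟨z, hzdef⟩ : ∃ z : (Fin n → Sobolev n m) → Fin n → Sobolev n (σ + 1),
    z = fun h i => -L h (h i) := ⟨_, rfl⟩
  rw [← hzdef] at hz
  have hz0 : z 0 = 0 := by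
    funext i
    rw [hzdef]
    simp
  have hF := hasFDerivAt_add_compOp hσ J
  rw [← hz0] at hF
  have hcomp := HasFDerivAt.comp 0 hF hz
  have key : ∀ᶠ h in 𝓝 (0 : Fin n → Sobolev n m), invField (lowerVec n hm (w + h))
      = fun i => z h i + compOp (z h) (Sobolev.lower (Nat.le_succ (σ + 1)) (J i)) := by
    have e1 : ∀ᶠ h in 𝓝 (0 : Fin n → Sobolev n m), z h ∈ diffeoSet n (σ + 1) :=
      hz.continuousAt.tendsto.eventually ((isOpen_diffeoSet hσ).mem_nhds
        (by rw [hz0]; exact zero_mem_diffeoSet _ _))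
    have e2 : ∀ᶠ h in 𝓝 (0 : Fin n → Sobolev n m), w + h ∈ diffeoSet n m := by
      have : Continuous (fun h : Fin n → Sobolev n m => w + h) := by fun_prop
      exact (this.tendsto 0).eventually ((isOpen_diffeoSet_of_le hσ hm).mem_nhds
        (by rwa [add_zero]))
    filter_upwards [e1, e2] with h h1 h2
    funext i
    have h3 := (lowerVec_mem_iff (k := σ + 1) (by omega) hm).2 h2
    have h4 : z h = fun i => -compOp (invField (lowerVec n hm w + lowerVec n hm h))
        (lowerVec n hm h i) := by
      rw [← map_add, hzdef, hL]; rfl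
    rw [map_add] at h3 ⊢
    rw [← hJlow]
    exact invField_add hσ hw' h3 h1 (fun i => congrFun h4 i) i
  have hfin := hcomp.congr_of_eventuallyEq (f₁ := fun h => invField (lowerVec n hm (w + h))) key
  have hd : (ContinuousLinearMap.pi fun i => (ContinuousLinearMap.proj i :
        (Fin n → Sobolev n (σ + 1)) →L[ℝ] Sobolev n (σ + 1)) +
        pairing hσ fun j => Sobolev.D j (J i)).comp
        (ContinuousLinearMap.pi fun i => -((L 0).comp (ContinuousLinearMap.proj i)))
      = invDeriv hσ J (L 0) := by
    ext1 h
    funext i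
    simp only [invDeriv, ContinuousLinearMap.comp_apply, ContinuousLinearMap.pi_apply,
      _root_.add_apply, _root_.neg_apply, ContinuousLinearMap.proj_apply, neg_add]
    congr 1
    rw [← map_neg]
    rfl
  rw [hd] at hfin
  have hsub : HasFDerivAt (fun v : Fin n → Sobolev n m => v - w)
      (ContinuousLinearMap.id ℝ (Fin n → Sobolev n m)) w := (hasFDerivAt_id w).sub_const w
  have hfin' : HasFDerivAt (fun h => invField (lowerVec n hm (w + h))) (invDeriv hσ J (L 0))
    (w - w) := by rwa [sub_self]
  have hend := HasFDerivAt.comp (f := fun v : Fin n → Sobolev n m => v - w) w hfin' hsub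
  simpa only [Function.comp_def, add_sub_cancel, ContinuousLinearMap.comp_id] using hend

theorem contDiffOn_clm_pi {ι X Y Z : Type*} [Fintype ι] [NormedAddCommGroup X] [NormedSpace ℝ X]
    [NormedAddCommGroup Y] [NormedSpace ℝ Y] [NormedAddCommGroup Z] [NormedSpace ℝ Z] {s : Set X}
    {r : ℕ} {A : ι → X → Y →L[ℝ] Z} (hA : ∀ i, ContDiffOn ℝ r (A i) s) :
    ContDiffOn ℝ r (fun x => ContinuousLinearMap.pi fun i => A i x) s := by
  classical
  have h : (fun x => ContinuousLinearMap.pi fun i => A i x) =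
      fun x => ∑ i, (ContinuousLinearMap.single ℝ (fun _ : ι => Z) i).comp (A i x) := by
    funext x
    ext y j
    simp [Pi.single_apply]
  rw [h]
  exact ContDiffOn.sum fun i _ => contDiffOn_const.clm_comp (hA i)

/-- The shape of `invDeriv` as a function of the operators that it is made of. -/
theorem contDiffOn_pi_neg_add {ι X Y Z : Type*} [Fintype ι] [NormedAddCommGroup X]
    [NormedSpace ℝ X] [NormedAddCommGroup Y] [NormedSpace ℝ Y] [NormedAddCommGroup Z]
    [NormedSpace ℝ Z] {s : Set X} {r : ℕ} {L : X → Y →L[ℝ] Z} {B : ι → X → (ι → Z) →L[ℝ] Z}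
    (hL : ContDiffOn ℝ r L s) (hB : ∀ i, ContDiffOn ℝ r (B i) s) :
    ContDiffOn ℝ r (fun x => (ContinuousLinearMap.pi fun i =>
      -((L x).comp (ContinuousLinearMap.proj i) + (B i x).comp
        (ContinuousLinearMap.pi fun j => (L x).comp (ContinuousLinearMap.proj j))) :
        (ι → Y) →L[ℝ] (ι → Z))) s :=
  contDiffOn_clm_pi fun i => ((hL.clm_comp contDiffOn_const).add ((hB i).clm_comp
    (contDiffOn_clm_pi fun _ => hL.clm_comp contDiffOn_const))).neg

/-- The inversion `D^m → D^{σ+1}` is `C^r` for `m ≥ σ + 1 + r`. The derivative involves the inverse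
in `H^{σ+2}`, so that the induction on `r` runs over all `σ`. -/
theorem contDiffOn_invField {n : ℕ} (r : ℕ) : ∀ {σ m : ℕ} (_ : n < 2 * σ) (hm : σ + 1 ≤ m),
    σ + 1 + r ≤ m → ContDiffOn ℝ r (fun w : Fin n → Sobolev n m => invField (lowerVec n hm w))
      (diffeoSet n m) := by
  induction r with
  | zero =>
    intro σ m hσ hm h
    rw [Nat.cast_zero, contDiffOn_zero]
    exact (continuousOn_invField hσ).comp (lowerVec n hm).continuous.continuousOn
      fun w hw => (lowerVec_mem_iff (k := σ + 1) (by omega) hm).2 hw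
  | succ r ih =>
    intro σ m hσ hm h
    have hm' : σ + 1 + 1 ≤ m := by omega
    refine contDiffOn_succ_of_hasFDerivAt (isOpen_diffeoSet_of_le hσ hm)
      (fun w hw => hasFDerivAt_invField hσ hm hm' hw) ?_
    have c1 : ContDiffOn ℝ r (fun w : Fin n → Sobolev n m => (compLow hm (invField
        (lowerVec n hm w)) : Sobolev n m →L[ℝ] Sobolev n (σ + 1))) (diffeoSet n m) :=
      (contDiffOn_compLow hσ r hm (by omega)).comp (ih hσ hm (by omega)) fun w hw =>
        invField_mem hσ ((lowerVec_mem_iff (k := σ + 1) (by omega) hm).2 hw)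
    have c2 : ∀ i, ContDiffOn ℝ r (fun w : Fin n → Sobolev n m => pairing hσ fun j =>
        Sobolev.D j (invField (lowerVec n hm' w) i)) (diffeoSet n m) := fun i => by
      have h0 := ih (σ := σ + 1) (by omega) hm' (by omega)
      have h1 := contDiffOn_pi.1 h0 i
      exact (pairing hσ).contDiff.comp_contDiffOn
        (contDiffOn_pi.2 fun j => (Sobolev.D j).contDiff.comp_contDiffOn h1)
    exact contDiffOn_pi_neg_add c1 c2

/-! ### The chart of the diffeomorphism group -/

theorem toMap_apply {n d s : ℕ} (u : SobolevVec n d s) (x : E n) (i : Fin d) :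
    toMap u x i = (u i).toL2 x := rfl

theorem toMap_ae_eq_disp {n k : ℕ} (hk : n < 2 * k) (w : SobolevVec n n k) :
    toMap w =ᵐ[volume] disp (WithLp.ofLp w) := by
  filter_upwards [ae_all_iff.2 fun i => emb_ae hk (w i)] with x hx
  ext i
  rw [toMap_apply, hx i, disp_apply]

theorem SobolevVec.ext_toMap {n d k : ℕ} {u v : SobolevVec n d k}
    (h : toMap u =ᵐ[volume] toMap v) : u = v := by
  ext i
  refine Sobolev.ext_toL2 (Lp.ext ?_)
  filter_upwards [h] with x hx
  exact congrArg (fun y : E d => y i) hx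

theorem chart_eq {n k : ℕ} {φ : Diffeo n k} {v : SobolevVec n n k}
    (h : toMap v =ᵐ[volume] fun x => φ.1 x - x) : chart φ = v :=
  SobolevVec.ext_toMap ((chart_spec φ).trans h.symm)

/-- The identity `φ = id + (φ - id)` holds everywhere, with the continuous representative of
`φ - id`. -/
theorem coe_eq_phi {n k : ℕ} (hk : n < 2 * k) (φ : Diffeo n k) :
    ⇑φ.1 = phi (WithLp.ofLp (chart φ)) := by
  have h1 := (chart_spec φ).symm.trans (toMap_ae_eq_disp hk (chart φ))
  have hc : Continuous (disp (WithLp.ofLp (chart φ))) := by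
    have h : disp (WithLp.ofLp (chart φ)) = fun x => phi (WithLp.ofLp (chart φ)) x - x :=
      funext fun x => (add_sub_cancel_left x _).symm
    rw [h]
    exact (continuous_phi (WithLp.ofLp (chart φ))).sub continuous_id
  have h2 := (Continuous.ae_eq_iff_eq (volume : Measure (E n))
    (φ.2.1.contDiff.continuous.sub continuous_id) hc).1 h1
  funext x
  rw [phi, ← congrFun h2 x]
  simp

theorem ofLp_chart_mem {n k : ℕ} (hk : n < 2 * k) (φ : Diffeo n k) :
    WithLp.ofLp (chart φ) ∈ diffeoSet n k :=
  ⟨φ.1, φ.2.1, congrFun (coe_eq_phi hk φ)⟩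

theorem mem_range_chart_iff {n k : ℕ} (hk : n < 2 * k) (w : SobolevVec n n k) :
    w ∈ Set.range (chart (n := n) (s := k)) ↔ WithLp.ofLp w ∈ diffeoSet n k := by
  constructor
  · rintro ⟨φ, rfl⟩
    exact ofLp_chart_mem hk φ
  · rintro ⟨e, he, hew⟩
    have h : toMap w =ᵐ[volume] fun x => e x - x := by
      filter_upwards [toMap_ae_eq_disp hk w] with x hx
      rw [hx, hew, phi, add_sub_cancel_left]
    exact ⟨⟨e, he, w, h⟩, chart_eq h⟩

theorem range_chart {n k : ℕ} (hk : n < 2 * k) :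
    Set.range (chart (n := n) (s := k)) =
      PiLp.continuousLinearEquiv 2 ℝ (fun _ : Fin n => Sobolev n k) ⁻¹' diffeoSet n k :=
  Set.ext (mem_range_chart_iff hk)

theorem isOpen_range_chart {n σ m : ℕ} (hσ : n < 2 * σ) (hm : σ + 1 ≤ m) :
    IsOpen (Set.range (chart (n := n) (s := m))) := by
  rw [range_chart (by omega)]
  exact (isOpen_diffeoSet_of_le hσ hm).preimage (ContinuousLinearEquiv.continuous _)

theorem chart_param {n k : ℕ} {w : SobolevVec n n k}
    (hw : w ∈ Set.range (chart (n := n) (s := k))) :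
    chart (param w) = w := by
  obtain ⟨φ, rfl⟩ := hw
  rw [param_chart]

/-! ### Composition and inversion on the diffeomorphism group -/

/-- The composition `(u, φ) ↦ u ∘ φ`, with `φ` given by its chart. -/
def comp {n d σ m : ℕ} (hm : σ + 1 ≤ m) (p : SobolevVec n d m × Diffeo n (σ + 1)) :
    SobolevVec n d (σ + 1) :=
  WithLp.toLp 2 fun i => compLow hm (WithLp.ofLp (chart p.2)) (p.1 i)

theorem toMap_comp {n d σ m : ℕ} (hσ : n < 2 * σ) (hm : σ + 1 ≤ m) (u : SobolevVec n d m)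
    (φ : Diffeo n (σ + 1)) : toMap (comp hm (u, φ)) =ᵐ[volume] toMap u ∘ φ.1 := by
  have hw := ofLp_chart_mem (by omega) φ
  filter_upwards [ae_all_iff.2 fun i => coeFn_compPhi hσ le_rfl hw (Sobolev.lower hm (u i))]
    with x hx
  ext i
  have h1 := hx i
  rw [← compOp_apply hσ hw, Sobolev.toL2_lower, ← coe_eq_phi (by omega) φ] at h1
  exact h1

theorem contDiffOn_comp {n d σ m r : ℕ} (hσ : n < 2 * σ) (hm : σ + 1 ≤ m) (h : σ + 1 + r ≤ m) :
    ContDiffOn ℝ r (fun p : SobolevVec n d m × SobolevVec n n (σ + 1) => comp hm (p.1, param p.2))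
      (Set.univ ×ˢ Set.range (chart (n := n) (s := σ + 1))) := by
  have h1 : ContDiffOn ℝ r (fun (p : SobolevVec n d m × SobolevVec n n (σ + 1)) (i : Fin d) =>
      compLow hm (WithLp.ofLp p.2) (p.1 i))
      (Set.univ ×ˢ Set.range (chart (n := n) (s := σ + 1))) := by
    refine contDiffOn_pi.2 fun i => ?_
    have h2 : ContDiff ℝ r (fun p : SobolevVec n d m × SobolevVec n n (σ + 1) =>
        (p.1 i, (WithLp.ofLp p.2 : Fin n → Sobolev n (σ + 1)))) := by
      have e1 : ContDiff ℝ r fun p : SobolevVec n d m × SobolevVec n n (σ + 1) => p.1 i :=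
        (PiLp.proj 2 (𝕜 := ℝ) (fun _ : Fin d => Sobolev n m) i).contDiff.comp contDiff_fst
      have e2 : ContDiff ℝ r fun p : SobolevVec n d m × SobolevVec n n (σ + 1) =>
          (WithLp.ofLp p.2 : Fin n → Sobolev n (σ + 1)) :=
        (PiLp.continuousLinearEquiv 2 ℝ (fun _ : Fin n => Sobolev n (σ + 1))).contDiff.comp
          contDiff_snd
      exact e1.prodMk e2
    have h3 := ContDiffOn.comp (contDiffOn_compLow_apply hσ r hm h) h2.contDiffOn
      (s := Set.univ ×ˢ Set.range (chart (n := n) (s := σ + 1)))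
      fun p hp => (mem_range_chart_iff (by omega) p.2).1 hp.2
    exact h3
  have h4 := (PiLp.continuousLinearEquiv 2 ℝ
    (fun _ : Fin d => Sobolev n (σ + 1))).symm.contDiff.comp_contDiffOn h1
  refine h4.congr fun p hp => ?_
  rw [comp, chart_param hp.2]
  rfl

/-- The inversion `φ ↦ φ⁻¹`, in charts. The vector field `φ⁻¹ - id` is in the image of the chart
(see `chart_inversion`), so that the value of `param` is the intended one. -/
def inversion {n σ m : ℕ} (hm : σ + 1 ≤ m) (φ : Diffeo n m) : Diffeo n (σ + 1) :=
  param (WithLp.toLp 2 (invField (lowerVec n hm (WithLp.ofLp (chart φ)))))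

theorem chart_inversion {n σ m : ℕ} (hσ : n < 2 * σ) (hm : σ + 1 ≤ m) (φ : Diffeo n m) :
    chart (inversion hm φ) = WithLp.toLp 2 (invField (lowerVec n hm (WithLp.ofLp (chart φ)))) :=
  chart_param ((mem_range_chart_iff (by omega) _).2 (invField_mem hσ
    ((lowerVec_mem_iff (by omega) hm).2 (ofLp_chart_mem (by omega) φ))))

theorem coe_inversion {n σ m : ℕ} (hσ : n < 2 * σ) (hm : σ + 1 ≤ m) (φ : Diffeo n m) :
    (inversion hm φ).1 = φ.1.symm := by
  have hw := (lowerVec_mem_iff (k := σ + 1) (by omega) hm).2 (ofLp_chart_mem (by omega) φ)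
  refine Equiv.ext fun y => ?_
  rw [Equiv.eq_symm_apply, coe_eq_phi (by omega) φ, coe_eq_phi (by omega) (inversion hm φ),
    chart_inversion hσ, phi_invField hσ hw, ← phi_lowerVec (k := σ + 1) (by omega) hm,
    phi_psi hw]

theorem contDiffOn_inversion {n σ m r : ℕ} (hσ : n < 2 * σ) (hm : σ + 1 ≤ m) (h : σ + 1 + r ≤ m) :
    ContDiffOn ℝ r (fun w : SobolevVec n n m => chart (inversion hm (param w)))
      (Set.range (chart (n := n) (s := m))) := by
  have h1 := (contDiffOn_invField r hσ hm h).comp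
    (PiLp.continuousLinearEquiv 2 ℝ (fun _ : Fin n => Sobolev n m)).contDiff.contDiffOn
    (s := Set.range (chart (n := n) (s := m)))
    fun w hw => (mem_range_chart_iff (by omega) w).1 hw
  have h2 := (PiLp.continuousLinearEquiv 2 ℝ
    (fun _ : Fin n => Sobolev n (σ + 1))).symm.contDiff.comp_contDiffOn h1
  refine h2.congr fun w hw => ?_
  rw [chart_inversion hσ, chart_param hw]
  rfl

end SobolevDiff

end

/-- Composition and inversion of `H^s`-regular diffeomorphisms of `ℝⁿ` are `C^r`-maps. The manifold
`D^s(ℝⁿ)` is read in its global chart `φ ↦ φ - id`, whose image is open in `H^s(ℝⁿ, ℝⁿ)`. -/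
theorem theorem1 (n d s r : ℕ) (hn : 1 ≤ n) (hs : (n : ℝ) / 2 + 1 < (s : ℝ)) :
    IsOpen (Set.range (SobolevDiff.chart (n := n) (s := s))) ∧
    IsOpen (Set.range (SobolevDiff.chart (n := n) (s := s + r))) ∧
    (∃ μ : SobolevDiff.SobolevVec n d (s + r) × SobolevDiff.Diffeo n s →
          SobolevDiff.SobolevVec n d s,
      (∀ u φ, SobolevDiff.toMap (μ (u, φ)) =ᵐ[volume] SobolevDiff.toMap u ∘ φ.1) ∧
      ContDiffOn ℝ r (fun p : SobolevDiff.SobolevVec n d (s + r) × SobolevDiff.SobolevVec n n s =>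
          μ (p.1, SobolevDiff.param p.2))
        (Set.univ ×ˢ Set.range (SobolevDiff.chart (n := n) (s := s)))) ∧
    (∃ inv : SobolevDiff.Diffeo n (s + r) → SobolevDiff.Diffeo n s,
      (∀ φ, (inv φ).1 = φ.1.symm) ∧
      ContDiffOn ℝ r (fun w : SobolevDiff.SobolevVec n n (s + r) =>
          SobolevDiff.chart (inv (SobolevDiff.param w)))
        (Set.range (SobolevDiff.chart (n := n) (s := s + r)))) := by
  obtain ⟨σ, rfl⟩ : ∃ σ, s = σ + 1 := by
    refine ⟨s - 1, (Nat.sub_add_cancel ?_).symm⟩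
    have h1 : (0 : ℝ) ≤ n := Nat.cast_nonneg n
    have h2 : (0 : ℝ) < s := by linarith
    exact_mod_cast h2
  have hσ : n < 2 * σ := by
    push_cast at hs
    have h1 : (n : ℝ) < 2 * σ := by linarith
    exact_mod_cast h1
  have hm : σ + 1 ≤ σ + 1 + r := Nat.le_add_right _ _
  exact ⟨SobolevDiff.isOpen_range_chart hσ le_rfl, SobolevDiff.isOpen_range_chart hσ hm,
    ⟨SobolevDiff.comp hm, SobolevDiff.toMap_comp hσ hm, SobolevDiff.contDiffOn_comp hσ hm le_rfl⟩,
    SobolevDiff.inversion hm, SobolevDiff.coe_inversion hσ hm,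
    SobolevDiff.contDiffOn_inversion hσ hm le_rfl⟩
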